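/- Let $M$ be a smooth manifold of dimension $2m$ and let $(\Omega,\omega)$ be a locally conformal symplectic structure on $M$ with its Lee form: $\Omega$ is a non-degenerate $2$-form and $\omega$ is a closed $1$-form with $d\Omega=\omega\wedge\Omega$. Write $\Omega^k(M)$ for the space of smooth $k$-forms on $M$ ($k\in\mathbb Z$), so $\Omega^k(M)=0$ for $k<0$ and for $k>2m$. Let $\flat(X)=i_X\Omega$, and let $\Lambda(\alpha,\beta)=\Omega(\flat^{-1}\alpha,\flat^{-1}\beta)$ and $E=\flat^{-1}(\omega)$ be the associated Jacobi structure. Define $\#_\Lambda$ on $1$-forms by $\beta(\#_\Lambda\alpha)=\Lambda(\alpha,\beta)$ and from $k$-forms to $k$-vectors by $(\#_\Lambda\alpha)(\alpha_1,\dots,\alpha_k)=(-1)^k\alpha(\#_\Lambda\alpha_1,\dots,\#_\Lambda\alpha_k)$, with $\#_\Lambda f=f$ for functions. Contraction by multivectors is determined by $i(X_1\wedge\dots\wedge X_k)\mu=\mu(X_1,\dots,X_k,\cdot,\dots,\cdot)$, and the star operator $\star:\Omega^k(M)\to\Omega^{2m-k}(M)$ is $$\star\alpha=(-1)^k\, i(\#_\Lambda\alpha)\,\frac{\Omega^m}{m!}.$$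 For $(\alpha,\beta)\in\Omega^k(M)\oplus\Omega^{k-1}(M)$ put $$\delta(\alpha,\beta)=\bigl(i(\Lambda)d\alpha-d\,i(\Lambda)\alpha+k\,i_E\alpha+(-1)^k\mathcal L_E\beta,\ \ i(\Lambda)d\beta-d\,i(\Lambda)\beta+(k-1)\,i_E\beta+(-1)^k i(\Lambda)\alpha\bigr),$$ $$\tilde d(\alpha,\beta)=\bigl(d\alpha+\omega_1\wedge\alpha-\Omega\wedge\beta,\ -(d\beta+\omega_0\wedge\beta)\bigr),\qquad \omega_0=-m\,\omega,\quad \omega_1=-(m+1)\,\omega,$$ $$\tilde\phi_k(\alpha,\beta)=\bigl(\star\beta,\ i_E(\star\beta)-\star\alpha\bigr).$$ Let $H_k^{LJ}(M)$ be the $k$-th homology of the complex $(\Omega^k(M)\oplus\Omega^{k-1}(M),\delta)$, where $\delta$ lowers $k$ by one, and let $\tilde H^k(M)$ be the $k$-th cohomology of the complex $(\Omega^k(M)\oplus\Omega^{k-1}(M),\tilde d)$, where $\tilde d$ raises $k$ by one. Then for every integer $k$: 1. $\tilde\phi_k$ is an isomorphism of $C^\infty(M,\mathbb R)$-modules from $\Omega^k(M)\oplus\Omega^{k-1}(M)$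 onto $\Omega^{2m+1-k}(M)\oplus\Omega^{2m-k}(M)$. 2. For all $(\alpha,\beta)\in\Omega^k(M)\oplus\Omega^{k-1}(M)$ one has $\delta(\alpha,\beta)\in\Omega^{k-1}(M)\oplus\Omega^{k-2}(M)$ and $$\tilde\phi_{k-1}(\delta(\alpha,\beta))=(-1)^k\,\tilde d(\tilde\phi_k(\alpha,\beta)).$$ 3. Consequently $\tilde\phi_k$ induces an isomorphism of real vector spaces $$H_k^{LJ}(M)\cong\tilde H^{2m+1-k}(M).$$ -/

import Mathlib

set_option maxSynthPendingDepth 3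

open scoped Manifold ContDiff

noncomputable section

namespace LCSForms

/-! ## Multilinear algebra on one tangent space

The tangent space of a `d`-manifold modelled on `EuclideanSpace ℝ (Fin d)` is by definition
`EuclideanSpace ℝ (Fin d)`. -/

/-- The model vector space `ℝᵈ`. -/
abbrev Vec (d : ℕ) : Type := EuclideanSpace ℝ (Fin d)

/-- Inhomogeneous alternating forms on `ℝᵈ`: the `n`-th entry is the component of degree `n`. -/
abbrev Alt (d : ℕ) : Type := ∀ n : ℕ, (Vec d) [⋀^Fin n]→L[ℝ] ℝ

/-- Covectors, regarded as alternating forms of degree one. -/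
abbrev Cov (d : ℕ) : Type := (Vec d) [⋀^Fin 1]→L[ℝ] ℝ

/-- `k`-vectors, regarded as alternating `k`-forms on the space of covectors. -/
abbrev MultiVec (d k : ℕ) : Type := (Cov d) [⋀^Fin k]→L[ℝ] ℝ

variable {d : ℕ}

/-- The multilinear map `v ↦ α (v₁, …, v_p) * β (v_{p+1}, …, v_{p+q})`. -/
def tensorMul {p q n : ℕ} (h : p + q = n) (α : (Vec d) [⋀^Fin p]→L[ℝ] ℝ)
    (β : (Vec d) [⋀^Fin q]→L[ℝ] ℝ) :
    ContinuousMultilinearMap ℝ (fun _ : Fin n => Vec d) ℝ where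
  toMultilinearMap :=
    ((LinearMap.mul' ℝ ℝ).compMultilinearMap
      (α.toMultilinearMap.domCoprod β.toMultilinearMap)).domDomCongr
        (finSumFinEquiv.trans (finCongr h))
  cont := by
    have h1 : Continuous fun v : Fin n → Vec d =>
        α (fun i => v (finCongr h (finSumFinEquiv (Sum.inl i)))) *
          β (fun j => v (finCongr h (finSumFinEquiv (Sum.inr j)))) :=
      Continuous.mul
        (α.coe_continuous.comp (continuous_pi fun i : Fin p =>
          continuous_apply (finCongr h (finSumFinEquiv (Sum.inl i)))))
        (β.coe_continuous.comp (continuous_pi fun i : Fin q =>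
          continuous_apply (finCongr h (finSumFinEquiv (Sum.inr i)))))
    exact h1

theorem tensorMul_apply {p q n : ℕ} (h : p + q = n) (α : (Vec d) [⋀^Fin p]→L[ℝ] ℝ)
    (β : (Vec d) [⋀^Fin q]→L[ℝ] ℝ) (v : Fin n → Vec d) :
    tensorMul h α β v =
      α (fun i => v (Fin.cast h (Fin.castAdd q i))) *
        β (fun j => v (Fin.cast h (Fin.natAdd p j))) := rfl

/-- Wedge product of a `p`-form and a `q`-form, normalised so that for one-forms
`(α ∧ β)(X, Y) = α(X) β(Y) - α(Y) β(X)`. -/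
def wedgeHom {p q n : ℕ} (h : p + q = n) (α : (Vec d) [⋀^Fin p]→L[ℝ] ℝ)
    (β : (Vec d) [⋀^Fin q]→L[ℝ] ℝ) : (Vec d) [⋀^Fin n]→L[ℝ] ℝ :=
  ((p.factorial : ℝ) * (q.factorial : ℝ))⁻¹ •
    ContinuousMultilinearMap.alternatization (tensorMul h α β)

/-- Wedge product of inhomogeneous forms. -/
def wedge (α β : Alt d) : Alt d := fun n =>
  ∑ p : Fin (n + 1), wedgeHom (p := (p : ℕ)) (q := n - p)
    (Nat.add_sub_cancel' (Nat.lt_succ_iff.mp p.isLt)) (α p) (β (n - p))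

/-- The constant form `1` of degree zero. -/
def oneForm : Alt d := Pi.single 0 (ContinuousAlternatingMap.constOfIsEmpty ℝ (Vec d) (Fin 0) 1)

/-- Interior product `i_X α = α(X, ·, …, ·)`. -/
def interior (X : Vec d) (α : Alt d) : Alt d := fun n => (α (n + 1)).curryLeft X

/-- Iterated interior product `i_{X_{k-1}} ⋯ i_{X_0} α = α(X_0, …, X_{k-1}, ·, …, ·)`. -/
def interiorMulti : (k : ℕ) → (Fin k → Vec d) → Alt d → Alt d
  | 0, _, α => α
  | k + 1, X, α => interiorMulti k (Fin.tail X) (interior (X 0) α)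

/-- The standard basis of `ℝᵈ`. -/
def stdVec (i : Fin d) : Vec d := EuclideanSpace.single i 1

/-- The dual basis. -/
def stdCov (i : Fin d) : Cov d :=
  ContinuousAlternatingMap.ofSubsingleton ℝ (Vec d) ℝ (0 : Fin 1)
    (EuclideanSpace.proj i : Vec d →L[ℝ] ℝ)

/-- Contraction `i(P)α` of a form by a `k`-vector, the linear extension of
`i(X_1 ∧ ⋯ ∧ X_k) α = α(X_1, …, X_k, ·, …, ·)`; in terms of a basis, with components
`P^{i_1 ⋯ i_k} = P(e^{i_1}, …, e^{i_k})`, it is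
`(1 / k!) ∑ P^{i_1 ⋯ i_k} α(e_{i_1}, …, e_{i_k}, ·, …, ·)`. -/
def contract {k : ℕ} (P : MultiVec d k) (α : Alt d) : Alt d :=
  (k.factorial : ℝ)⁻¹ • ∑ I : Fin k → Fin d,
    P (fun j => stdCov (I j)) • interiorMulti k (fun j => stdVec (I j)) α

/-- The musical map `♭(X) = i_X Ω` of a two-form. -/
def flat (Ω : (Vec d) [⋀^Fin 2]→L[ℝ] ℝ) : Vec d →L[ℝ] Cov d := Ω.curryLeft

/-- `♭⁻¹`; this is the inverse of `♭` for a nondegenerate two-form (and zero otherwise). -/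
def flatInv (Ω : (Vec d) [⋀^Fin 2]→L[ℝ] ℝ) : Cov d →L[ℝ] Vec d := (flat Ω).inverse

/-- The bivector `Λ(α, β) = Ω(♭⁻¹ α, ♭⁻¹ β)` of a nondegenerate two-form. -/
def bivector (Ω : (Vec d) [⋀^Fin 2]→L[ℝ] ℝ) : MultiVec d 2 :=
  Ω.compContinuousLinearMap (flatInv Ω)

/-- The map `#_Λ` from covectors to vectors, `β(#_Λ α) = Λ(α, β)`. -/
def sharp (Λ : MultiVec d 2) : Cov d →L[ℝ] Vec d :=
  ∑ i : Fin d, (Λ.toContinuousLinearMap ![0, stdCov i] 0).smulRight (stdVec i)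

/-- The map `#_Λ` from `k`-forms to `k`-vectors,
`(#_Λ α)(α_1, …, α_k) = (-1)^k α(#_Λ α_1, …, #_Λ α_k)`. -/
def sharpForm (Λ : MultiVec d 2) {k : ℕ} (α : (Vec d) [⋀^Fin k]→L[ℝ] ℝ) : MultiVec d k :=
  (-1 : ℝ) ^ k • α.compContinuousLinearMap (sharp Λ)

/-- The form `Ω^m / m!`, for `Ω` homogeneous of degree two. -/
def liouville (m : ℕ) (Ω : Alt d) : Alt d := (m.factorial : ℝ)⁻¹ • (wedge Ω)^[m] oneForm

/-- The star operator of a nondegenerate two-form `Ω` on a space of dimension `2m`: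
`⋆ α = (-1)^k i(#_Λ α) (Ω^m / m!)` on forms of degree `k`, extended additively to inhomogeneous
forms. -/
def star (m : ℕ) (Ω : Alt (2 * m)) (α : Alt (2 * m)) : Alt (2 * m) :=
  ∑ k ∈ Finset.range (2 * m + 1),
    (-1 : ℝ) ^ k • contract (sharpForm (bivector (Ω 2)) (α k)) (liouville m Ω)

/-! ### Elementary facts -/

theorem interiorMulti_add (k : ℕ) (X : Fin k → Vec d) (α β : Alt d) :
    interiorMulti k X (α + β) = interiorMulti k X α + interiorMulti k X β := by
  induction k generalizing α β with
  | zero => rfl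
  | succ k ih =>
    simp only [interiorMulti]
    rw [← ih]
    rfl

theorem interiorMulti_smul (k : ℕ) (X : Fin k → Vec d) (c : ℝ) (α : Alt d) :
    interiorMulti k X (c • α) = c • interiorMulti k X α := by
  induction k generalizing α with
  | zero => rfl
  | succ k ih =>
    simp only [interiorMulti]
    rw [← ih]
    rfl

theorem interior_add (X : Vec d) (α β : Alt d) :
    interior X (α + β) = interior X α + interior X β := rfl

theorem interior_smul (X : Vec d) (c : ℝ) (α : Alt d) :
    interior X (c • α) = c • interior X α := rfl

theorem contract_add {k : ℕ} (P : MultiVec d k) (α β : Alt d) :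
    contract P (α + β) = contract P α + contract P β := by
  simp only [contract, interiorMulti_add, smul_add, Finset.sum_add_distrib]

theorem contract_smul {k : ℕ} (P : MultiVec d k) (c : ℝ) (α : Alt d) :
    contract P (c • α) = c • contract P α := by
  simp only [contract, interiorMulti_smul, smul_comm _ c, Finset.smul_sum]

theorem wedgeHom_add {p q n : ℕ} (h : p + q = n) (α : (Vec d) [⋀^Fin p]→L[ℝ] ℝ)
    (β γ : (Vec d) [⋀^Fin q]→L[ℝ] ℝ) :
    wedgeHom h α (β + γ) = wedgeHom h α β + wedgeHom h α γ := by
  have : tensorMul h α (β + γ) = tensorMul h α β + tensorMul h α γ := by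
    ext v
    simp [tensorMul_apply, mul_add]
  rw [wedgeHom, this, map_add, smul_add]
  rfl

theorem wedgeHom_smul {p q n : ℕ} (h : p + q = n) (α : (Vec d) [⋀^Fin p]→L[ℝ] ℝ)
    (c : ℝ) (β : (Vec d) [⋀^Fin q]→L[ℝ] ℝ) :
    wedgeHom h α (c • β) = c • wedgeHom h α β := by
  ext v
  simp only [wedgeHom, ContinuousAlternatingMap.smul_apply,
    ContinuousMultilinearMap.alternatization_apply_apply, tensorMul_apply, smul_eq_mul,
    Finset.mul_sum]
  refine Finset.sum_congr rfl fun σ _ => ?_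
  simp only [Units.smul_def, zsmul_eq_mul]
  ring

theorem wedge_add (α β γ : Alt d) : wedge α (β + γ) = wedge α β + wedge α γ := by
  funext n
  simp only [wedge, Pi.add_apply, wedgeHom_add, Finset.sum_add_distrib]

theorem wedge_smul (α : Alt d) (c : ℝ) (β : Alt d) : wedge α (c • β) = c • wedge α β := by
  funext n
  simp only [wedge, Pi.smul_apply, wedgeHom_smul, Finset.smul_sum]

theorem stdCov_apply (i : Fin d) (v : Fin 1 → Vec d) : stdCov i v = v 0 i := rfl

theorem interior_apply (X : Vec d) (α : Alt d) (n : ℕ) (v : Fin n → Vec d) :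
    interior X α n v = α (n + 1) (Fin.cons X v) := rfl

/-- The contraction by a bivector in coordinates. -/
theorem contract_two_apply (P : MultiVec d 2) (α : Alt d) (n : ℕ) (v : Fin n → Vec d) :
    contract P α n v = (2 : ℝ)⁻¹ * ∑ i : Fin d, ∑ j : Fin d,
      P ![stdCov i, stdCov j] * α (n + 2) (Fin.cons (stdVec i) (Fin.cons (stdVec j) v)) := by
  have key : ∀ I : Fin 2 → Fin d,
      (P (fun j => stdCov (I j)) • interiorMulti 2 (fun j => stdVec (I j)) α) n v =
      P ![stdCov (I 0), stdCov (I 1)] *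
        α (n + 2) (Fin.cons (stdVec (I 0)) (Fin.cons (stdVec (I 1)) v)) := by
    intro I
    have : (fun j => stdCov (I j)) = ![stdCov (I 0), stdCov (I 1)] := by
      funext j
      fin_cases j <;> rfl
    rw [this]
    rfl
  have h1 : contract P α n v = (2 : ℝ)⁻¹ * ∑ I : Fin 2 → Fin d,
      (P (fun j => stdCov (I j)) • interiorMulti 2 (fun j => stdVec (I j)) α) n v := by
    simp [contract, Finset.sum_apply, ContinuousAlternatingMap.sum_apply]
  rw [h1, Finset.sum_congr rfl fun I _ => key I,
    ← Fintype.sum_prod_type' (f := fun i j : Fin d => P ![stdCov i, stdCov j] *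
      α (n + 2) (Fin.cons (stdVec i) (Fin.cons (stdVec j) v)))]
  congr 1
  exact Fintype.sum_equiv (finTwoArrowEquiv (Fin d)) _ _ fun I => rfl

/-- Nondegeneracy of a two-form. -/
def Nondeg (Ω : (Vec d) [⋀^Fin 2]→L[ℝ] ℝ) : Prop :=
  ∀ X : Vec d, (∀ Y : Vec d, Ω ![X, Y] = 0) → X = 0

theorem Nondeg.isInvertible_flat {Ω : (Vec d) [⋀^Fin 2]→L[ℝ] ℝ} (h : Nondeg Ω) :
    (flat Ω).IsInvertible := by
  have hinj : Function.Injective (flat Ω).toLinearMap := by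
    rw [← LinearMap.ker_eq_bot, LinearMap.ker_eq_bot']
    intro X hX
    refine h X fun Y => ?_
    have := congrArg (fun c : Cov d => c ![Y]) hX
    exact this
  let e : (Vec d →L[ℝ] ℝ) ≃ₗ[ℝ] Cov d :=
    (ContinuousAlternatingMap.ofSubsingletonLIE (𝕜 := ℝ) (E := Vec d) (F := ℝ)
      (0 : Fin 1)).toLinearEquiv
  have : FiniteDimensional ℝ (Cov d) := e.finiteDimensional
  have hrank : Module.finrank ℝ (Vec d) = Module.finrank ℝ (Cov d) := by
    rw [← e.finrank_eq, ← (LinearMap.toContinuousLinearMap (𝕜 := ℝ) (E := Vec d)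
      (F' := ℝ)).finrank_eq]
    exact (Subspace.dual_finrank_eq).symm
  refine ⟨(LinearEquiv.ofBijective (flat Ω).toLinearMap
    ⟨hinj, (LinearMap.injective_iff_surjective_of_finrank_eq_finrank hrank).mp
      hinj⟩).toContinuousLinearEquiv, ?_⟩
  ext X
  rfl

theorem Nondeg.pull {Ω : (Vec d) [⋀^Fin 2]→L[ℝ] ℝ} (h : Nondeg Ω) (T : Vec d ≃L[ℝ] Vec d) :
    Nondeg (Ω.compContinuousLinearMap (T : Vec d →L[ℝ] Vec d)) := by
  intro X hX
  have : T X = 0 := by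
    refine h _ fun Y => ?_
    have := hX (T.symm Y)
    rw [ContinuousAlternatingMap.compContinuousLinearMap_apply] at this
    rw [← this]
    congr 1
    funext i
    fin_cases i <;> simp
  simpa using this

theorem flatInv_pull {Ω : (Vec d) [⋀^Fin 2]→L[ℝ] ℝ} (h : Nondeg Ω) (T : Vec d ≃L[ℝ] Vec d)
    (c : Cov d) :
    flatInv (Ω.compContinuousLinearMap (T : Vec d →L[ℝ] Vec d))
      (c.compContinuousLinearMap (T : Vec d →L[ℝ] Vec d)) = T.symm (flatInv Ω c) := by
  rw [flatInv, (h.pull T).isInvertible_flat.inverse_apply_eq]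
  have h1 : flat Ω (flatInv Ω c) = c := h.isInvertible_flat.self_apply_inverse c
  conv_lhs => rw [← h1]
  ext v
  have : ∀ X : Vec d, (Fin.cons (T X) (fun i => T (v i)) : Fin 2 → Vec d) =
      fun i => T ((Fin.cons X v : Fin 2 → Vec d) i) := by
    intro X
    funext i
    refine Fin.cases ?_ (fun j => ?_) i <;> simp
  have h2 := this (T.symm (flatInv Ω c))
  rw [T.apply_symm_apply] at h2
  change Ω (Fin.cons (flatInv Ω c) (fun i => T (v i))) = Ω _
  rw [h2]
  rfl

theorem sum_stdVec (X : Vec d) : X = ∑ i, X i • stdVec i := by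
  ext j
  simp [stdVec, Finset.sum_apply, Pi.single_apply]

/-- The canonical tensor `∑ e^i ⊗ e_i` does not depend on the basis. -/
theorem sum_pull (T : Vec d ≃L[ℝ] Vec d) (F : Cov d →ₗ[ℝ] ℝ) (G : Vec d →ₗ[ℝ] ℝ) :
    ∑ i, F ((stdCov i).compContinuousLinearMap (T.symm : Vec d →L[ℝ] Vec d)) * G (T (stdVec i)) =
      ∑ i, F (stdCov i) * G (stdVec i) := by
  have h1 : ∀ a : Fin d, stdCov a = ∑ i, (T (stdVec i)) a •
      (stdCov i).compContinuousLinearMap (T.symm : Vec d →L[ℝ] Vec d) := by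
    intro a
    ext v
    have h2 : v 0 = T (T.symm (v 0)) := (T.apply_symm_apply _).symm
    rw [ContinuousAlternatingMap.sum_apply, stdCov_apply, h2]
    conv_lhs => rw [sum_stdVec (T.symm (v 0)), map_sum]
    simp [stdCov_apply, Finset.sum_apply, mul_comm]
  have h3 : ∀ i, G (T (stdVec i)) = ∑ a, (T (stdVec i)) a * G (stdVec a) := by
    intro i
    conv_lhs => rw [sum_stdVec (T (stdVec i)), map_sum]
    simp
  calc _ = ∑ i, ∑ a, F ((stdCov i).compContinuousLinearMap (T.symm : Vec d →L[ℝ] Vec d)) *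
        ((T (stdVec i)) a * G (stdVec a)) := by
        simp only [h3, Finset.mul_sum]
    _ = ∑ a, (∑ i, (T (stdVec i)) a *
        F ((stdCov i).compContinuousLinearMap (T.symm : Vec d →L[ℝ] Vec d))) * G (stdVec a) := by
        rw [Finset.sum_comm]
        refine Finset.sum_congr rfl fun a _ => ?_
        rw [Finset.sum_mul]
        exact Finset.sum_congr rfl fun i _ => by ring
    _ = _ := by
        refine Finset.sum_congr rfl fun a _ => ?_
        conv_rhs => rw [h1 a, map_sum]
        simp

/-- Pull-back of inhomogeneous forms by a linear isomorphism. -/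
def pull (T : Vec d ≃L[ℝ] Vec d) (α : Alt d) : Alt d := fun n =>
  (α n).compContinuousLinearMap (T : Vec d →L[ℝ] Vec d)

theorem pull_interior (T : Vec d ≃L[ℝ] Vec d) (X : Vec d) (α : Alt d) :
    pull T (interior X α) = interior (T.symm X) (pull T α) := by
  funext n
  ext v
  change α (n + 1) (Fin.cons X fun i => T (v i)) =
    α (n + 1) (fun i => T ((Fin.cons (T.symm X) v : Fin (n + 1) → Vec d) i))
  congr 1
  funext i
  refine Fin.cases ?_ (fun j => ?_) i <;> simp

theorem pull_contract_bivector (T : Vec d ≃L[ℝ] Vec d) {Ω : (Vec d) [⋀^Fin 2]→L[ℝ] ℝ}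
    (h : Nondeg Ω) (α : Alt d) :
    pull T (contract (bivector Ω) α) =
      contract (bivector (Ω.compContinuousLinearMap (T : Vec d →L[ℝ] Vec d))) (pull T α) := by
  funext n
  ext v
  set w : Fin n → Vec d := fun i => T (v i) with hw
  have hL : pull T (contract (bivector Ω) α) n v = contract (bivector Ω) α n w := rfl
  rw [hL, contract_two_apply, contract_two_apply]
  congr 1
  have hc : ∀ c : Cov d, flatInv (Ω.compContinuousLinearMap (T : Vec d →L[ℝ] Vec d)) c =
      T.symm (flatInv Ω (c.compContinuousLinearMap (T.symm : Vec d →L[ℝ] Vec d))) := by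
    intro c
    rw [← flatInv_pull h T]
    congr 1
    ext v
    simp [ContinuousAlternatingMap.compContinuousLinearMap_apply, Function.comp_def]
  have hA : ∀ i j, bivector (Ω.compContinuousLinearMap (T : Vec d →L[ℝ] Vec d))
      ![stdCov i, stdCov j] =
      bivector Ω ![(stdCov i).compContinuousLinearMap (T.symm : Vec d →L[ℝ] Vec d),
        (stdCov j).compContinuousLinearMap (T.symm : Vec d →L[ℝ] Vec d)] := by
    intro i j
    simp only [bivector, ContinuousAlternatingMap.compContinuousLinearMap_apply]
    congr 1
    funext a
    fin_cases a <;> simp [hc]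
  have hB : ∀ i j, pull T α (n + 2) (Fin.cons (stdVec i) (Fin.cons (stdVec j) v)) =
      α (n + 2) (Fin.cons (T (stdVec i)) (Fin.cons (T (stdVec j)) w)) := by
    intro i j
    simp only [pull, ContinuousAlternatingMap.compContinuousLinearMap_apply]
    congr 1
    funext a
    refine Fin.cases ?_ (fun a => Fin.cases ?_ (fun a => ?_) a) a <;> simp [hw]
  simp only [hA, hB]
  -- the two bilinear maps
  let F1 (c' : Cov d) : Cov d →ₗ[ℝ] ℝ :=
    { toFun := fun c => bivector Ω ![c, c']
      map_add' := fun a b => (bivector Ω).map_vecCons_add ![c'] a b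
      map_smul' := fun r a => (bivector Ω).map_vecCons_smul ![c'] r a }
  let F2 (c : Cov d) : Cov d →ₗ[ℝ] ℝ :=
    ((bivector Ω).curryLeft c).toContinuousLinearMap (fun _ => 0) 0
  have hF2 : ∀ c c', F2 c c' = bivector Ω ![c, c'] := by
    intro c c'
    change bivector Ω (Fin.cons c (Function.update (fun _ => 0) 0 c')) = _
    congr 1
    funext a
    fin_cases a <;> rfl
  let G1 (Y : Vec d) : Vec d →ₗ[ℝ] ℝ :=
    { toFun := fun X => α (n + 2) (Fin.cons X (Fin.cons Y w))
      map_add' := fun a b => (α (n + 2)).toContinuousMultilinearMap.cons_add (Fin.cons Y w) a b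
      map_smul' := fun r a =>
        (α (n + 2)).toContinuousMultilinearMap.cons_smul (Fin.cons Y w) r a }
  let G2 (X : Vec d) : Vec d →ₗ[ℝ] ℝ :=
    { toFun := fun Y => α (n + 2) (Fin.cons X (Fin.cons Y w))
      map_add' := fun a b =>
        ((α (n + 2)).curryLeft X).toContinuousMultilinearMap.cons_add w a b
      map_smul' := fun r a =>
        ((α (n + 2)).curryLeft X).toContinuousMultilinearMap.cons_smul w r a }
  symm
  calc _ = ∑ i, ∑ j, F2 ((stdCov i).compContinuousLinearMap (T.symm : Vec d →L[ℝ] Vec d))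
          ((stdCov j).compContinuousLinearMap (T.symm : Vec d →L[ℝ] Vec d)) *
        G2 (T (stdVec i)) (T (stdVec j)) := by simp only [hF2]; rfl
    _ = ∑ i, ∑ j, F2 ((stdCov i).compContinuousLinearMap (T.symm : Vec d →L[ℝ] Vec d))
          (stdCov j) * G2 (T (stdVec i)) (stdVec j) :=
        Finset.sum_congr rfl fun i _ => sum_pull T _ _
    _ = ∑ j, ∑ i, F1 (stdCov j) ((stdCov i).compContinuousLinearMap
          (T.symm : Vec d →L[ℝ] Vec d)) * G1 (stdVec j) (T (stdVec i)) := by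
        rw [Finset.sum_comm]
        simp only [hF2]
        rfl
    _ = ∑ j, ∑ i, F1 (stdCov j) (stdCov i) * G1 (stdVec j) (stdVec i) :=
        Finset.sum_congr rfl fun j _ => sum_pull T _ _
    _ = _ := by
        rw [Finset.sum_comm]
        rfl

/-! ## Differential forms on a manifold -/

section Manifold

variable {M : Type*} [TopologicalSpace M] [ChartedSpace (Vec d) M]

/-- The pull-back of the degree `n` component of a field of forms `α` under the inverse of the
chart at `x₀`; it is a field of `n`-forms on the target of that chart, an open subset of `ℝᵈ`. -/
def chartRep (x₀ : M) (α : M → Alt d) (n : ℕ) (y : Vec d) : (Vec d) [⋀^Fin n]→L[ℝ] ℝ :=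
  (α ((extChartAt (𝓡 d) x₀).symm y) n).compContinuousLinearMap
    (mfderiv 𝓘(ℝ, Vec d) (𝓡 d) (extChartAt (𝓡 d) x₀).symm y : Vec d →L[ℝ] Vec d)

/-- A field of forms is smooth if all its chart representatives are smooth. -/
def IsSmooth (α : M → Alt d) : Prop :=
  ∀ (x₀ : M) (n : ℕ), ContDiffOn ℝ ∞ (chartRep x₀ α n) (extChartAt (𝓡 d) x₀).target

/-- The exterior derivative: at `x` it is computed in the chart at `x`. -/
def extD (α : M → Alt d) : M → Alt d := fun x n =>
  match n with
  | 0 => 0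
  | n + 1 => (extDeriv (chartRep x α n) (extChartAt (𝓡 d) x x)).compContinuousLinearMap
      (mfderiv (𝓡 d) 𝓘(ℝ, Vec d) (extChartAt (𝓡 d) x) x : Vec d →L[ℝ] Vec d)

/-- The space `Ωᵏ(M)` of smooth `k`-forms, for an integer `k`; it is zero for negative `k`. -/
def Forms (d : ℕ) (M : Type*) [TopologicalSpace M] [ChartedSpace (Vec d) M] (k : ℤ) :
    Submodule ℝ (M → Alt d) where
  carrier := {α | IsSmooth α ∧ ∀ (x : M) (n : ℕ), (n : ℤ) ≠ k → α x n = 0}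
  zero_mem' := ⟨fun _ _ => contDiffOn_const (c := 0), fun _ _ _ => rfl⟩
  add_mem' := by
    rintro α β ⟨hα, hα'⟩ ⟨hβ, hβ'⟩
    refine ⟨fun x₀ n => (hα x₀ n).add (hβ x₀ n), fun x n hn => ?_⟩
    simp [hα' x n hn, hβ' x n hn]
  smul_mem' := by
    rintro c α ⟨hα, hα'⟩
    refine ⟨fun x₀ n => (hα x₀ n).const_smul c, fun x n hn => ?_⟩
    simp [hα' x n hn]

/-- Interior product of a field of forms by a vector field. -/
def intF (X : M → Vec d) (α : M → Alt d) : M → Alt d := fun x => interior (X x) (α x)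

/-- Contraction `i(P)` of a field of forms by a field of `k`-vectors. -/
def contractF {k : ℕ} (P : M → MultiVec d k) (α : M → Alt d) : M → Alt d :=
  fun x => contract (P x) (α x)

/-- Wedge product of fields of forms. -/
def wedgeF (α β : M → Alt d) : M → Alt d := fun x => wedge (α x) (β x)

/-- The Lie derivative of forms along a vector field, `L_X = d ∘ i_X + i_X ∘ d`. -/
def lieD (X : M → Vec d) (α : M → Alt d) : M → Alt d :=
  extD (intF X α) + intF X (extD α)

/-- Pairs `(α, β)` of fields of forms. -/
abbrev Pairs (d : ℕ) (M : Type*) : Type _ := (M → Alt d) × (M → Alt d)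

/-- The space `Ωᵏ(M) ⊕ Ωᵏ⁻¹(M)`. -/
def PairForms (d : ℕ) (M : Type*) [TopologicalSpace M] [ChartedSpace (Vec d) M] (k : ℤ) :
    Submodule ℝ (Pairs d M) :=
  (Forms d M k).prod (Forms d M (k - 1))

/-- The Lichnerowicz–Jacobi operator `δ` of a bivector field `Λ` and a vector field `E`, on pairs
in `Ωᵏ(M) ⊕ Ωᵏ⁻¹(M)`:
`δ(α, β) = (i(Λ) dα - d i(Λ) α + k i_E α + (-1)ᵏ L_E β,
  i(Λ) dβ - d i(Λ) β + (k - 1) i_E β + (-1)ᵏ i(Λ) α)`. -/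
def ljOp (Λ : M → MultiVec d 2) (E : M → Vec d) (k : ℤ) (p : Pairs d M) : Pairs d M :=
  (contractF Λ (extD p.1) - extD (contractF Λ p.1) + (k : ℝ) • intF E p.1 +
      (-1 : ℝ) ^ k • lieD E p.2,
    contractF Λ (extD p.2) - extD (contractF Λ p.2) + ((k : ℝ) - 1) • intF E p.2 +
      (-1 : ℝ) ^ k • contractF Λ p.1)

/-- The twisted differential `d_θ α = dα + θ ∧ α`. -/
def twistedD (θ α : M → Alt d) : M → Alt d := extD α + wedgeF θ α

end Manifold

/-- A locally conformal symplectic structure on a `2m`-dimensional manifold, with its Lee form: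
a nondegenerate two-form `Ω` and a closed one-form `ω` such that `dΩ = ω ∧ Ω`. -/
structure LCSStructure (m : ℕ) (M : Type*) [TopologicalSpace M] [ChartedSpace (Vec (2 * m)) M] where
  /-- The two-form. -/
  Ω : M → Alt (2 * m)
  /-- The Lee one-form. -/
  lee : M → Alt (2 * m)
  Ω_mem : Ω ∈ Forms (2 * m) M 2
  lee_mem : lee ∈ Forms (2 * m) M 1
  nondeg : ∀ x, Nondeg (Ω x 2)
  closed : extD lee = 0
  extD_Ω : extD Ω = wedgeF lee Ω

namespace LCSStructure

variable {m : ℕ} {M : Type*} [TopologicalSpace M] [ChartedSpace (Vec (2 * m)) M]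

/-- The bivector field `Λ` of the associated Jacobi structure. -/
def Λ (S : LCSStructure m M) (x : M) : MultiVec (2 * m) 2 := bivector (S.Ω x 2)

/-- The vector field `E = ♭⁻¹(ω)` of the associated Jacobi structure. -/
def E (S : LCSStructure m M) (x : M) : Vec (2 * m) := flatInv (S.Ω x 2) (S.lee x 1)

/-- The star operator on fields of forms. -/
def starF (S : LCSStructure m M) (α : M → Alt (2 * m)) : M → Alt (2 * m) :=
  fun x => star m (S.Ω x) (α x)

/-- The map `φ̃(α, β) = (⋆β, i_E ⋆β - ⋆α)`. -/
def phi (S : LCSStructure m M) (p : Pairs (2 * m) M) : Pairs (2 * m) M :=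
  (S.starF p.2, intF S.E (S.starF p.2) - S.starF p.1)

/-- The operator `δ` of the associated Jacobi structure on `Ωᵏ(M) ⊕ Ωᵏ⁻¹(M)`. -/
def delta (S : LCSStructure m M) (k : ℤ) (p : Pairs (2 * m) M) : Pairs (2 * m) M :=
  ljOp S.Λ S.E k p

/-- The one-form `ω₀ = -m ω`. -/
def lee₀ (S : LCSStructure m M) : M → Alt (2 * m) := (-(m : ℝ)) • S.lee

/-- The one-form `ω₁ = -(m + 1) ω`. -/
def lee₁ (S : LCSStructure m M) : M → Alt (2 * m) := (-((m : ℝ) + 1)) • S.lee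

/-- The operator `d̃(α, β) = (d_{ω₁} α - Ω ∧ β, -d_{ω₀} β)`. -/
def dTilde (S : LCSStructure m M) (p : Pairs (2 * m) M) : Pairs (2 * m) M :=
  (twistedD S.lee₁ p.1 - wedgeF S.Ω p.2, -twistedD S.lee₀ p.2)

end LCSStructure

/-! ### The operators are linear on smooth forms -/

section Pointwise

variable {M : Type*}

theorem intF_add (X : M → Vec d) (α β : M → Alt d) : intF X (α + β) = intF X α + intF X β := rfl

theorem intF_smul (X : M → Vec d) (c : ℝ) (α : M → Alt d) : intF X (c • α) = c • intF X α := rfl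

theorem contractF_add {k : ℕ} (P : M → MultiVec d k) (α β : M → Alt d) :
    contractF P (α + β) = contractF P α + contractF P β :=
  funext fun x => contract_add (P x) (α x) (β x)

theorem contractF_smul {k : ℕ} (P : M → MultiVec d k) (c : ℝ) (α : M → Alt d) :
    contractF P (c • α) = c • contractF P α :=
  funext fun x => contract_smul (P x) c (α x)

theorem wedgeF_add (α β γ : M → Alt d) : wedgeF α (β + γ) = wedgeF α β + wedgeF α γ :=
  funext fun x => wedge_add (α x) (β x) (γ x)

theorem wedgeF_smul (α : M → Alt d) (c : ℝ) (β : M → Alt d) :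
    wedgeF α (c • β) = c • wedgeF α β :=
  funext fun x => wedge_smul (α x) c (β x)

end Pointwise

section Linear

variable {M : Type*} [TopologicalSpace M] [ChartedSpace (Vec d) M]

theorem IsSmooth.differentiableAt {α : M → Alt d} (hα : IsSmooth α) (x : M) (n : ℕ) :
    DifferentiableAt ℝ (chartRep x α n) (extChartAt (𝓡 d) x x) :=
  ((hα x n).contDiffAt ((isOpen_extChartAt_target x).mem_nhds
    (mem_extChartAt_target x))).differentiableAt (by simp)

theorem extD_add {α β : M → Alt d} (hα : IsSmooth α) (hβ : IsSmooth β) :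
    extD (α + β) = extD α + extD β := by
  funext x n
  cases n with
  | zero => simp [extD]
  | succ n =>
    have : chartRep x (α + β) n = chartRep x α n + chartRep x β n := rfl
    simp only [extD, Pi.add_apply]
    rw [this, extDeriv_add (hα.differentiableAt x n) (hβ.differentiableAt x n)]
    rfl

theorem extD_smul (c : ℝ) (α : M → Alt d) : extD (c • α) = c • extD α := by
  funext x n
  cases n with
  | zero => simp [extD]
  | succ n =>
    have : chartRep x (c • α) n = c • chartRep x α n := rfl
    simp only [extD, Pi.smul_apply]
    rw [this, extDeriv_smul]
    rfl

theorem exists_equiv_mfderiv [IsManifold (𝓡 d) ∞ M] (x₀ : M) {y : Vec d}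
    (hy : y ∈ (extChartAt (𝓡 d) x₀).target) : ∃ T : Vec d ≃L[ℝ] Vec d,
      (T : Vec d →L[ℝ] Vec d) =
        (mfderiv 𝓘(ℝ, Vec d) (𝓡 d) (extChartAt (𝓡 d) x₀).symm y : Vec d →L[ℝ] Vec d) := by
  have : IsManifold (𝓡 d) 1 M := IsManifold.of_le (n := ∞) (by simp)
  have h := isInvertible_mfderivWithin_extChartAt_symm (I := 𝓡 d) hy
  rw [ModelWithCorners.range_eq_univ, mfderivWithin_univ] at h
  exact h

theorem chartRep_interior_flatInv [IsManifold (𝓡 d) ∞ M] {Ω θ : M → Alt d}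
    (hΩ : ∀ x, Nondeg (Ω x 2)) (α : M → Alt d) (x₀ : M) (n : ℕ) {y : Vec d}
    (hy : y ∈ (extChartAt (𝓡 d) x₀).target) :
    chartRep x₀ (intF (fun x => flatInv (Ω x 2) (θ x 1)) α) n y =
      (chartRep x₀ α (n + 1) y).curryLeft
        (flatInv (chartRep x₀ Ω 2 y) (chartRep x₀ θ 1 y)) := by
  obtain ⟨T, hT⟩ := exists_equiv_mfderiv x₀ hy
  set x := (extChartAt (𝓡 d) x₀).symm y with hx
  have h := congrFun (pull_interior T (flatInv (Ω x 2) (θ x 1)) (α x)) n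
  rw [← flatInv_pull (hΩ x) T] at h
  simp only [chartRep, ← hT, ← hx]
  exact h

theorem chartRep_contract_bivector [IsManifold (𝓡 d) ∞ M] {Ω : M → Alt d}
    (hΩ : ∀ x, Nondeg (Ω x 2)) (α : M → Alt d) (x₀ : M) (n : ℕ) {y : Vec d}
    (hy : y ∈ (extChartAt (𝓡 d) x₀).target) :
    chartRep x₀ (contractF (fun x => bivector (Ω x 2)) α) n y =
      contract (bivector (chartRep x₀ Ω 2 y)) (fun k => chartRep x₀ α k y) n := by
  obtain ⟨T, hT⟩ := exists_equiv_mfderiv x₀ hy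
  set x := (extChartAt (𝓡 d) x₀).symm y with hx
  have h := congrFun (pull_contract_bivector T (hΩ x) (α x)) n
  simp only [chartRep, ← hT, ← hx]
  exact h

theorem nondeg_chartRep [IsManifold (𝓡 d) ∞ M] {Ω : M → Alt d}
    (hΩ : ∀ x, Nondeg (Ω x 2)) (x₀ : M) {y : Vec d}
    (hy : y ∈ (extChartAt (𝓡 d) x₀).target) : Nondeg (chartRep x₀ Ω 2 y) := by
  obtain ⟨T, hT⟩ := exists_equiv_mfderiv x₀ hy
  simp only [chartRep, ← hT]
  exact (hΩ _).pull T

theorem contDiff_curryLeft (n : ℕ) :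
    ContDiff ℝ ∞ (fun α : (Vec d) [⋀^Fin (n + 1)]→L[ℝ] ℝ => α.curryLeft) :=
  ContinuousLinearMap.contDiff (𝕜 := ℝ) (n := ∞)
    (ContinuousAlternatingMap.curryLeftLI (𝕜 := ℝ) (E := Vec d) (F := ℝ)
      (n := n)).toContinuousLinearMap

theorem contDiffOn_flatInv {s : Set (Vec d)} {Ω : Vec d → (Vec d) [⋀^Fin 2]→L[ℝ] ℝ}
    (hΩ : ContDiffOn ℝ ∞ Ω s) (h : ∀ y ∈ s, Nondeg (Ω y)) :
    ContDiffOn ℝ ∞ (fun y => flatInv (Ω y)) s := by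
  intro y hy
  have h1 : ContDiffWithinAt ℝ ∞ (fun y => flat (Ω y)) s y :=
    (contDiff_curryLeft (d := d) 1).comp_contDiffWithinAt (hΩ y hy)
  exact ((h y hy).isInvertible_flat.contDiffAt_map_inverse (n := ∞)).comp_contDiffWithinAt y h1

theorem contDiffOn_curryLeft {s : Set (Vec d)} {n : ℕ}
    {α : Vec d → (Vec d) [⋀^Fin (n + 1)]→L[ℝ] ℝ} {X : Vec d → Vec d}
    (hα : ContDiffOn ℝ ∞ α s) (hX : ContDiffOn ℝ ∞ X s) :
    ContDiffOn ℝ ∞ (fun y => (α y).curryLeft (X y)) s :=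
  ContDiffOn.clm_apply ((contDiff_curryLeft (d := d) n).comp_contDiffOn hα) hX

theorem isSmooth_interior_flatInv [IsManifold (𝓡 d) ∞ M] {Ω θ α : M → Alt d}
    (hΩ : ∀ x, Nondeg (Ω x 2)) (hΩs : IsSmooth Ω) (hθ : IsSmooth θ) (hα : IsSmooth α) :
    IsSmooth (intF (fun x => flatInv (Ω x 2) (θ x 1)) α) := by
  intro x₀ n
  refine ContDiffOn.congr ?_ fun y hy => chartRep_interior_flatInv hΩ α x₀ n hy
  exact contDiffOn_curryLeft (hα x₀ (n + 1))
    ((contDiffOn_flatInv (hΩs x₀ 2) fun y hy => nondeg_chartRep hΩ x₀ hy).clm_apply (hθ x₀ 1))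

theorem bivector_apply {Ω : (Vec d) [⋀^Fin 2]→L[ℝ] ℝ} (h : Nondeg Ω) (c : Fin 2 → Cov d) :
    bivector Ω c = c 0 ![flatInv Ω (c 1)] := by
  have h1 : flat Ω (flatInv Ω (c 0)) = c 0 := h.isInvertible_flat.self_apply_inverse (c 0)
  conv_rhs => rw [← h1]
  change Ω _ = Ω _
  congr 1
  funext i
  fin_cases i <;> rfl

theorem isSmooth_contract_bivector [IsManifold (𝓡 d) ∞ M] {Ω α : M → Alt d}
    (hΩ : ∀ x, Nondeg (Ω x 2)) (hΩs : IsSmooth Ω) (hα : IsSmooth α) :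
    IsSmooth (contractF (fun x => bivector (Ω x 2)) α) := by
  intro x₀ n
  refine ContDiffOn.congr ?_ fun y hy => chartRep_contract_bivector hΩ α x₀ n hy
  simp only [contract, Pi.smul_apply, Finset.sum_apply]
  refine ContDiffOn.const_smul _ (ContDiffOn.sum fun I _ => ?_)
  refine ContDiffOn.smul (f := fun y => bivector (chartRep x₀ Ω 2 y) fun j => stdCov (I j))
    (g := fun y => interiorMulti 2 (fun j => stdVec (I j)) (fun k => chartRep x₀ α k y) n) ?_ ?_
  · refine ContDiffOn.congr (f := fun y =>
      (flatInv (chartRep x₀ Ω 2 y) (stdCov (I 1))) (I 0)) ?_ fun y hy => ?_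
    · exact (EuclideanSpace.proj (I 0) : Vec d →L[ℝ] ℝ).contDiff.comp_contDiffOn
        ((contDiffOn_flatInv (hΩs x₀ 2) fun y hy => nondeg_chartRep hΩ x₀ hy).clm_apply
          contDiffOn_const)
    · rw [bivector_apply (nondeg_chartRep hΩ x₀ hy)]
      rfl
  · exact contDiffOn_curryLeft (contDiffOn_curryLeft (hα x₀ (n + 2)) contDiffOn_const)
      contDiffOn_const

end Linear

namespace LCSStructure

variable {m : ℕ} {M : Type*} [TopologicalSpace M] [ChartedSpace (Vec (2 * m)) M]

/-- `δ : Ωᵏ(M) ⊕ Ωᵏ⁻¹(M) → Ωᵏ⁻¹(M) ⊕ Ωᵏ⁻²(M)` as a linear map; its values are regarded as pairs of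
fields of forms. -/
def deltaLin [IsManifold (𝓡 (2 * m)) ∞ M] (S : LCSStructure m M) (k : ℤ) :
    PairForms (2 * m) M k →ₗ[ℝ] Pairs (2 * m) M where
  toFun p := S.delta k p
  map_add' := by
    rintro ⟨⟨α, β⟩, hα, hβ⟩ ⟨⟨α', β'⟩, hα', hβ'⟩
    have hE : ∀ γ : M → Alt (2 * m), IsSmooth γ → IsSmooth (intF S.E γ) := fun γ h =>
      isSmooth_interior_flatInv S.nondeg S.Ω_mem.1 S.lee_mem.1 h
    have hΛ : ∀ γ : M → Alt (2 * m), IsSmooth γ → IsSmooth (contractF S.Λ γ) := fun γ h =>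
      isSmooth_contract_bivector S.nondeg S.Ω_mem.1 h
    have h1 := extD_add hα.1 hα'.1
    have h2 := extD_add hβ.1 hβ'.1
    have h3 := extD_add (hE β hβ.1) (hE β' hβ'.1)
    have h4 := extD_add (hΛ α hα.1) (hΛ α' hα'.1)
    have h5 := extD_add (hΛ β hβ.1) (hΛ β' hβ'.1)
    refine Prod.ext ?_ ?_
    · change contractF S.Λ (extD (α + α')) - extD (contractF S.Λ (α + α')) +
          (k : ℝ) • intF S.E (α + α') +
          (-1 : ℝ) ^ k • (extD (intF S.E (β + β')) + intF S.E (extD (β + β'))) =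
        (contractF S.Λ (extD α) - extD (contractF S.Λ α) + (k : ℝ) • intF S.E α +
          (-1 : ℝ) ^ k • (extD (intF S.E β) + intF S.E (extD β))) +
        (contractF S.Λ (extD α') - extD (contractF S.Λ α') + (k : ℝ) • intF S.E α' +
          (-1 : ℝ) ^ k • (extD (intF S.E β') + intF S.E (extD β')))
      rw [intF_add S.E β β', contractF_add S.Λ α α', h1, h2, h3, h4, contractF_add, intF_add,
        intF_add]
      module
    · change contractF S.Λ (extD (β + β')) - extD (contractF S.Λ (β + β')) +
          ((k : ℝ) - 1) • intF S.E (β + β') + (-1 : ℝ) ^ k • contractF S.Λ (α + α') =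
        (contractF S.Λ (extD β) - extD (contractF S.Λ β) + ((k : ℝ) - 1) • intF S.E β +
          (-1 : ℝ) ^ k • contractF S.Λ α) +
        (contractF S.Λ (extD β') - extD (contractF S.Λ β') + ((k : ℝ) - 1) • intF S.E β' +
          (-1 : ℝ) ^ k • contractF S.Λ α')
      rw [contractF_add S.Λ β β', h2, h5, contractF_add, contractF_add, intF_add]
      module
  map_smul' := by
    rintro c ⟨⟨α, β⟩, hα, hβ⟩
    refine Prod.ext ?_ ?_
    · change contractF S.Λ (extD (c • α)) - extD (contractF S.Λ (c • α)) +
          (k : ℝ) • intF S.E (c • α) +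
          (-1 : ℝ) ^ k • (extD (intF S.E (c • β)) + intF S.E (extD (c • β))) =
        c • (contractF S.Λ (extD α) - extD (contractF S.Λ α) + (k : ℝ) • intF S.E α +
          (-1 : ℝ) ^ k • (extD (intF S.E β) + intF S.E (extD β)))
      rw [intF_smul S.E c β, contractF_smul S.Λ c α, extD_smul, extD_smul, extD_smul, extD_smul,
        contractF_smul, intF_smul, intF_smul]
      module
    · change contractF S.Λ (extD (c • β)) - extD (contractF S.Λ (c • β)) +
          ((k : ℝ) - 1) • intF S.E (c • β) + (-1 : ℝ) ^ k • contractF S.Λ (c • α) =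
        c • (contractF S.Λ (extD β) - extD (contractF S.Λ β) + ((k : ℝ) - 1) • intF S.E β +
          (-1 : ℝ) ^ k • contractF S.Λ α)
      rw [contractF_smul S.Λ c β, extD_smul, extD_smul, contractF_smul, contractF_smul, intF_smul]
      module

/-- `d̃ : Ωᵏ(M) ⊕ Ωᵏ⁻¹(M) → Ωᵏ⁺¹(M) ⊕ Ωᵏ(M)` as a linear map; its values are regarded as pairs of
fields of forms. -/
def dTildeLin (S : LCSStructure m M) (k : ℤ) :
    PairForms (2 * m) M k →ₗ[ℝ] Pairs (2 * m) M where
  toFun p := S.dTilde p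
  map_add' := by
    rintro ⟨⟨α, β⟩, hα, hβ⟩ ⟨⟨α', β'⟩, hα', hβ'⟩
    refine Prod.ext ?_ ?_
    · change extD (α + α') + wedgeF S.lee₁ (α + α') - wedgeF S.Ω (β + β') =
        (extD α + wedgeF S.lee₁ α - wedgeF S.Ω β) + (extD α' + wedgeF S.lee₁ α' - wedgeF S.Ω β')
      rw [extD_add hα.1 hα'.1, wedgeF_add, wedgeF_add]
      module
    · change -(extD (β + β') + wedgeF S.lee₀ (β + β')) =
        -(extD β + wedgeF S.lee₀ β) + -(extD β' + wedgeF S.lee₀ β')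
      rw [extD_add hβ.1 hβ'.1, wedgeF_add]
      module
  map_smul' := by
    rintro c ⟨⟨α, β⟩, hα, hβ⟩
    refine Prod.ext ?_ ?_
    · change extD (c • α) + wedgeF S.lee₁ (c • α) - wedgeF S.Ω (c • β) =
        c • (extD α + wedgeF S.lee₁ α - wedgeF S.Ω β)
      rw [extD_smul, wedgeF_smul, wedgeF_smul]
      module
    · change -(extD (c • β) + wedgeF S.lee₀ (c • β)) = c • -(extD β + wedgeF S.lee₀ β)
      rw [extD_smul, wedgeF_smul]
      module

/-- The cycles in degree `k` of the Lichnerowicz–Jacobi complex. -/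
def Cycles [IsManifold (𝓡 (2 * m)) ∞ M] (S : LCSStructure m M) (k : ℤ) :
    Submodule ℝ (Pairs (2 * m) M) :=
  (LinearMap.ker (S.deltaLin k)).map (PairForms (2 * m) M k).subtype

/-- The boundaries in degree `k` of the Lichnerowicz–Jacobi complex. -/
def Boundaries [IsManifold (𝓡 (2 * m)) ∞ M] (S : LCSStructure m M) (k : ℤ) :
    Submodule ℝ (Pairs (2 * m) M) :=
  LinearMap.range (S.deltaLin (k + 1))

/-- The Lichnerowicz–Jacobi homology `H_k^{LJ}(M)`: cycles modulo boundaries. -/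
abbrev LJHomology [IsManifold (𝓡 (2 * m)) ∞ M] (S : LCSStructure m M) (k : ℤ) : Type _ :=
  S.Cycles k ⧸ (S.Boundaries k).submoduleOf (S.Cycles k)

/-- The cocycles in degree `k` of the complex with differential `d̃`. -/
def Cocycles (S : LCSStructure m M) (k : ℤ) : Submodule ℝ (Pairs (2 * m) M) :=
  (LinearMap.ker (S.dTildeLin k)).map (PairForms (2 * m) M k).subtype

/-- The coboundaries in degree `k` of the complex with differential `d̃`. -/
def Coboundaries (S : LCSStructure m M) (k : ℤ) : Submodule ℝ (Pairs (2 * m) M) :=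
  LinearMap.range (S.dTildeLin (k - 1))

/-- The cohomology `H̃ᵏ(M)` of the complex with differential `d̃`: cocycles modulo
coboundaries. -/
abbrev TildeCohomology (S : LCSStructure m M) (k : ℤ) : Type _ :=
  S.Cocycles k ⧸ (S.Coboundaries k).submoduleOf (S.Cocycles k)

end LCSStructure

end LCSForms

end

set_option maxSynthPendingDepth 3

open scoped Manifold ContDiff

noncomputable section

namespace LCSForms

section

variable {d : ℕ}

/-! ## The exterior algebra of one tangent space -/

/-! At a point, `⋆` is determined by `⋆1 = Ω^m/m!` and the exchange rule `⋆(a ∧ α) = (-1)^k i_{♭⁻¹a}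
⋆α` (`Nondeg.starL_ε`), because forms are generated from functions by exterior multiplication by
covectors. Together with the Clifford relation `i_X(a ∧ α) = a(X)α - a ∧ i_Xα`, this gives the dual
rule `⋆(i_Xα) = (-1)^k ♭X ∧ ⋆α` (`Nondeg.starL_ι`). Hence `⋆` exchanges `i(Λ)` with `Ω ∧`. The
commutator of these two operators is `m - deg` (`Nondeg.contrTwo_wedgeTwo`), which yields `⋆(Ω^m/m!)
= 1` and then `⋆⋆ = 1`. So `φ̃` is triangular in two copies of an involution, which gives its
inverse explicitly. Since `⋆` acts pointwise and linearly, `φ̃` is linear over functions.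

The intertwining relation follows formally from two identities for `k`-forms: `⋆([i(Λ), d]α + k
i_Eα) = (-1)^{k+1}(d - (m+1)ω ∧ - Ω ∧ i_E)⋆α` (`starF_commutator`) and `⋆L_E = L_E⋆` (`starF_lieD`).
The first uses `dΩ = ω ∧ Ω`; the second also uses `dω = 0`, and amounts to `L_EΩ = 0`.

Both are checked in a chart, where `d = ∑ eⁱ ∧ ∂ᵢ`. The one analytic input is the derivative of `⋆`
itself. If `B = ♭⁻¹ ∘ ∂_vΩ` and `D_B` is the derivation extending the transpose of `B`, then
`∂_v(⋆A) = ⋆∂_vA + (D_B - ½ tr B)⋆A` (`pd_starL`). The terms in `∂A` cancel by the exchange rules,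
and what remains is algebra in the first derivatives of `Ω` subject to the Lee identity
(`LeeIdentity.sum_variation`, `LeeIdentity.starL_derivL`). Naturality of every operator under linear
isomorphisms carries the chart identities back to the manifold. As `φ̃` matches degrees,
differentials up to sign, cycles and boundaries, it descends to homology. -/

theorem eq_zero_of_eq_neg {V : Type*} [AddCommGroup V] [Module ℝ V] {x : V} (h : x = -x) :
    x = 0 := by
  have h1 : (2 : ℝ) • x = 0 := by
    rw [two_smul]
    nth_rewrite 1 [h]
    exact neg_add_cancel x
  simpa using h1

/-- A covector as a continuous linear functional. -/
def covDual : Cov d →L[ℝ] Vec d →L[ℝ] ℝ :=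
  (ContinuousAlternatingMap.ofSubsingletonLIE (𝕜 := ℝ) (E := Vec d) (F := ℝ)
    (0 : Fin 1)).symm.toContinuousLinearEquiv.toContinuousLinearMap

/-- Evaluation of a covector on a vector. -/
def pairing : Cov d →ₗ[ℝ] Vec d →ₗ[ℝ] ℝ :=
  ContinuousLinearMap.coeLM ℝ ∘ₗ covDual.toLinearMap

theorem pairing_apply (a : Cov d) (X : Vec d) : pairing a X = a fun _ => X := rfl

theorem Cov.apply_eq_pairing (a : Cov d) (v : Fin 1 → Vec d) : a v = pairing a (v 0) := by
  rw [pairing_apply]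
  congr 1
  funext i
  rw [Subsingleton.elim i 0]

theorem Cov.ext_pairing {a b : Cov d} (h : ∀ X, pairing a X = pairing b X) : a = b := by
  ext v
  rw [Cov.apply_eq_pairing, Cov.apply_eq_pairing, h]

theorem pairing_stdCov (i : Fin d) (X : Vec d) : pairing (stdCov i) X = X i := rfl

theorem pairing_stdCov_stdVec (i j : Fin d) :
    pairing (stdCov i) (stdVec j) = if i = j then 1 else 0 := by
  simp [pairing_stdCov, stdVec]

theorem sum_pairing_smul_stdVec (X : Vec d) : ∑ i, pairing (stdCov i) X • stdVec i = X :=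
  (sum_stdVec X).symm

theorem sum_pairing_smul_stdCov (a : Cov d) : ∑ i, pairing a (stdVec i) • stdCov i = a := by
  refine Cov.ext_pairing fun X => ?_
  conv_rhs => rw [← sum_pairing_smul_stdVec X]
  simp [map_sum, mul_comm]

theorem covDual_apply (a : Cov d) (X : Vec d) : covDual a X = pairing a X := rfl

/-- Exterior multiplication of an `n`-form by a covector, as a continuous bilinear map. -/
def wedgeCov (n : ℕ) :
    Cov d →L[ℝ] ((Vec d) [⋀^Fin n]→L[ℝ] ℝ) →L[ℝ] ((Vec d) [⋀^Fin (n + 1)]→L[ℝ] ℝ) :=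
  ((ContinuousLinearMap.compL ℝ _ _ _
    (ContinuousAlternatingMap.alternatizeUncurryFinCLM (n := n) ℝ (Vec d) ℝ)).comp
      (ContinuousLinearMap.smulRightL ℝ (Vec d) ((Vec d) [⋀^Fin n]→L[ℝ] ℝ))).comp covDual

theorem wedgeCov_apply (n : ℕ) (a : Cov d) (α : (Vec d) [⋀^Fin n]→L[ℝ] ℝ)
    (v : Fin (n + 1) → Vec d) :
    wedgeCov n a α v = ∑ i : Fin (n + 1), (-1) ^ (i : ℕ) * (pairing a (v i) * α (i.removeNth v)) := by
  change ContinuousAlternatingMap.alternatizeUncurryFin ((covDual a).smulRight α) v = _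
  rw [ContinuousAlternatingMap.alternatizeUncurryFin_apply]
  refine Finset.sum_congr rfl fun i _ => ?_
  simp [covDual_apply]

/-- Exterior multiplication `ε a α = a ∧ α` by a covector. -/
def ε : Cov d →ₗ[ℝ] Alt d →ₗ[ℝ] Alt d :=
  LinearMap.mk₂ ℝ
    (fun a α n => match n with
      | 0 => 0
      | n + 1 => wedgeCov n a (α n))
    (fun a b α => by funext n; cases n <;> simp)
    (fun c a α => by funext n; cases n <;> simp)
    (fun a α β => by funext n; cases n <;> simp)
    (fun c a α => by funext n; cases n <;> simp)

theorem ε_zero_apply (a : Cov d) (α : Alt d) : ε a α 0 = 0 := rfl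

theorem ε_succ_apply (a : Cov d) (α : Alt d) (n : ℕ) : ε a α (n + 1) = wedgeCov n a (α n) := rfl

/-- The interior product as a bilinear map. -/
def ι : Vec d →ₗ[ℝ] Alt d →ₗ[ℝ] Alt d :=
  LinearMap.mk₂ ℝ interior
    (fun X Y α => by funext n; simp [interior])
    (fun c X α => by funext n; simp [interior])
    (fun X α β => rfl) (fun c X α => rfl)

theorem ι_apply (X : Vec d) (α : Alt d) (n : ℕ) : ι X α n = (α (n + 1)).curryLeft X := rfl

theorem ι_eq_interior (X : Vec d) (α : Alt d) : ι X α = interior X α := rfl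

theorem ι_apply_apply (X : Vec d) (α : Alt d) (n : ℕ) (v : Fin n → Vec d) :
    ι X α n v = α (n + 1) (Fin.cons X v) := rfl

/-- Two forms of positive degree agree if all their interior products agree. -/
theorem eq_of_ι_eq {α β : Alt d} {n : ℕ} (h : ∀ X, ι X α n = ι X β n) : α (n + 1) = β (n + 1) := by
  ext v
  rw [← Fin.cons_self_tail v]
  exact congrArg (fun γ => γ (Fin.tail v)) (h (v 0))

/-- The Clifford relation between interior and exterior multiplication. -/
theorem ι_ε (X : Vec d) (a : Cov d) (α : Alt d) :
    ι X (ε a α) = pairing a X • α - ε a (ι X α) := by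
  funext n
  ext v
  rw [ι_apply_apply, ε_succ_apply, wedgeCov_apply, Fin.sum_univ_succ]
  cases n with
  | zero => simp [ε_zero_apply]
  | succ n =>
    have h0 : (pairing a X • α - ε a (ι X α)) (n + 1) v = pairing a X * α (n + 1) v -
        wedgeCov n a (ι X α n) v := rfl
    rw [h0, wedgeCov_apply, sub_eq_add_neg, ← Finset.sum_neg_distrib]
    congr 1
    · simp
    · refine Finset.sum_congr rfl fun i _ => ?_
      have h : i.succ.removeNth (Fin.cons X v : Fin (n + 2) → Vec d) = Fin.cons X (i.removeNth v) := by
        funext j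
        refine Fin.cases ?_ (fun j => ?_) j <;> simp [Fin.removeNth]
      rw [h]
      simp [pow_succ, ι_apply_apply]

theorem ι_ι (X Y : Vec d) (α : Alt d) : ι X (ι Y α) = -ι Y (ι X α) := by
  funext n
  ext v
  change α (n + 2) (Fin.cons Y (Fin.cons X v)) = -α (n + 2) (Fin.cons X (Fin.cons Y v))
  refine Eq.trans ?_ ((α (n + 2)).toAlternatingMap.map_swap _ (i := 0) (j := 1) (by simp))
  change _ = α (n + 2) _
  congr 1
  funext i
  refine Fin.cases ?_ (fun i => Fin.cases ?_ (fun i => ?_) i) i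
  · simp
  · have : (Fin.succ 0 : Fin (n + 2)) = 1 := rfl
    simp [this]
  · rw [Function.comp_apply, Equiv.swap_apply_of_ne_of_ne]
    · simp
    · exact Fin.succ_ne_zero _
    · rw [← Fin.succ_zero_eq_one, Ne, Fin.succ_inj]
      exact Fin.succ_ne_zero _

theorem ι_ι_self (X : Vec d) (α : Alt d) : ι X (ι X α) = 0 :=
  eq_zero_of_eq_neg (ι_ι X X α)

/-- Interior products separate forms of positive degree, and by the Clifford relation `ι X` turns
the claim for `α` into the claim for `ι X α`; hence an induction on the degree. -/
theorem ε_ε (a b : Cov d) (α : Alt d) : ε a (ε b α) = -ε b (ε a α) := by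
  have key : ∀ (n : ℕ) (α : Alt d), ε a (ε b α) n = -ε b (ε a α) n := by
    intro n
    induction n with
    | zero => intro α; simp [ε_zero_apply]
    | succ n ih =>
      intro α
      refine eq_of_ι_eq (β := -ε b (ε a α)) fun X => ?_
      have := ih (ι X α)
      simp only [map_neg, ι_ε, map_sub, map_smul, Pi.sub_apply, Pi.neg_apply, Pi.smul_apply, this]
      abel
  exact funext fun n => key n α

/-- A form on `ℝᵈ` of degree larger than `d` vanishes. -/
theorem form_eq_zero_of_lt {n : ℕ} (h : d < n) (α : (Vec d) [⋀^Fin n]→L[ℝ] ℝ) : α = 0 := by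
  ext v
  refine α.toAlternatingMap.map_linearDependent v fun hv => ?_
  have := hv.fintype_card_le_finrank
  simp at this
  omega

/-- The degree operator. -/
def degL : Alt d →ₗ[ℝ] Alt d where
  toFun α n := (n : ℝ) • α n
  map_add' α β := by funext n; simp
  map_smul' c α := funext fun n => smul_comm _ c (α n)

/-- The parity operator, multiplication by `(-1)ⁿ` in degree `n`. -/
def sgn : Alt d →ₗ[ℝ] Alt d where
  toFun α n := (-1 : ℝ) ^ n • α n
  map_add' α β := by funext n; simp
  map_smul' c α := funext fun n => smul_comm _ c (α n)

theorem degL_apply (α : Alt d) (n : ℕ) : degL α n = (n : ℝ) • α n := rfl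

theorem sgn_apply (α : Alt d) (n : ℕ) : sgn α n = (-1 : ℝ) ^ n • α n := rfl

theorem sgn_sgn (α : Alt d) : sgn (sgn α) = α := by
  funext n
  rw [sgn_apply, sgn_apply, smul_smul, ← mul_pow]
  simp

theorem sgn_ε (a : Cov d) (α : Alt d) : sgn (ε a α) = -ε a (sgn α) := by
  funext n
  cases n with
  | zero => simp [sgn_apply, ε_zero_apply]
  | succ n => simp [sgn_apply, ε_succ_apply, pow_succ]

theorem sgn_ι (X : Vec d) (α : Alt d) : sgn (ι X α) = -ι X (sgn α) := by
  funext n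
  ext v
  simp [sgn_apply, ι_apply_apply, pow_succ]

/-- A form all of whose components of degree different from `k` vanish. -/
def Homog (k : ℕ) (α : Alt d) : Prop := ∀ n, n ≠ k → α n = 0

theorem Homog.sgn_eq {k : ℕ} {α : Alt d} (h : Homog k α) : sgn α = (-1 : ℝ) ^ k • α := by
  funext n
  by_cases hn : n = k
  · subst hn; rfl
  · simp [sgn_apply, h n hn]

theorem Homog.degL_eq {k : ℕ} {α : Alt d} (h : Homog k α) : degL α = (k : ℝ) • α := by
  funext n
  by_cases hn : n = k
  · subst hn; rfl
  · simp [degL_apply, h n hn]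

theorem Homog.ι {k : ℕ} {α : Alt d} (h : Homog (k + 1) α) (X : Vec d) : Homog k (ι X α) := by
  intro n hn
  rw [ι_apply, h (n + 1) (by omega)]
  ext v
  rfl

theorem Homog.ε {k : ℕ} {α : Alt d} (h : Homog k α) (a : Cov d) : Homog (k + 1) (ε a α) := by
  intro n hn
  cases n with
  | zero => rfl
  | succ n => rw [ε_succ_apply, h n (by omega), map_zero]

theorem Homog.smul {k : ℕ} {α : Alt d} (hα : Homog k α) (c : ℝ) : Homog k (c • α) :=
  fun n hn => by simp [hα n hn]

theorem Homog.sum {k : ℕ} {I : Type*} {s : Finset I} {α : I → Alt d} (hα : ∀ i, Homog k (α i)) :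
    Homog k (∑ i ∈ s, α i) :=
  fun n hn => by simp [Finset.sum_apply, hα _ n hn]

theorem ι_zero_of_homog {α : Alt d} (h : Homog 0 α) (X : Vec d) : ι X α = 0 := by
  funext n
  ext v
  rw [ι_apply_apply, h _ n.succ_ne_zero]
  rfl

/-- Contraction of the canonical tensor. -/
theorem sum_ε_ι (α : Alt d) : ∑ i, ε (stdCov i) (ι (stdVec i) α) = degL α := by
  have key : ∀ (n : ℕ) (α : Alt d), (∑ i, ε (stdCov i) (ι (stdVec i) α)) n = degL α n := by
    intro n
    induction n with
    | zero => intro α; simp [degL_apply, ε_zero_apply, Finset.sum_apply]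
    | succ n ih =>
      intro α
      refine eq_of_ι_eq fun X => ?_
      have h1 : ∀ i, ι (stdVec i) (ι X α) = -ι X (ι (stdVec i) α) := fun i => ι_ι _ _ _
      have h := ih (ι X α)
      -- Moving `ι X` inside produces `ι X α` once, plus the same sum for `ι X α`; this is what
      -- raises the eigenvalue from `n` to `n + 1`.
      have h2 : ι X (∑ i, ε (stdCov i) (ι (stdVec i) α)) =
          ι X α + ∑ i, ε (stdCov i) (ι (stdVec i) (ι X α)) := by
        have h3 : ∑ i, pairing (stdCov i) X • ι (stdVec i) α = ι X α := by
          conv_rhs => rw [← sum_pairing_smul_stdVec X]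
          simp [map_sum, LinearMap.sum_apply]
        refine Eq.trans ?_ (congrArg (· + ∑ i, ε (stdCov i) (ι (stdVec i) (ι X α))) h3)
        rw [map_sum]
        refine Eq.trans (Finset.sum_congr rfl fun i _ => ?_) Finset.sum_add_distrib
        rw [ι_ε, h1, map_neg, sub_eq_add_neg]
      rw [h2, Pi.add_apply, h, degL_apply, ι_apply, ι_apply, degL_apply]
      ext v
      simp
      ring
  exact funext fun n => key n α

/-- Induction over homogeneous forms, from functions by exterior multiplication by covectors. -/
theorem homog_induction {P : Alt d → Prop} (one : P oneForm) (zero : P 0)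
    (add : ∀ α β, P α → P β → P (α + β)) (smul : ∀ (c : ℝ) α, P α → P (c • α))
    (mul : ∀ (k : ℕ) a α, Homog k α → P α → P (ε a α)) {k : ℕ} {α : Alt d} (h : Homog k α) : P α := by
  have hs : ∀ f : Fin d → Alt d, (∀ i, P (f i)) → P (∑ i, f i) := fun f hf =>
    Finset.sum_induction f P add zero fun i _ => hf i
  induction k generalizing α with
  | zero =>
    have : α = (α 0 fun i => i.elim0) • oneForm := by
      funext n
      cases n with
      | zero =>
        ext v
        simp [oneForm]
        congr 1
        funext i
        exact i.elim0
      | succ n => simp [oneForm, h (n + 1) n.succ_ne_zero]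
    rw [this]
    exact smul _ _ one
  | succ k ih =>
    -- Euler's identity `sum_ε_ι` divided by the positive degree exhibits `α` as a sum of products
    -- of covectors with forms of lower degree.
    have h1 : α = ((k + 1 : ℕ) : ℝ)⁻¹ • ∑ i, ε (stdCov i) (ι (stdVec i) α) := by
      rw [sum_ε_ι, h.degL_eq, smul_smul, inv_mul_cancel₀ (by positivity), one_smul]
    rw [h1]
    exact smul _ _ (hs _ fun i => mul k _ _ (h.ι _) (ih (h.ι _)))

theorem homog_oneForm : Homog 0 (oneForm : Alt d) := by
  intro n hn
  simp [oneForm, hn]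

/-! ### Derivations -/

/-- The canonical tensor `∑ eⁱ ⊗ eᵢ` intertwines an endomorphism and its transpose. -/
theorem sum_comp_canonical {V : Type*} [AddCommGroup V] [Module ℝ V]
    (F : Cov d →ₗ[ℝ] Vec d →ₗ[ℝ] V) (a : Fin d → Cov d) (B : Vec d → Vec d)
    (h : ∀ i X, pairing (a i) X = pairing (stdCov i) (B X)) :
    ∑ i, F (a i) (stdVec i) = ∑ i, F (stdCov i) (B (stdVec i)) := by
  have h1 : ∀ i, F (a i) (stdVec i) =
      ∑ j, pairing (stdCov i) (B (stdVec j)) • F (stdCov j) (stdVec i) := by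
    intro i
    conv_lhs => rw [← sum_pairing_smul_stdCov (a i)]
    simp [map_sum, LinearMap.sum_apply, h]
  have h2 : ∀ j, F (stdCov j) (B (stdVec j)) =
      ∑ i, pairing (stdCov i) (B (stdVec j)) • F (stdCov j) (stdVec i) := by
    intro j
    conv_lhs => rw [← sum_pairing_smul_stdVec (B (stdVec j))]
    simp [map_sum]
  simp only [h1, h2]
  exact Finset.sum_comm

/-- The derivation of the exterior algebra induced by an endomorphism `B` of the tangent space,
`D_B a = a ∘ B` on covectors. -/
def derivL (B : Vec d →ₗ[ℝ] Vec d) : Alt d →ₗ[ℝ] Alt d :=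
  ∑ i, ε (stdCov i) ∘ₗ ι (B (stdVec i))

theorem derivL_apply (B : Vec d →ₗ[ℝ] Vec d) (α : Alt d) :
    derivL B α = ∑ i, ε (stdCov i) (ι (B (stdVec i)) α) := by
  simp [derivL, LinearMap.sum_apply]

/-- The commutator `[ι X, D_B] = ι (B X)`: in the Clifford relation the scalar terms reassemble `B
X` in the standard basis. -/
theorem ι_derivL (X : Vec d) (B : Vec d →ₗ[ℝ] Vec d) (α : Alt d) :
    ι X (derivL B α) = derivL B (ι X α) + ι (B X) α := by
  have h : ∑ i, pairing (stdCov i) X • ι (B (stdVec i)) α = ι (B X) α := by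
    conv_rhs => rw [← sum_pairing_smul_stdVec X]
    simp [map_sum, LinearMap.sum_apply]
  rw [← h, derivL_apply, derivL_apply, ← Finset.sum_add_distrib, map_sum]
  refine Finset.sum_congr rfl fun i _ => ?_
  rw [ι_ε, ι_ι X, map_neg]
  abel

theorem derivL_ε (B : Vec d →ₗ[ℝ] Vec d) (a : Cov d) (α : Alt d) :
    derivL B (ε a α) = ∑ i, pairing a (B (stdVec i)) • ε (stdCov i) α + ε a (derivL B α) := by
  rw [derivL_apply, derivL_apply, map_sum, ← Finset.sum_add_distrib]
  refine Finset.sum_congr rfl fun i _ => ?_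
  rw [ι_ε, map_sub, map_smul, ε_ε _ a]
  abel

/-- The trace of an endomorphism of the tangent space. -/
def traceL (B : Vec d →ₗ[ℝ] Vec d) : ℝ := ∑ i, pairing (stdCov i) (B (stdVec i))

/-- On forms of top degree a derivation acts by its trace. -/
theorem derivL_top {α : Alt d} (h : Homog d α) (B : Vec d →ₗ[ℝ] Vec d) :
    derivL B α = traceL B • α := by
  -- There is nothing in degree `d + 1`, so the Clifford relation degenerates to `a ∧ ι_X α = a(X)
  -- α`.
  have h0 : ∀ a, ε a α = 0 := fun a => by
    funext n
    by_cases hn : n = d + 1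
    · exact form_eq_zero_of_lt (by omega) _
    · exact h.ε a n hn
  have h1 : ∀ X a, ε a (ι X α) = pairing a X • α := fun X a => by
    have := ι_ε X a α
    rw [h0, map_zero] at this
    exact (sub_eq_zero.mp this.symm).symm
  simp only [derivL_apply, h1, traceL, Finset.sum_smul]

/-! ### Two-forms -/

/-- Exterior multiplication by a two-form. -/
def wedgeTwo (η : (Vec d) [⋀^Fin 2]→L[ℝ] ℝ) : Alt d →ₗ[ℝ] Alt d :=
  (2 : ℝ)⁻¹ • ∑ i, ε (stdCov i) ∘ₗ ε (flat η (stdVec i))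

theorem wedgeTwo_apply (η : (Vec d) [⋀^Fin 2]→L[ℝ] ℝ) (α : Alt d) :
    wedgeTwo η α = (2 : ℝ)⁻¹ • ∑ i, ε (stdCov i) (ε (flat η (stdVec i)) α) := by
  simp [wedgeTwo, LinearMap.sum_apply]

theorem pairing_flat (η : (Vec d) [⋀^Fin 2]→L[ℝ] ℝ) (X Y : Vec d) :
    pairing (flat η X) Y = η ![X, Y] := by
  rw [pairing_apply]
  change η _ = η _
  congr 1
  funext i
  fin_cases i <;> rfl

theorem pairing_flat_swap (η : (Vec d) [⋀^Fin 2]→L[ℝ] ℝ) (X Y : Vec d) :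
    pairing (flat η X) Y = -pairing (flat η Y) X := by
  rw [pairing_flat, pairing_flat]
  refine Eq.trans ?_ (η.toAlternatingMap.map_swap ![Y, X] (i := 0) (j := 1) (by simp))
  change _ = η _
  congr 1
  funext i
  fin_cases i <;> rfl

theorem pairing_flat_self (η : (Vec d) [⋀^Fin 2]→L[ℝ] ℝ) (X : Vec d) :
    pairing (flat η X) X = 0 :=
  eq_zero_of_eq_neg (pairing_flat_swap η X X)

theorem sum_pairing_flat_smul_stdCov (η : (Vec d) [⋀^Fin 2]→L[ℝ] ℝ) (X : Vec d) :
    ∑ i, pairing (flat η (stdVec i)) X • stdCov i = -flat η X := by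
  conv_rhs => rw [← sum_pairing_smul_stdCov (flat η X)]
  rw [← Finset.sum_neg_distrib]
  exact Finset.sum_congr rfl fun i _ => by rw [pairing_flat_swap, neg_smul]

/-- The vector may hit either factor of `eⁱ ∧ η(eᵢ, ·)`; by skewness the two contributions agree,
which absorbs the factor `1/2`. -/
theorem ι_wedgeTwo (X : Vec d) (η : (Vec d) [⋀^Fin 2]→L[ℝ] ℝ) (α : Alt d) :
    ι X (wedgeTwo η α) = ε (flat η X) α + wedgeTwo η (ι X α) := by
  have h1 : ∑ i, pairing (stdCov i) X • ε (flat η (stdVec i)) α = ε (flat η X) α := by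
    conv_rhs => rw [← sum_pairing_smul_stdVec X]
    simp [map_sum, LinearMap.sum_apply]
  have h2 : ∑ i, pairing (flat η (stdVec i)) X • ε (stdCov i) α = -ε (flat η X) α := by
    rw [← LinearMap.neg_apply, ← map_neg, ← sum_pairing_flat_smul_stdCov]
    simp [map_sum, LinearMap.sum_apply]
  simp only [wedgeTwo_apply, map_smul, map_sum, ι_ε, map_sub, Finset.sum_sub_distrib, h1, h2]
  module

theorem Homog.wedgeTwo {k : ℕ} {α : Alt d} (h : Homog k α) (η : (Vec d) [⋀^Fin 2]→L[ℝ] ℝ) :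
    Homog (k + 2) (wedgeTwo η α) := by
  rw [wedgeTwo_apply]
  exact (Homog.sum fun i => (h.ε _).ε _).smul _

end

section

variable {d : ℕ}

/-! ### The wedge product by forms of degree one and two -/

/-- Coset representatives in `Equiv.Perm.decomposeFin` are the transpositions `(0 p)`, whereas
`wedgeCov` deletes the `p`-th argument and keeps the order. The two arrangements of the remaining
arguments differ by a cycle of length `p` when `p ≠ 0`, which turns the sign `-1` into `(-1)^p`. -/
theorem map_swap_succ {n : ℕ} (β : (Vec d) [⋀^Fin n]→L[ℝ] ℝ) (v : Fin (n + 1) → Vec d)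
    (p : Fin (n + 1)) :
    ((if p = 0 then 1 else -1 : ℤˣ) : ℤ) * β (fun j => v (Equiv.swap 0 p j.succ)) =
      (-1) ^ (p : ℕ) * β (p.removeNth v) := by
  refine Fin.cases ?_ (fun k => ?_) p
  · simp only [if_true, Units.val_one, Int.cast_one, Fin.val_zero, pow_zero, Equiv.swap_self]
    rfl
  · obtain ⟨n, rfl⟩ : ∃ l, n = l + 1 := ⟨n - 1, by have := k.pos; omega⟩
    have h1 : (fun j : Fin (n + 1) => v (Equiv.swap 0 k.succ j.succ)) =
        k.insertNth (v 0) (k.removeNth (Fin.tail v)) := by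
      funext j
      rcases eq_or_ne j k with rfl | hj
      · simp
      · obtain ⟨i, rfl⟩ := Fin.exists_succAbove_eq hj
        rw [Fin.insertNth_apply_succAbove, Equiv.swap_apply_of_ne_of_ne (Fin.succ_ne_zero _)
          (fun h => hj (Fin.succ_injective _ h))]
        rfl
    have h2 : k.succ.removeNth v = Fin.cons (v 0) (k.removeNth (Fin.tail v)) := by
      funext j
      refine Fin.cases ?_ (fun j => ?_) j
      · simp [Fin.removeNth]
      · simp [Fin.removeNth, Fin.tail]
    rw [h1, h2, ContinuousAlternatingMap.map_insertNth]
    simp [pow_succ, Matrix.vecCons]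

/-- Alternating a product with a covector on the left. -/
theorem sum_sign_pairing_mul {n : ℕ} (a : Cov d)
    (T : ContinuousMultilinearMap ℝ (fun _ : Fin n => Vec d) ℝ) (v : Fin (n + 1) → Vec d) :
    ∑ σ : Equiv.Perm (Fin (n + 1)), ((Equiv.Perm.sign σ : ℤ) : ℝ) *
        (pairing a (v (σ 0)) * T (fun j => v (σ j.succ))) =
      wedgeCov n a (ContinuousMultilinearMap.alternatization T) v := by
  -- Permutations are grouped by the value `σ 0 = p`; within a group the sum alternates the
  -- remaining arguments of `T`.
  rw [wedgeCov_apply, ← Equiv.Perm.decomposeFin.symm.sum_comp, Fintype.sum_prod_type]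
  refine Finset.sum_congr rfl fun p _ => ?_
  have h := map_swap_succ (ContinuousMultilinearMap.alternatization T) v p
  rw [mul_left_comm, ← h, ContinuousMultilinearMap.alternatization_apply_apply, Finset.mul_sum,
    Finset.mul_sum]
  refine Finset.sum_congr rfl fun e _ => ?_
  simp only [Equiv.Perm.decomposeFin_symm_apply_zero, Equiv.Perm.decomposeFin_symm_apply_succ,
    Equiv.Perm.decomposeFin.symm_sign, Units.smul_def, zsmul_eq_mul, Units.val_mul, Int.cast_mul]
  change _ = pairing a (v p) * (_ * (_ * T fun j => v (Equiv.swap 0 p (e j).succ)))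
  ring

theorem alternatization_self {n : ℕ} (β : (Vec d) [⋀^Fin n]→L[ℝ] ℝ) :
    ContinuousMultilinearMap.alternatization β.toContinuousMultilinearMap =
      (n.factorial : ℝ) • β := by
  ext v
  rw [ContinuousMultilinearMap.alternatization_apply_apply]
  have : ∀ σ : Equiv.Perm (Fin n), Equiv.Perm.sign σ • β.toContinuousMultilinearMap (v ∘ σ) = β v := by
    intro σ
    have h := β.toAlternatingMap.map_perm v σ
    change β (v ∘ σ) = Equiv.Perm.sign σ • β v at h
    change Equiv.Perm.sign σ • β (v ∘ σ) = _
    rw [h, smul_smul, Int.units_mul_self, one_smul]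
  rw [Finset.sum_congr rfl fun σ _ => this σ]
  simp [Fintype.card_perm]

/-- Alternating the already alternating `β` gives `q! β`, which cancels the normalisation `1/(1!
q!)`. The equation `n = q + 1` is carried separately because `1 + q` does not reduce to it. -/
theorem wedgeHom_one {q n : ℕ} (h : 1 + q = n) (hn : n = q + 1) (a : Cov d)
    (β : (Vec d) [⋀^Fin q]→L[ℝ] ℝ) (v : Fin n → Vec d) :
    wedgeHom h a β v =
      wedgeCov q a β (fun i => v (Fin.cast hn.symm i)) := by
  subst hn
  have h1 := sum_sign_pairing_mul a β.toContinuousMultilinearMap v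
  rw [alternatization_self, map_smul, ContinuousAlternatingMap.smul_apply, smul_eq_mul] at h1
  have h2 : wedgeCov q a β (fun i => v (Fin.cast rfl i)) = wedgeCov q a β v := rfl
  have hq : (q.factorial : ℝ) ≠ 0 := by exact_mod_cast q.factorial_ne_zero
  rw [h2, ← mul_left_cancel_iff_of_pos (show (0 : ℝ) < q.factorial by positivity), ← h1, wedgeHom,
    ContinuousAlternatingMap.smul_apply, ContinuousMultilinearMap.alternatization_apply_apply]
  simp only [Nat.factorial_one, Nat.cast_one, one_mul, smul_eq_mul]
  rw [mul_inv_cancel_left₀ hq]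
  refine Finset.sum_congr rfl fun σ _ => ?_
  rw [tensorMul_apply, Units.smul_def, zsmul_eq_mul, Cov.apply_eq_pairing]
  congr 2
  change β _ = β _
  congr 1
  funext j
  change v (σ _) = v (σ _)
  congr 2
  ext
  simp

theorem flat_sum_apply (η : (Vec d) [⋀^Fin 2]→L[ℝ] ℝ) (w : Fin 2 → Vec d) :
    η w = ∑ i, pairing (stdCov i) (w 0) * pairing (flat η (stdVec i)) (w 1) := by
  have h : η w = pairing (flat η (w 0)) (w 1) := by
    rw [pairing_flat]
    congr 1
    funext i
    fin_cases i <;> rfl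
  rw [h]
  conv_lhs => rw [← sum_pairing_smul_stdVec (w 0)]
  simp [map_sum, LinearMap.sum_apply]

/-- As a tensor `η = ∑ eⁱ ⊗ η(eᵢ, ·)` by `flat_sum_apply`, so the alternation over `q + 2` arguments
is two successive alternations with a covector; the factor `1/2` is the `1/2!` of the normalisation.
-/
theorem wedgeHom_two {q n : ℕ} (h : 2 + q = n) (hn : n = q + 2)
    (η : (Vec d) [⋀^Fin 2]→L[ℝ] ℝ) (β : (Vec d) [⋀^Fin q]→L[ℝ] ℝ) (v : Fin n → Vec d) :
    wedgeHom h η β v =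
      (2 : ℝ)⁻¹ * ∑ i, wedgeCov (q + 1) (stdCov i) (wedgeCov q
        (flat η (stdVec i)) β) (fun i => v (Fin.cast hn.symm i)) := by
  subst hn
  have h3 : (fun i => v (Fin.cast rfl i)) = v := rfl
  rw [h3]
  have hq : (q.factorial : ℝ) ≠ 0 := by exact_mod_cast q.factorial_ne_zero
  have hw : ∀ i, wedgeCov q (flat η (stdVec i)) β = (q.factorial : ℝ)⁻¹ •
      ContinuousMultilinearMap.alternatization
        (tensorMul (add_comm 1 q) (flat η (stdVec i)) β) := by
    intro i
    ext w
    refine (wedgeHom_one (add_comm 1 q) rfl (flat η (stdVec i)) β w).symm.trans ?_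
    simp [wedgeHom]
  have h1 : ∀ i, wedgeCov (q + 1) (stdCov i) (wedgeCov q (flat η (stdVec i)) β) v =
      (q.factorial : ℝ)⁻¹ * ∑ σ : Equiv.Perm (Fin (q + 1 + 1)), ((Equiv.Perm.sign σ : ℤ) : ℝ) *
        (pairing (stdCov i) (v (σ 0)) *
          tensorMul (add_comm 1 q) (flat η (stdVec i)) β (fun j => v (σ j.succ))) := by
    intro i
    rw [sum_sign_pairing_mul, hw, map_smul]
    rfl
  simp only [h1]
  rw [← Finset.mul_sum, Finset.sum_comm, wedgeHom, ContinuousAlternatingMap.smul_apply,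
    ContinuousMultilinearMap.alternatization_apply_apply, smul_eq_mul, ← mul_assoc, mul_inv]
  congr 1
  refine Finset.sum_congr rfl fun σ _ => ?_
  rw [← Finset.mul_sum, Units.smul_def, zsmul_eq_mul, tensorMul_apply, flat_sum_apply η]
  congr 1
  rw [Finset.sum_mul]
  refine Finset.sum_congr rfl fun i _ => ?_
  rw [tensorMul_apply, mul_assoc, Cov.apply_eq_pairing (flat η (stdVec i))]
  congr 1
  congr 1
  congr 1
  funext j
  change v (σ _) = v (σ _)
  congr 2
  ext
  simp

theorem wedgeHom_zero_left {p q n : ℕ} (h : p + q = n) (β : (Vec d) [⋀^Fin q]→L[ℝ] ℝ) :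
    wedgeHom h (0 : (Vec d) [⋀^Fin p]→L[ℝ] ℝ) β = 0 := by
  have : tensorMul h (0 : (Vec d) [⋀^Fin p]→L[ℝ] ℝ) β = 0 := by
    ext v
    simp [tensorMul_apply]
  rw [wedgeHom, this, map_zero, smul_zero]

theorem wedge_of_homog {k : ℕ} {η : Alt d} (h : Homog k η) (β : Alt d) (q : ℕ) :
    wedge η β (q + k) = wedgeHom (p := k) (q := q + k - k) (by omega) (η k) (β (q + k - k)) := by
  rw [wedge, Finset.sum_eq_single (⟨k, by omega⟩ : Fin (q + k + 1))]
  · intro p _ hp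
    rw [h p fun hpk => hp (Fin.ext hpk), wedgeHom_zero_left]
  · simp

theorem wedge_of_homog_lt {k : ℕ} {η : Alt d} (h : Homog k η) (β : Alt d) {n : ℕ} (hn : n < k) :
    wedge η β n = 0 := by
  rw [wedge]
  refine Finset.sum_eq_zero fun p _ => ?_
  rw [h p (by have := p.isLt; omega), wedgeHom_zero_left]

theorem wedge_one {θ : Alt d} (h : Homog 1 θ) (β : Alt d) : wedge θ β = ε (θ 1) β := by
  funext n
  cases n with
  | zero => exact wedge_of_homog_lt h β one_pos
  | succ n =>
    rw [wedge_of_homog h]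
    ext v
    exact wedgeHom_one (q := n) _ rfl (θ 1) (β n) v

theorem wedge_two {η : Alt d} (h : Homog 2 η) (β : Alt d) : wedge η β = wedgeTwo (η 2) β := by
  funext n
  rcases n with _ | _ | n
  · rw [wedge_of_homog_lt h β two_pos]
    simp [wedgeTwo_apply, Finset.sum_apply, ε_zero_apply]
  · rw [wedge_of_homog_lt h β (n := 0 + 1) one_lt_two]
    simp [wedgeTwo_apply, Finset.sum_apply, ε_zero_apply, ε_succ_apply]
  · rw [wedge_of_homog h]
    ext v
    refine (wedgeHom_two (q := n) _ rfl (η 2) (β n) v).trans ?_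
    simp only [wedgeTwo_apply, Pi.smul_apply, Finset.sum_apply, ContinuousAlternatingMap.smul_apply,
      ContinuousAlternatingMap.sum_apply, smul_eq_mul]
    rfl

end

section

variable {d : ℕ}

/-! ### The musical isomorphism and the bivector -/

theorem Nondeg.flat_flatInv {Ω : (Vec d) [⋀^Fin 2]→L[ℝ] ℝ} (h : Nondeg Ω) (a : Cov d) :
    flat Ω (flatInv Ω a) = a :=
  h.isInvertible_flat.self_apply_inverse a

theorem Nondeg.flatInv_flat {Ω : (Vec d) [⋀^Fin 2]→L[ℝ] ℝ} (h : Nondeg Ω) (X : Vec d) :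
    flatInv Ω (flat Ω X) = X :=
  h.isInvertible_flat.inverse_apply_self X

theorem Nondeg.pairing_flatInv_swap {Ω : (Vec d) [⋀^Fin 2]→L[ℝ] ℝ} (h : Nondeg Ω) (a b : Cov d) :
    pairing a (flatInv Ω b) = -pairing b (flatInv Ω a) := by
  conv_lhs => rw [← h.flat_flatInv a]
  rw [pairing_flat_swap, h.flat_flatInv]

theorem Nondeg.pairing_eq {Ω : (Vec d) [⋀^Fin 2]→L[ℝ] ℝ} (h : Nondeg Ω) (a : Cov d) (X : Vec d) :
    pairing a X = -pairing (flat Ω X) (flatInv Ω a) := by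
  conv_lhs => rw [← h.flat_flatInv a]
  rw [pairing_flat_swap]

/-- The contraction by the bivector of a two-form. -/
def contrTwo (Ω : (Vec d) [⋀^Fin 2]→L[ℝ] ℝ) : Alt d →ₗ[ℝ] Alt d :=
  (2 : ℝ)⁻¹ • ∑ i, ι (stdVec i) ∘ₗ ι (flatInv Ω (stdCov i))

theorem contrTwo_apply (Ω : (Vec d) [⋀^Fin 2]→L[ℝ] ℝ) (α : Alt d) :
    contrTwo Ω α = (2 : ℝ)⁻¹ • ∑ i, ι (stdVec i) (ι (flatInv Ω (stdCov i)) α) := by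
  simp [contrTwo, LinearMap.sum_apply]

/-- The numbers `Λ(eⁱ, eʲ)` are the components of `♭⁻¹ eʲ`, so one of the two sums in coordinates
collapses. -/
theorem contract_bivector {Ω : (Vec d) [⋀^Fin 2]→L[ℝ] ℝ} (h : Nondeg Ω) (α : Alt d) :
    contract (bivector Ω) α = contrTwo Ω α := by
  have h1 : ∀ j, flatInv Ω (stdCov j) =
      ∑ i, bivector Ω ![stdCov i, stdCov j] • stdVec i := by
    intro j
    conv_lhs => rw [← sum_pairing_smul_stdVec (flatInv Ω (stdCov j))]
    refine Finset.sum_congr rfl fun i _ => ?_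
    rw [bivector_apply h]
    rfl
  funext n
  ext v
  rw [contract_two_apply, contrTwo_apply, Finset.sum_comm]
  simp only [h1, map_sum, map_smul, LinearMap.sum_apply, LinearMap.smul_apply, Pi.smul_apply,
    Finset.sum_apply, ContinuousAlternatingMap.smul_apply, ContinuousAlternatingMap.sum_apply,
    smul_eq_mul, ι_apply_apply]

theorem Homog.contrTwo {k : ℕ} {α : Alt d} (h : Homog (k + 2) α) (Ω : (Vec d) [⋀^Fin 2]→L[ℝ] ℝ) :
    Homog k (contrTwo Ω α) := by
  rw [contrTwo_apply]
  exact (Homog.sum fun i => (h.ι _).ι _).smul _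

theorem contrTwo_of_homog_one {α : Alt d} (h : Homog 1 α) (Ω : (Vec d) [⋀^Fin 2]→L[ℝ] ℝ) :
    LCSForms.contrTwo Ω α = 0 := by
  simp [contrTwo_apply, ι_zero_of_homog (h.ι _)]

theorem contrTwo_of_homog_zero {α : Alt d} (h : Homog 0 α) (Ω : (Vec d) [⋀^Fin 2]→L[ℝ] ℝ) :
    LCSForms.contrTwo Ω α = 0 := by
  simp [contrTwo_apply, ι_zero_of_homog h]

/-! ### The canonical tensor under `♭`, and the Lefschetz commutator. -/

section Nondegenerate

variable {Ω : (Vec d) [⋀^Fin 2]→L[ℝ] ℝ}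

/-- Moving the canonical tensor `∑ eⁱ ⊗ eᵢ` through the musical isomorphism. -/
theorem Nondeg.sum_flat_comp (h : Nondeg Ω) {V : Type*} [AddCommGroup V] [Module ℝ V]
    (F : Cov d →ₗ[ℝ] Vec d →ₗ[ℝ] V) {N C : Vec d → Vec d}
    (hNC : ∀ X Y, pairing (flat Ω (N X)) Y = pairing (flat Ω (C Y)) X) :
    ∑ i, F (flat Ω (N (stdVec i))) (flatInv Ω (stdCov i)) =
      ∑ j, F (stdCov j) (C (stdVec j)) := by
  have h1 : ∀ i, F (flat Ω (N (stdVec i))) (flatInv Ω (stdCov i)) =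
      ∑ j, pairing (flat Ω (C (stdVec j))) (stdVec i) • F (stdCov j) (flatInv Ω (stdCov i)) := by
    intro i
    conv_lhs => rw [← sum_pairing_smul_stdCov (flat Ω (N (stdVec i)))]
    simp only [map_sum, map_smul, LinearMap.sum_apply, LinearMap.smul_apply, hNC]
  have h2 : ∀ j, F (stdCov j) (C (stdVec j)) =
      ∑ i, pairing (flat Ω (C (stdVec j))) (stdVec i) • F (stdCov j) (flatInv Ω (stdCov i)) := by
    intro j
    conv_lhs => rw [← h.flatInv_flat (C (stdVec j)),
      ← sum_pairing_smul_stdCov (flat Ω (C (stdVec j)))]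
    simp only [map_sum, map_smul]
  simp only [h1, h2]
  exact Finset.sum_comm

/-- The case `N = id`, `C = -id`: the sign is the skewness of `Ω`. -/
theorem Nondeg.sum_flat_flatInv (h : Nondeg Ω) {V : Type*} [AddCommGroup V] [Module ℝ V]
    (F : Cov d →ₗ[ℝ] Vec d →ₗ[ℝ] V) :
    ∑ i, F (flat Ω (stdVec i)) (flatInv Ω (stdCov i)) = -∑ i, F (stdCov i) (stdVec i) := by
  refine (h.sum_flat_comp F (N := id) (C := fun X => -X) fun X Y => ?_).trans ?_
  · rw [id, map_neg, map_neg, LinearMap.neg_apply, pairing_flat_swap]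
  · simp only [map_neg, Finset.sum_neg_distrib]

theorem Nondeg.sum_pairing_flatInv (h : Nondeg Ω) {V : Type*} [AddCommGroup V] [Module ℝ V]
    (F : Vec d →ₗ[ℝ] V) (a : Cov d) :
    ∑ i, pairing a (flatInv Ω (stdCov i)) • F (stdVec i) = -F (flatInv Ω a) := by
  conv_rhs => rw [← sum_pairing_smul_stdVec (flatInv Ω a)]
  rw [map_sum, ← Finset.sum_neg_distrib]
  exact Finset.sum_congr rfl fun i _ => by rw [h.pairing_flatInv_swap, map_smul, neg_smul]

/-- The commutator of contraction by the bivector and multiplication by the two-form. -/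
theorem Nondeg.contrTwo_wedgeTwo (h : Nondeg Ω) (α : Alt d) :
    contrTwo Ω (wedgeTwo Ω α) =
      wedgeTwo Ω (contrTwo Ω α) + ((d : ℝ) / 2) • α - degL α := by
  have h1 : ∀ i, ι (stdVec i) (ι (flatInv Ω (stdCov i)) (wedgeTwo Ω α)) =
      wedgeTwo Ω (ι (stdVec i) (ι (flatInv Ω (stdCov i)) α)) + α -
        ε (stdCov i) (ι (stdVec i) α) + ε (flat Ω (stdVec i)) (ι (flatInv Ω (stdCov i)) α) := by
    intro i
    rw [ι_wedgeTwo, h.flat_flatInv, map_add, ι_ε, ι_wedgeTwo, pairing_stdCov_stdVec, if_pos rfl,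
      one_smul]
    abel
  -- Both cross terms of the expansion are equal to `-degL α`, one directly and one through `♭`; the
  -- scalar terms add up to the dimension `d`. The prefactor `1/2` then gives `d/2 - deg`.
  have h2 := h.sum_flat_flatInv
    (LinearMap.mk₂ ℝ (fun a X => ε a (ι X α)) (by simp) (by simp) (by simp) (by simp))
  simp only [LinearMap.mk₂_apply, sum_ε_ι] at h2
  rw [contrTwo_apply, contrTwo_apply, Finset.sum_congr rfl fun i _ => h1 i,
    Finset.sum_add_distrib, Finset.sum_sub_distrib, Finset.sum_add_distrib, h2, sum_ε_ι, map_smul,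
    map_sum, Finset.sum_const, Finset.card_univ, Fintype.card_fin, ← Nat.cast_smul_eq_nsmul ℝ]
  module

/-- Since `Ω^s` has degree `2s`, moving the contraction through the factors adds up `d/2 - 2s` for
`s = 0, …, r`, and the total is `(r + 1)(d/2 - r)`. -/
theorem Nondeg.contrTwo_wedgeTwo_iterate (h : Nondeg Ω) (r : ℕ) :
    contrTwo Ω ((wedgeTwo Ω)^[r + 1] oneForm) =
      (((r : ℝ) + 1) * ((d : ℝ) / 2 - r)) • (wedgeTwo Ω)^[r] oneForm := by
  have hd : ∀ r : ℕ, Homog (2 * r) ((wedgeTwo Ω)^[r] (oneForm : Alt d)) := by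
    intro r
    induction r with
    | zero => exact homog_oneForm
    | succ r ih =>
      rw [Function.iterate_succ_apply']
      exact ih.wedgeTwo Ω
  induction r with
  | zero =>
    rw [Function.iterate_succ_apply', h.contrTwo_wedgeTwo, contrTwo_of_homog_zero (hd 0),
      (hd 0).degL_eq]
    simp
  | succ r ih =>
    rw [Function.iterate_succ_apply', h.contrTwo_wedgeTwo, ih, (hd (r + 1)).degL_eq, map_smul,
      ← Function.iterate_succ_apply' (wedgeTwo Ω)]
    push_cast
    module

end Nondegenerate

/-! ### The star operator -/

/-- The Liouville form `Ω^m / m!` of a two-form. -/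
def volForm (m : ℕ) (Ω : (Vec d) [⋀^Fin 2]→L[ℝ] ℝ) : Alt d :=
  (m.factorial : ℝ)⁻¹ • (wedgeTwo Ω)^[m] oneForm

theorem liouville_eq {m : ℕ} {Ω : Alt d} (h : Homog 2 Ω) : liouville m Ω = volForm m (Ω 2) := by
  have : wedge Ω = ⇑(wedgeTwo (Ω 2)) := funext fun β => wedge_two h β
  rw [liouville, volForm, this]

theorem homog_volForm (m : ℕ) (Ω : (Vec d) [⋀^Fin 2]→L[ℝ] ℝ) : Homog (2 * m) (volForm m Ω) := by
  refine Homog.smul ?_ _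
  induction m with
  | zero => exact homog_oneForm
  | succ r ih =>
    rw [Function.iterate_succ_apply']
    exact ih.wedgeTwo Ω

/-- The form `(-1)ᵏ / k! ∑ α(♭⁻¹ e^{i₁}, …, ♭⁻¹ e^{iₖ}) v(e_{i₁}, …, e_{iₖ}, ·, …, ·)`. -/
def starAux (Ω : (Vec d) [⋀^Fin 2]→L[ℝ] ℝ) : ℕ → Alt d →ₗ[ℝ] Alt d →ₗ[ℝ] Alt d
  | 0 => LinearMap.mk₂ ℝ (fun α v => α 0 (fun i => i.elim0) • v)
      (fun _ _ _ => add_smul _ _ _) (fun _ _ _ => by simp [mul_smul])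
      (fun _ _ _ => smul_add _ _ _) (fun _ _ _ => smul_comm _ _ _)
  | k + 1 => (-((k : ℝ) + 1)⁻¹) • ∑ i,
      (starAux Ω k).compl₁₂ (ι (flatInv Ω (stdCov i))) (ι (stdVec i))

theorem starAux_zero (Ω : (Vec d) [⋀^Fin 2]→L[ℝ] ℝ) (α v : Alt d) :
    starAux Ω 0 α v = α 0 (fun i => i.elim0) • v := rfl

theorem starAux_succ (Ω : (Vec d) [⋀^Fin 2]→L[ℝ] ℝ) (k : ℕ) (α v : Alt d) :
    starAux Ω (k + 1) α v = (-((k : ℝ) + 1)⁻¹) • ∑ i,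
      starAux Ω k (ι (flatInv Ω (stdCov i)) α) (ι (stdVec i) v) := by
  simp [starAux, LinearMap.sum_apply]

/-- Unfolding the recursion one index at a time identifies `starAux` with the coordinate formula
underlying `star`; the recursive form is the one suited to induction. -/
theorem starAux_eq (Ω : (Vec d) [⋀^Fin 2]→L[ℝ] ℝ) (k : ℕ) (α v : Alt d) :
    starAux Ω k α v = ((-1 : ℝ) ^ k * (k.factorial : ℝ)⁻¹) • ∑ I : Fin k → Fin d,
      α k (fun j => flatInv Ω (stdCov (I j))) • interiorMulti k (fun j => stdVec (I j)) v := by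
  induction k generalizing α v with
  | zero =>
    rw [starAux_zero]
    simp [interiorMulti]
    congr 2
    funext i
    exact i.elim0
  | succ k ih =>
    rw [starAux_succ, ← (Fin.consEquiv fun _ => Fin d).sum_comp, Fintype.sum_prod_type,
      Finset.smul_sum, Finset.smul_sum]
    refine Finset.sum_congr rfl fun i _ => ?_
    rw [ih, smul_smul]
    congr 1
    · rw [Nat.factorial_succ, pow_succ]
      push_cast
      rw [mul_inv]
      ring
    · refine Finset.sum_congr rfl fun I _ => ?_
      congr 1
      rw [ι_apply_apply]
      congr 1
      funext j
      refine Fin.cases ?_ (fun j => ?_) j <;> rfl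

theorem Homog.starAux {k l : ℕ} {v : Alt d} (h : Homog (k + l) v)
    (Ω : (Vec d) [⋀^Fin 2]→L[ℝ] ℝ) (α : Alt d) : Homog l (starAux Ω k α v) := by
  induction k generalizing α v with
  | zero =>
    rw [zero_add] at h
    exact h.smul _
  | succ k ih =>
    rw [starAux_succ]
    refine (Homog.sum fun i => ih ?_ _).smul _
    exact Homog.ι (by rwa [show k + l + 1 = k + 1 + l by omega]) _

theorem starAux_congr {k : ℕ} {α β : Alt d} (h : α k = β k) (Ω : (Vec d) [⋀^Fin 2]→L[ℝ] ℝ)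
    (v : Alt d) : starAux Ω k α v = starAux Ω k β v := by
  rw [starAux_eq, starAux_eq, h]

/-- Each of the `k` contractions applied to `v` anticommutes with `ι X`. -/
theorem starAux_ι_right (Ω : (Vec d) [⋀^Fin 2]→L[ℝ] ℝ) (k : ℕ) (X : Vec d) (α v : Alt d) :
    starAux Ω k α (ι X v) = (-1 : ℝ) ^ k • ι X (starAux Ω k α v) := by
  induction k generalizing α v with
  | zero => simp [starAux_zero]
  | succ k ih =>
    rw [starAux_succ, starAux_succ]
    simp only [ι_ι _ X, map_neg, ih, Finset.sum_neg_distrib, ← Finset.smul_sum, ← map_sum, map_smul,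
      pow_succ]
    module

/-- By the Clifford relation one contraction either meets `a`, giving one copy of the result, or
passes it. By induction the latter terms give `k` further copies, and the `k + 1` copies cancel the
factor `1/(k + 1)`. -/
theorem starAux_ε {Ω : (Vec d) [⋀^Fin 2]→L[ℝ] ℝ} (h : Nondeg Ω) (k : ℕ) (a : Cov d)
    (α v : Alt d) :
    starAux Ω (k + 1) (ε a α) v = (-1 : ℝ) ^ k • ι (flatInv Ω a) (starAux Ω k α v) := by
  have hs : ∀ k (α v : Alt d), ∑ i, pairing a (flatInv Ω (stdCov i)) •
      starAux Ω k α (ι (stdVec i) v) = -((-1 : ℝ) ^ k • ι (flatInv Ω a) (starAux Ω k α v)) := by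
    intro k α v
    rw [← starAux_ι_right]
    exact h.sum_pairing_flatInv ((starAux Ω k α) ∘ₗ ι.flip v) a
  induction k generalizing α v with
  | zero =>
    rw [starAux_succ]
    have h1 : ∀ β w : Alt d, starAux Ω 0 (ε a β) w = 0 := fun β w => by
      rw [starAux_zero, ε_zero_apply]
      simp
    simp only [ι_ε, map_sub, LinearMap.sub_apply, h1, sub_zero, map_smul, LinearMap.smul_apply, hs]
    simp
  | succ k ih =>
    rw [starAux_succ]
    simp only [ι_ε, map_sub, LinearMap.sub_apply, map_smul, LinearMap.smul_apply, hs, ih,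
      Finset.sum_sub_distrib, ← Finset.smul_sum, ← map_sum]
    have h2 : ∑ i, starAux Ω k (ι (flatInv Ω (stdCov i)) α) (ι (stdVec i) v) =
        (-((k : ℝ) + 1)) • starAux Ω (k + 1) α v := by
      rw [starAux_succ, smul_smul, neg_mul_neg, mul_inv_cancel₀ (by positivity), one_smul]
    rw [h2, map_smul, smul_smul, ← neg_smul, ← sub_smul, smul_smul]
    congr 1
    push_cast
    rw [pow_succ]
    have : (k : ℝ) + 1 + 1 ≠ 0 := by positivity
    field_simp
    ring

end

section

/-! ### Exchange rules for the star operator, and its involutivity. -/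

section Star

variable {m : ℕ} {Ω : (Vec (2 * m)) [⋀^Fin 2]→L[ℝ] ℝ}

/-- The star operator of a two-form, as a linear map. -/
def starL (m : ℕ) (Ω : (Vec (2 * m)) [⋀^Fin 2]→L[ℝ] ℝ) : Alt (2 * m) →ₗ[ℝ] Alt (2 * m) :=
  ∑ k ∈ Finset.range (2 * m + 1), (starAux Ω k).flip (volForm m Ω)

theorem starL_apply (Ω : (Vec (2 * m)) [⋀^Fin 2]→L[ℝ] ℝ) (α : Alt (2 * m)) :
    starL m Ω α = ∑ k ∈ Finset.range (2 * m + 1), starAux Ω k α (volForm m Ω) := by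
  simp [starL, LinearMap.sum_apply]

/-- By skewness, `β(#α) = Λ(α, β) = α(♭⁻¹β) = -β(♭⁻¹α)`. -/
theorem Nondeg.sharp_bivector {d : ℕ} {Ω : (Vec d) [⋀^Fin 2]→L[ℝ] ℝ} (h : Nondeg Ω) (c : Cov d) :
    sharp (bivector Ω) c = -flatInv Ω c := by
  have h1 : ∀ i, (bivector Ω).toContinuousLinearMap ![0, stdCov i] 0 c =
      pairing c (flatInv Ω (stdCov i)) := by
    intro i
    refine (bivector_apply h (Function.update ![0, stdCov i] 0 c)).trans ?_
    rw [Cov.apply_eq_pairing]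
    rfl
  simp only [sharp, _root_.sum_apply, ContinuousLinearMap.smulRight_apply, h1]
  exact h.sum_pairing_flatInv LinearMap.id c

/-- The sign `(-1)^k` in `sharpForm` cancels the `k` signs coming from `# = -♭⁻¹`, so only the
explicit `(-1)^k` of `star` survives, and `starAux` has that one built in. -/
theorem star_eq_starL {Ω : Alt (2 * m)} (hΩ : Homog 2 Ω) (h : Nondeg (Ω 2)) (α : Alt (2 * m)) :
    star m Ω α = starL m (Ω 2) α := by
  rw [star, starL_apply]
  refine Finset.sum_congr rfl fun k _ => ?_
  rw [starAux_eq, contract, mul_smul, liouville_eq hΩ]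
  congr 2
  refine Finset.sum_congr rfl fun I _ => ?_
  congr 1
  have h1 : ∀ j, sharp (bivector (Ω 2)) (stdCov (I j)) = (-1 : ℝ) • flatInv (Ω 2) (stdCov (I j)) :=
    fun j => by rw [h.sharp_bivector, neg_one_smul]
  have h2 : sharpForm (bivector (Ω 2)) (α k) (fun j => stdCov (I j)) =
      (-1 : ℝ) ^ k * α k (fun j => sharp (bivector (Ω 2)) (stdCov (I j))) := rfl
  rw [h2]
  simp only [h1]
  have h3 := (α k).toMultilinearMap.map_smul_univ (fun _ => (-1 : ℝ))
    (fun j => flatInv (Ω 2) (stdCov (I j)))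
  change α k _ = _ • α k _ at h3
  rw [h3, Finset.prod_const, Finset.card_univ, Fintype.card_fin, smul_eq_mul, ← mul_assoc,
    ← mul_pow]
  simp

theorem starL_of_homog {k : ℕ} {α : Alt (2 * m)} (h : Homog k α) (hk : k ≤ 2 * m)
    (Ω : (Vec (2 * m)) [⋀^Fin 2]→L[ℝ] ℝ) : starL m Ω α = starAux Ω k α (volForm m Ω) := by
  rw [starL_apply, Finset.sum_eq_single k]
  · intro j _ hj
    rw [starAux_congr (β := 0) (by rw [h j hj]; rfl)]
    simp
  · intro hk'
    simp at hk'
    omega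

theorem Homog.starL {k l : ℕ} {α : Alt (2 * m)} (h : Homog k α) (hk : k + l = 2 * m)
    (Ω : (Vec (2 * m)) [⋀^Fin 2]→L[ℝ] ℝ) : Homog l (starL m Ω α) := by
  rw [starL_of_homog h (by omega)]
  exact Homog.starAux (by rw [hk]; exact homog_volForm m Ω) Ω α

theorem starL_one (Ω : (Vec (2 * m)) [⋀^Fin 2]→L[ℝ] ℝ) :
    starL m Ω oneForm = volForm m Ω := by
  rw [starL_of_homog homog_oneForm (by omega), starAux_zero]
  simp [oneForm]

theorem Nondeg.starL_ε (h : Nondeg Ω) (a : Cov (2 * m)) (α : Alt (2 * m)) :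
    starL m Ω (ε a α) = ι (flatInv Ω a) (starL m Ω (sgn α)) := by
  -- The two sums are shifted by one degree. The unmatched bottom term vanishes because `a ∧ α` has
  -- no component of degree zero, the unmatched top term because it contracts a function.
  rw [starL_apply, starL_apply, Finset.sum_range_succ', Finset.sum_range_succ (n := 2 * m)]
  have h0 : starAux Ω 0 (ε a α) (volForm m Ω) = 0 := by
    rw [starAux_zero, ε_zero_apply]
    simp
  have h1 : ι (flatInv Ω a) (starAux Ω (2 * m) (sgn α) (volForm m Ω)) = 0 := by
    refine ι_zero_of_homog (Homog.starAux ?_ _ _) _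
    exact homog_volForm m Ω
  rw [h0, add_zero, map_add, h1, add_zero, map_sum]
  refine Finset.sum_congr rfl fun k _ => ?_
  rw [starAux_ε h, ← map_smul, ← LinearMap.smul_apply, ← map_smul]
  congr 1
  exact starAux_congr (by rw [Pi.smul_apply, sgn_apply]) _ _

/-- The degrees `k` and `2m - k` have the same parity. -/
theorem sgn_starL (Ω : (Vec (2 * m)) [⋀^Fin 2]→L[ℝ] ℝ) (α : Alt (2 * m)) :
    sgn (starL m Ω α) = starL m Ω (sgn α) := by
  rw [starL_apply, starL_apply, map_sum]
  refine Finset.sum_congr rfl fun k hk => ?_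
  have hk' : k + (2 * m - k) = 2 * m := by
    have := Finset.mem_range.mp hk
    omega
  rw [(Homog.starAux (l := 2 * m - k) (by rw [hk']; exact homog_volForm m Ω) Ω α).sgn_eq,
    starAux_congr (α := sgn α) (β := (-1 : ℝ) ^ k • α) rfl, map_smul, LinearMap.smul_apply]
  congr 1
  have : (-1 : ℝ) ^ k * (-1 : ℝ) ^ (2 * m - k) = 1 := by
    rw [← pow_add, hk', pow_mul]
    simp
  have h2 : (-1 : ℝ) ^ k * (-1 : ℝ) ^ k = 1 := by
    rw [← mul_pow]
    simp
  have h3 : (-1 : ℝ) ^ k ≠ 0 := pow_ne_zero _ (by norm_num)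
  exact mul_left_cancel₀ h3 (this.trans h2.symm)

/-- An inhomogeneous form is the sum of its components. -/
theorem sum_single (α : Alt d) : ∑ k ∈ Finset.range (d + 1), Pi.single k (α k) = α := by
  funext n
  rw [Finset.sum_apply]
  by_cases hn : n < d + 1
  · rw [Finset.sum_eq_single n]
    · simp
    · intro k _ hk
      simp [hk.symm]
    · intro h
      simp at h
      omega
  · rw [form_eq_zero_of_lt (by omega) (α n)]
    refine Finset.sum_eq_zero fun k hk => ?_
    have := Finset.mem_range.mp hk
    exact Pi.single_eq_of_ne (by omega) _

theorem homog_single {k : ℕ} (α : (Vec d) [⋀^Fin k]→L[ℝ] ℝ) : Homog k (Pi.single k α : Alt d) :=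
  fun _ hn => Pi.single_eq_of_ne hn _

/-- Induction over all forms. -/
theorem form_induction {P : Alt d → Prop} (one : P oneForm) (zero : P 0)
    (add : ∀ α β, P α → P β → P (α + β)) (smul : ∀ (c : ℝ) α, P α → P (c • α))
    (mul : ∀ (k : ℕ) a α, Homog k α → P α → P (ε a α)) (α : Alt d) : P α := by
  rw [← sum_single α]
  exact Finset.sum_induction _ P add zero fun k _ =>
    homog_induction one zero add smul mul (homog_single (α k))

/-- Induction along products with covectors: the Clifford relation holds on both sides of `⋆`, and
`b(X) = -(♭X)(♭⁻¹b)` matches the scalar terms. On functions the right-hand side vanishes because its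
degree exceeds the dimension. -/
theorem Nondeg.starL_ι (h : Nondeg Ω) (X : Vec (2 * m)) (α : Alt (2 * m)) :
    starL m Ω (ι X α) = ε (flat Ω X) (starL m Ω (sgn α)) := by
  induction α using form_induction generalizing X with
  | one =>
    rw [ι_zero_of_homog homog_oneForm, map_zero, homog_oneForm.sgn_eq, pow_zero, one_smul, starL_one]
    funext n
    by_cases hn : n = 2 * m + 1
    · exact (form_eq_zero_of_lt (by omega) _).symm
    · exact ((homog_volForm m Ω).ε _ n hn).symm
  | zero => simp
  | add α β hα hβ => simp [hα, hβ]
  | smul c α hα => simp [hα]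
  | mul k b γ hγ ih =>
    have h1 : starL m Ω (ι X (sgn γ)) = ε (flat Ω X) (starL m Ω γ) := by
      have := ih X
      rw [hγ.sgn_eq] at this ⊢
      rw [map_smul, map_smul, this, map_smul, map_smul, smul_smul, ← mul_pow]
      simp
    rw [ι_ε, map_sub, map_smul, h.starL_ε, sgn_ι, map_neg, h1, sgn_ε, map_neg, map_neg, h.starL_ε, sgn_sgn,
      map_neg, ι_ε, h.pairing_eq b X]
    module

/-- Two applications of the exchange rule give two signs `sgn`, which cancel up to the sign that
also reverses the order of the two contractions. -/
theorem Nondeg.starL_wedgeTwo (h : Nondeg Ω) (α : Alt (2 * m)) :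
    starL m Ω (wedgeTwo Ω α) = contrTwo Ω (starL m Ω α) := by
  simp only [wedgeTwo_apply, contrTwo_apply, map_smul, map_sum, h.starL_ε, sgn_ε, map_neg, sgn_sgn,
    h.flatInv_flat]
  congr 1
  refine Finset.sum_congr rfl fun i _ => ?_
  rw [ι_ι, neg_neg]

theorem Nondeg.starL_contrTwo (h : Nondeg Ω) (α : Alt (2 * m)) :
    starL m Ω (contrTwo Ω α) = wedgeTwo Ω (starL m Ω α) := by
  simp only [wedgeTwo_apply, contrTwo_apply, map_smul, map_sum, h.starL_ι, sgn_ι, map_neg, sgn_sgn,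
    h.flat_flatInv]
  congr 1
  refine Finset.sum_congr rfl fun i _ => ?_
  rw [ε_ε, neg_neg]

theorem Nondeg.starL_volForm (h : Nondeg Ω) : starL m Ω (volForm m Ω) = oneForm := by
  have h1 : ∀ r : ℕ, starL m Ω ((wedgeTwo Ω)^[r] oneForm) =
      (contrTwo Ω)^[r] (volForm m Ω) := by
    intro r
    induction r with
    | zero => exact starL_one Ω
    | succ r ih =>
      rw [Function.iterate_succ_apply', h.starL_wedgeTwo, ih, Function.iterate_succ_apply']
  -- With `d = 2m`, lowering `Ω^{s+1}` costs the factor `(s + 1)(m - s)`; the product of these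
  -- factors is the quotient of factorials stated here, and `r = m` reaches the constant form.
  have h2 : ∀ r ≤ m, (contrTwo Ω)^[r] (volForm m Ω) =
      ((r.factorial : ℝ) * ((m - r).factorial : ℝ)⁻¹) • (wedgeTwo Ω)^[m - r] oneForm := by
    intro r
    induction r with
    | zero => intro _; simp [volForm]
    | succ r ih =>
      intro hr
      obtain ⟨s, rfl⟩ : ∃ s, m = r + 1 + s := ⟨m - (r + 1), by omega⟩
      rw [Function.iterate_succ_apply', ih (by omega), show r + 1 + s - r = s + 1 by omega,
        show r + 1 + s - (r + 1) = s by omega, map_smul, h.contrTwo_wedgeTwo_iterate, smul_smul]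
      congr 1
      rw [Nat.factorial_succ, Nat.factorial_succ]
      push_cast
      have : ((s : ℝ) + 1) ≠ 0 := by positivity
      have : (s.factorial : ℝ) ≠ 0 := by positivity
      field_simp
      ring
  rw [volForm, map_smul, h1, h2 m le_rfl, smul_smul]
  have : (m.factorial : ℝ) ≠ 0 := by positivity
  simp [this]

/-- The star operator is an involution. -/
theorem Nondeg.starL_starL (h : Nondeg Ω) (α : Alt (2 * m)) : starL m Ω (starL m Ω α) = α := by
  induction α using form_induction with
  | one => rw [starL_one, h.starL_volForm]
  | zero => simp
  | add α β hα hβ => simp [hα, hβ]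
  | smul c α hα => simp [hα]
  | mul k b γ hγ ih =>
    -- The first star turns `b ∧` into a contraction by `♭⁻¹b`, the second turns it back; the two
    -- parity operators cancel because `⋆` preserves parity.
    rw [h.starL_ε, h.starL_ι, h.flat_flatInv, sgn_starL, sgn_sgn, ih]

end Star

end

section

/-! ### First-order variations of a two-form -/

variable {d : ℕ}

/-- The endomorphism `♭⁻¹ ∘ ζ` measuring a two-form `ζ` against a nondegenerate one. -/
def varEnd (Ω ζ : (Vec d) [⋀^Fin 2]→L[ℝ] ℝ) : Vec d →ₗ[ℝ] Vec d :=
  ((flatInv Ω).comp (flat ζ)).toLinearMap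

theorem varEnd_apply (Ω ζ : (Vec d) [⋀^Fin 2]→L[ℝ] ℝ) (X : Vec d) :
    varEnd Ω ζ X = flatInv Ω (flat ζ X) := rfl

theorem derivL_ε_of_pairing {B : Vec d →ₗ[ℝ] Vec d} {a b : Cov d}
    (h : ∀ X, pairing b X = pairing a (B X)) (α : Alt d) :
    derivL B (ε a α) = ε b α + ε a (derivL B α) := by
  rw [derivL_ε]
  congr 1
  conv_rhs => rw [← sum_pairing_smul_stdCov b]
  simp [map_sum, LinearMap.sum_apply, h]

/-- Exterior multiplication by a covector after interior multiplication by a vector. -/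
def ει : Cov d →ₗ[ℝ] Vec d →ₗ[ℝ] Alt d →ₗ[ℝ] Alt d :=
  LinearMap.mk₂ ℝ (fun a X => ε a ∘ₗ ι X) (fun _ _ _ => by ext; simp) (fun _ _ _ => by ext; simp)
    (fun _ _ _ => by ext; simp) (fun _ _ _ => by ext; simp)

theorem ει_apply (a : Cov d) (X : Vec d) (α : Alt d) : ει a X α = ε a (ι X α) := rfl

variable {Ω : (Vec d) [⋀^Fin 2]→L[ℝ] ℝ}

theorem Nondeg.pairing_flat_flatInv_stdCov (h : Nondeg Ω) (ζ : (Vec d) [⋀^Fin 2]→L[ℝ] ℝ)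
    (i : Fin d) (X : Vec d) :
    pairing (flat ζ (flatInv Ω (stdCov i))) X = pairing (stdCov i) (varEnd Ω ζ X) := by
  rw [varEnd_apply, h.pairing_flatInv_swap, pairing_flat_swap]

/-- For two-forms the transpose of `♭⁻¹ ∘ ζ` sends `eⁱ` to `ζ(♭⁻¹eⁱ, ·)`, so the endomorphism can be
moved from the vectors to the covectors of the canonical tensor. -/
theorem Nondeg.derivL_varEnd (h : Nondeg Ω) (ζ : (Vec d) [⋀^Fin 2]→L[ℝ] ℝ) (α : Alt d) :
    derivL (varEnd Ω ζ) α = ∑ i, ε (flat ζ (flatInv Ω (stdCov i))) (ι (stdVec i) α) := by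
  have := sum_comp_canonical (ει (d := d)) (fun i => flat ζ (flatInv Ω (stdCov i)))
    (varEnd Ω ζ) (h.pairing_flat_flatInv_stdCov ζ)
  have := congrArg (fun T : Alt d →ₗ[ℝ] Alt d => T α) this
  simp only [LinearMap.sum_apply, ει_apply] at this
  rw [this, derivL_apply]

theorem Nondeg.traceL_varEnd (h : Nondeg Ω) (ζ : (Vec d) [⋀^Fin 2]→L[ℝ] ℝ) :
    traceL (varEnd Ω ζ) = ∑ i, pairing (flat ζ (flatInv Ω (stdCov i))) (stdVec i) := by
  simp only [traceL, h.pairing_flat_flatInv_stdCov]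

/-- The derivation `D_B` with `B = ♭⁻¹ ∘ ζ` sends `Ω` to `2ζ`, one `ζ` from each slot. Hence a
variation `ζ` of `Ω` acts on powers of `Ω` as `½ D_B`. -/
theorem Nondeg.derivL_wedgeTwo (h : Nondeg Ω) (ζ : (Vec d) [⋀^Fin 2]→L[ℝ] ℝ) (α : Alt d) :
    derivL (varEnd Ω ζ) (wedgeTwo Ω α) =
      (2 : ℝ) • wedgeTwo ζ α + wedgeTwo Ω (derivL (varEnd Ω ζ) α) := by
  have h1 : ∀ i X, pairing (flat ζ (stdVec i)) X = pairing (flat Ω (stdVec i)) (varEnd Ω ζ X) := by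
    intro i X
    rw [varEnd_apply, ← neg_neg (pairing (flat Ω (stdVec i)) _), ← h.pairing_eq, pairing_flat_swap]
  have h2 := sum_comp_canonical
    (LinearMap.mk₂ ℝ (fun a X => ε a (ε (flat Ω X) α)) (by simp) (by simp) (by simp) (by simp))
    (fun i => flat ζ (flatInv Ω (stdCov i))) (varEnd Ω ζ) (h.pairing_flat_flatInv_stdCov ζ)
  simp only [LinearMap.mk₂_apply, varEnd_apply, h.flat_flatInv] at h2
  simp only [wedgeTwo_apply, map_smul, map_sum, derivL_ε_of_pairing (h1 _),
    derivL_ε_of_pairing (h.pairing_flat_flatInv_stdCov ζ _), map_add, Finset.sum_add_distrib, h2]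
  module

/-- Antisymmetry of the tensor `∑ ♭⁻¹(eⁱ) ⊗ eᵢ`. -/
theorem Nondeg.sum_flatInv_swap (h : Nondeg Ω) {V : Type*} [AddCommGroup V] [Module ℝ V]
    (F : Vec d →ₗ[ℝ] Vec d →ₗ[ℝ] V) :
    ∑ i, F (flatInv Ω (stdCov i)) (stdVec i) = -∑ i, F (stdVec i) (flatInv Ω (stdCov i)) := by
  have h1 : ∀ i, F (flatInv Ω (stdCov i)) (stdVec i) =
      ∑ j, pairing (stdCov j) (flatInv Ω (stdCov i)) • F (stdVec j) (stdVec i) := by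
    intro i
    conv_lhs => rw [← sum_pairing_smul_stdVec (flatInv Ω (stdCov i))]
    simp [map_sum, LinearMap.sum_apply]
  have h2 : ∀ j, F (stdVec j) (flatInv Ω (stdCov j)) =
      ∑ i, pairing (stdCov i) (flatInv Ω (stdCov j)) • F (stdVec j) (stdVec i) := by
    intro j
    conv_lhs => rw [← sum_pairing_smul_stdVec (flatInv Ω (stdCov j))]
    simp [map_sum]
  simp only [h1, h2]
  rw [Finset.sum_comm, ← Finset.sum_neg_distrib]
  refine Finset.sum_congr rfl fun j _ => ?_
  rw [← Finset.sum_neg_distrib]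
  exact Finset.sum_congr rfl fun i _ => by rw [h.pairing_flatInv_swap, neg_smul]

/-- The pointwise form of `dΩ = θ ∧ Ω`, where `η X` is the derivative of `Ω` along `X`. -/
def LeeIdentity (Ω : (Vec d) [⋀^Fin 2]→L[ℝ] ℝ) (η : Vec d →ₗ[ℝ] (Vec d) [⋀^Fin 2]→L[ℝ] ℝ)
    (θ : Cov d) : Prop :=
  ∀ X Y Z, pairing (flat (η X) Y) Z - pairing (flat (η Y) X) Z + pairing (flat (η Z) X) Y =
    pairing θ X * pairing (flat Ω Y) Z - pairing θ Y * pairing (flat Ω X) Z +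
      pairing θ Z * pairing (flat Ω X) Y

variable {η : Vec d →ₗ[ℝ] (Vec d) [⋀^Fin 2]→L[ℝ] ℝ} {θ : Cov d}

/-- The components of a two-form depend linearly on it. -/
def flatEval (Y Z : Vec d) : ((Vec d) [⋀^Fin 2]→L[ℝ] ℝ) →ₗ[ℝ] ℝ where
  toFun ζ := pairing (flat ζ Y) Z
  map_add' _ _ := rfl
  map_smul' _ _ := rfl

theorem flatEval_apply (Y Z : Vec d) (ζ : (Vec d) [⋀^Fin 2]→L[ℝ] ℝ) :
    flatEval Y Z ζ = pairing (flat ζ Y) Z := rfl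

theorem sum_pairing_mul_flat (η : Vec d →ₗ[ℝ] (Vec d) [⋀^Fin 2]→L[ℝ] ℝ) (X Y Z : Vec d) :
    ∑ j, pairing (flat (η (stdVec j)) X) Y * pairing (stdCov j) Z = pairing (flat (η Z) X) Y := by
  rw [← flatEval_apply X Y (η Z)]
  conv_rhs => rw [← sum_pairing_smul_stdVec Z]
  simp [map_sum, flatEval_apply, mul_comm]

/-- The covariant two-tensor `(X, Y) ↦ η_X(Y, Z)`. -/
def varForm (η : Vec d →ₗ[ℝ] (Vec d) [⋀^Fin 2]→L[ℝ] ℝ) (Z : Vec d) : Vec d →ₗ[ℝ] Vec d →ₗ[ℝ] ℝ :=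
  LinearMap.mk₂ ℝ (fun X Y => pairing (flat (η X) Y) Z)
    (fun X X' Y => by rw [map_add]; rfl) (fun c X Y => by rw [map_smul]; rfl)
    (by simp) (by simp)

theorem wedgeTwo_add (ζ ζ' : (Vec d) [⋀^Fin 2]→L[ℝ] ℝ) (α : Alt d) :
    wedgeTwo (ζ + ζ') α = wedgeTwo ζ α + wedgeTwo ζ' α := by
  have : ∀ X, flat (ζ + ζ') X = flat ζ X + flat ζ' X := fun _ => rfl
  simp [wedgeTwo_apply, this, Finset.sum_add_distrib]

theorem wedgeTwo_smul (c : ℝ) (ζ : (Vec d) [⋀^Fin 2]→L[ℝ] ℝ) (α : Alt d) :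
    wedgeTwo (c • ζ) α = c • wedgeTwo ζ α := by
  have : ∀ X, flat (c • ζ) X = c • flat ζ X := fun _ => rfl
  simp only [wedgeTwo_apply, this, map_smul, LinearMap.smul_apply, ← Finset.smul_sum]
  exact smul_comm _ _ _

/-- The Lee identity is solved for `η_Y` and antisymmetrised over the other two slots; the two terms
with `η_{eᵢ}(Y, ·)` coincide after antisymmetrisation, which cancels the `1/2` in `wedgeTwo`. -/
theorem LeeIdentity.sum_ε_ε_flat (hL : LeeIdentity Ω η θ) (Y : Vec d) (α : Alt d) :
    ∑ i, ε (stdCov i) (ε (flat (η (stdVec i)) Y) α) =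
      wedgeTwo (η Y) α - pairing θ Y • wedgeTwo Ω α + ε θ (ε (flat Ω Y) α) := by
  have h1 : ∀ i, flat (η Y) (stdVec i) = flat (η (stdVec i)) Y -
      ∑ j, pairing (flat (η (stdVec j)) Y) (stdVec i) • stdCov j +
      (pairing θ Y • flat Ω (stdVec i) - pairing θ (stdVec i) • flat Ω Y +
        pairing (flat Ω Y) (stdVec i) • θ) := by
    intro i
    refine Cov.ext_pairing fun Z => ?_
    have h2 := hL Y (stdVec i) Z
    have h3 := sum_pairing_mul_flat η Y (stdVec i) Z
    simp only [map_add, map_sub, map_sum, map_smul, LinearMap.add_apply, LinearMap.sub_apply,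
      LinearMap.sum_apply, LinearMap.smul_apply, smul_eq_mul, h3]
    linarith
  have h4 : ∑ i, ∑ j, pairing (flat (η (stdVec j)) Y) (stdVec i) • ε (stdCov i) (ε (stdCov j) α) =
      -∑ j, ε (stdCov j) (ε (flat (η (stdVec j)) Y) α) := by
    rw [Finset.sum_comm, ← Finset.sum_neg_distrib]
    refine Finset.sum_congr rfl fun j _ => ?_
    rw [ε_ε, neg_neg]
    conv_rhs => rw [← sum_pairing_smul_stdCov (flat (η (stdVec j)) Y)]
    simp [map_sum, LinearMap.sum_apply]
  have h5 : ∑ i, pairing θ (stdVec i) • ε (stdCov i) (ε (flat Ω Y) α) = ε θ (ε (flat Ω Y) α) := by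
    conv_rhs => rw [← sum_pairing_smul_stdCov θ]
    simp [map_sum, LinearMap.sum_apply]
  have h6 : ∑ i, pairing (flat Ω Y) (stdVec i) • ε (stdCov i) (ε θ α) = -ε θ (ε (flat Ω Y) α) := by
    rw [ε_ε, neg_neg]
    conv_rhs => rw [← sum_pairing_smul_stdCov (flat Ω Y)]
    simp [map_sum, LinearMap.sum_apply]
  rw [wedgeTwo_apply (η Y)]
  simp only [h1, map_add, map_sub, map_sum, map_smul, LinearMap.add_apply, LinearMap.sub_apply,
    LinearMap.sum_apply, LinearMap.smul_apply, Finset.sum_add_distrib, Finset.sum_sub_distrib, h4,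
    h5, h6, ← Finset.smul_sum]
  rw [wedgeTwo_apply Ω]
  module

/-- The Lee identity is contracted with the bivector in two of its three slots. On the left two
terms coincide and the third is a trace; on the right the coefficients are `-1`, `-1` and `d`. -/
theorem LeeIdentity.sum_flat_flatInv (hL : LeeIdentity Ω η θ) (h : Nondeg Ω) :
    ∑ i, flat (η (stdVec i)) (flatInv Ω (stdCov i)) -
        (2 : ℝ)⁻¹ • ∑ i, traceL (varEnd Ω (η (stdVec i))) • stdCov i = (1 - (d : ℝ) / 2) • θ := by
  refine Cov.ext_pairing fun Z => ?_
  have h1 := Finset.sum_congr (Eq.refl Finset.univ)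
    fun (j : Fin d) _ => hL (flatInv Ω (stdCov j)) (stdVec j) Z
  have h2 : ∑ j, pairing (flat (η (flatInv Ω (stdCov j))) (stdVec j)) Z =
      -∑ j, pairing (flat (η (stdVec j)) (flatInv Ω (stdCov j))) Z :=
    h.sum_flatInv_swap (varForm η Z)
  have h3 : ∑ j, pairing θ (flatInv Ω (stdCov j)) * pairing (flat Ω (stdVec j)) Z =
      -pairing θ Z := by
    have := h.sum_pairing_flatInv (pairing.flip Z ∘ₗ (flat Ω).toLinearMap) θ
    simp only [LinearMap.comp_apply, LinearMap.flip_apply, ContinuousLinearMap.coe_coe, smul_eq_mul,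
      h.flat_flatInv] at this
    exact this
  have h4 : ∑ j, pairing θ (stdVec j) * pairing (stdCov j) Z = pairing θ Z := by
    conv_rhs => rw [← sum_pairing_smul_stdCov θ]
    simp [map_sum, LinearMap.sum_apply]
  have h5 : ∑ j, traceL (varEnd Ω (η (stdVec j))) * pairing (stdCov j) Z =
      ∑ j, pairing (flat (η Z) (flatInv Ω (stdCov j))) (stdVec j) := by
    simp only [h.traceL_varEnd, Finset.sum_mul]
    rw [Finset.sum_comm]
    exact Finset.sum_congr rfl fun i _ => sum_pairing_mul_flat η _ _ Z
  simp only [Finset.sum_add_distrib, Finset.sum_sub_distrib, h2, h.flat_flatInv, h3, h4,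
    pairing_stdCov_stdVec, if_true, mul_one, Finset.sum_const, Finset.card_univ, Fintype.card_fin,
    nsmul_eq_mul] at h1
  simp only [map_sub, map_sum, map_smul, LinearMap.sub_apply, LinearMap.sum_apply,
    LinearMap.smul_apply, smul_eq_mul, h5]
  linarith

/-- Collects all terms in which `Ω`, rather than the form, is differentiated when the commutator of
`d` and `i(Λ)` is carried through `⋆`; here `Φ` stands for the starred form. The terms `η(eᵢ) ∧ ι Φ`
from the two sums cancel by antisymmetry of the bivector, and the rest is expressed through `θ`. -/
theorem LeeIdentity.sum_variation (hL : LeeIdentity Ω η θ) (h : Nondeg Ω) (Φ : Alt d) :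
    ∑ i, ε (stdCov i) (derivL (varEnd Ω (η (stdVec i))) Φ -
          ((2 : ℝ)⁻¹ * traceL (varEnd Ω (η (stdVec i)))) • Φ) +
        ∑ i, ι (flatInv Ω (stdCov i)) (wedgeTwo (η (stdVec i)) Φ) =
      ε θ (degL Φ) + (1 - (d : ℝ) / 2) • ε θ Φ + wedgeTwo Ω (ι (flatInv Ω θ) Φ) := by
  have h1 : ∑ i, ε (stdCov i) (derivL (varEnd Ω (η (stdVec i))) Φ) =
      ∑ j, wedgeTwo (η (flatInv Ω (stdCov j))) (ι (stdVec j) Φ) +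
        wedgeTwo Ω (ι (flatInv Ω θ) Φ) + ε θ (degL Φ) := by
    have h2 := h.sum_pairing_flatInv (wedgeTwo Ω ∘ₗ ι.flip Φ) θ
    simp only [LinearMap.comp_apply, LinearMap.flip_apply] at h2
    simp only [h.derivL_varEnd, map_sum]
    rw [Finset.sum_comm]
    simp only [hL.sum_ε_ε_flat, h.flat_flatInv, Finset.sum_add_distrib, Finset.sum_sub_distrib, h2,
      ← map_sum, sum_ε_ι]
    abel
  have h3 : ∑ j, wedgeTwo (η (flatInv Ω (stdCov j))) (ι (stdVec j) Φ) =
      -∑ j, wedgeTwo (η (stdVec j)) (ι (flatInv Ω (stdCov j)) Φ) :=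
    h.sum_flatInv_swap (LinearMap.mk₂ ℝ (fun X Y => wedgeTwo (η X) (ι Y Φ))
      (fun X X' Y => by rw [map_add, wedgeTwo_add])
      (fun c X Y => by rw [map_smul, wedgeTwo_smul]) (by simp) (by simp))
  have h4 : ∑ i, ε (flat (η (stdVec i)) (flatInv Ω (stdCov i))) Φ -
      ∑ i, ((2 : ℝ)⁻¹ * traceL (varEnd Ω (η (stdVec i)))) • ε (stdCov i) Φ =
        (1 - (d : ℝ) / 2) • ε θ Φ := by
    have := congrArg (fun a => ε a Φ) (hL.sum_flat_flatInv h)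
    simpa only [map_sub, map_smul, map_sum, LinearMap.sub_apply, LinearMap.smul_apply,
      LinearMap.sum_apply, Finset.smul_sum, smul_smul] using this
  simp only [map_sub, map_smul, Finset.sum_sub_distrib, h1, ι_wedgeTwo, Finset.sum_add_distrib, h3,
    ← h4]
  abel

/-- An infinitesimal form of the invariance of the star operator along `E = ♭⁻¹(θ)`; here `N` is the
derivative of `E` and `τ` that of `θ`. -/
theorem LeeIdentity.starL_derivL {m : ℕ} {Ω : (Vec (2 * m)) [⋀^Fin 2]→L[ℝ] ℝ}
    {η : Vec (2 * m) →ₗ[ℝ] (Vec (2 * m)) [⋀^Fin 2]→L[ℝ] ℝ} {θ : Cov (2 * m)}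
    (hL : LeeIdentity Ω η θ) (h : Nondeg Ω) {N : Vec (2 * m) →ₗ[ℝ] Vec (2 * m)}
    {τ : Vec (2 * m) → Cov (2 * m)}
    (hN : ∀ X, flat (η X) (flatInv Ω θ) + flat Ω (N X) = τ X)
    (hτ : ∀ X Y, pairing (τ X) Y = pairing (τ Y) X) (β : Alt (2 * m)) :
    starL m Ω (derivL N β) = derivL N (starL m Ω β) +
      (derivL (varEnd Ω (η (flatInv Ω θ))) (starL m Ω β) -
        ((2 : ℝ)⁻¹ * traceL (varEnd Ω (η (flatInv Ω θ)))) • starL m Ω β) := by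
  set E := flatInv Ω θ with hE
  have hflat : flat Ω E = θ := h.flat_flatInv θ
  -- This is `L_EΩ = 0` written out: the derivative of `Ω` along `E` is compensated by `N` acting in
  -- both slots. It combines the Lee identity at `E`, the symmetry of `τ` and `θ(E) = 0`.
  have hC : ∀ X Y, pairing (flat Ω (N X)) Y =
      pairing (flat Ω ((N + varEnd Ω (η E)) Y)) X := by
    intro X Y
    have h1 : ∀ X Y, pairing (flat Ω (N X)) Y = pairing (τ X) Y - pairing (flat (η X) E) Y := by
      intro X Y
      rw [← hN X, map_add, LinearMap.add_apply]
      ring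
    have h2 := hL E Y X
    have h3 : pairing θ E = 0 := by
      rw [← hflat]
      exact pairing_flat_self Ω E
    rw [LinearMap.add_apply, map_add, map_add, LinearMap.add_apply, varEnd_apply, h.flat_flatInv, h1,
      h1, hτ X Y]
    rw [hflat, h3] at h2
    linarith
  have h4 := h.sum_flat_comp ει hC
  have h5 := h.sum_flat_comp pairing hC
  have h6 : ∑ i, pairing (flat Ω (N (stdVec i))) (flatInv Ω (stdCov i)) = -traceL N := by
    rw [traceL, ← Finset.sum_neg_distrib]
    exact Finset.sum_congr rfl fun i _ => by rw [h.pairing_eq (stdCov i), neg_neg]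
  -- Taking the trace of the adjunction `hC` gives `-tr N = tr N + tr B`, so the scalar left over by
  -- the Clifford relation is exactly the `-½ tr B` of the claim.
  have h7 : traceL N = -((2 : ℝ)⁻¹ * traceL (varEnd Ω (η E))) := by
    rw [h6] at h5
    simp only [LinearMap.add_apply, map_add, Finset.sum_add_distrib] at h5
    change -traceL N = traceL N + traceL _ at h5
    linarith
  have h8 : starL m Ω (derivL N β) = ∑ i, (ε (flat Ω (N (stdVec i)))
      (ι (flatInv Ω (stdCov i)) (starL m Ω β)) -
        pairing (flat Ω (N (stdVec i))) (flatInv Ω (stdCov i)) • starL m Ω β) := by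
    rw [derivL_apply, map_sum]
    refine Finset.sum_congr rfl fun i _ => ?_
    rw [h.starL_ε, sgn_ι, map_neg, h.starL_ι, sgn_sgn, map_neg, ι_ε]
    abel
  have h9 := congrArg (fun T : Alt (2 * m) →ₗ[ℝ] Alt (2 * m) => T (starL m Ω β)) h4
  simp only [LinearMap.sum_apply, ει_apply, LinearMap.add_apply, map_add, Finset.sum_add_distrib]
    at h9
  rw [h8, Finset.sum_sub_distrib, h9, ← Finset.sum_smul, h6, ← derivL_apply, h7,
    derivL_apply (varEnd _ _)]
  module

end

section

/-! ## Calculus of forms on an open subset of `ℝᵈ` -/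

variable {d : ℕ}

/-- Smoothness at a point of a field of forms on `ℝᵈ`. -/
def SmoothAt (A : Vec d → Alt d) (y : Vec d) : Prop :=
  ∀ n, ContDiffAt ℝ ∞ (fun z => A z n) y

theorem SmoothAt.differentiableAt {A : Vec d → Alt d} {y : Vec d} (h : SmoothAt A y) (n : ℕ) :
    DifferentiableAt ℝ (fun z => A z n) y :=
  (h n).differentiableAt (by simp)

/-- The directional derivatives of a field of forms on `ℝᵈ`. -/
def pd (A : Vec d → Alt d) (y : Vec d) : Vec d →ₗ[ℝ] Alt d where
  toFun v n := fderiv ℝ (fun z => A z n) y v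
  map_add' v w := by funext n; simp
  map_smul' c v := by funext n; simp

theorem pd_apply (A : Vec d → Alt d) (y v : Vec d) (n : ℕ) :
    pd A y v n = fderiv ℝ (fun z => A z n) y v := rfl

theorem pd_congr {A B : Vec d → Alt d} {y : Vec d} (h : A =ᶠ[nhds y] B) : pd A y = pd B y := by
  ext v n : 2
  rw [pd_apply, pd_apply, Filter.EventuallyEq.fderiv_eq]
  filter_upwards [h] with z hz
  rw [hz]

theorem SmoothAt.congr {A B : Vec d → Alt d} {y : Vec d} (hB : SmoothAt B y) (h : A =ᶠ[nhds y] B) :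
    SmoothAt A y := fun n => (hB n).congr_of_eventuallyEq (by
  filter_upwards [h] with z hz
  rw [hz])

theorem SmoothAt.const (α : Alt d) (y : Vec d) : SmoothAt (fun _ => α) y := fun _ => contDiffAt_const

theorem pd_const (α : Alt d) (y : Vec d) : pd (fun _ => α) y = 0 := by
  ext v n : 2
  simp [pd_apply]

theorem SmoothAt.const_smul {A : Vec d → Alt d} {y : Vec d} (hA : SmoothAt A y) (c : ℝ) :
    SmoothAt (fun z => c • A z) y := fun n => contDiffAt_const.smul (hA n)

theorem SmoothAt.smul {A : Vec d → Alt d} {f : Vec d → ℝ} {y : Vec d} (hf : ContDiffAt ℝ ∞ f y)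
    (hA : SmoothAt A y) : SmoothAt (fun z => f z • A z) y := fun n => hf.smul (hA n)

theorem SmoothAt.sum {I : Type*} {s : Finset I} {A : I → Vec d → Alt d} {y : Vec d}
    (hA : ∀ i, SmoothAt (A i) y) : SmoothAt (fun z => ∑ i ∈ s, A i z) y := by
  intro n
  simp only [Finset.sum_apply]
  exact ContDiffAt.sum fun i _ => hA i n

theorem pd_const_smul {A : Vec d → Alt d} {y : Vec d} (hA : SmoothAt A y) (c : ℝ) :
    pd (fun z => c • A z) y = c • pd A y := by
  ext v n : 2
  simp only [pd_apply, Pi.smul_apply, LinearMap.smul_apply]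
  rw [fderiv_fun_const_smul (hA.differentiableAt n)]
  rfl

theorem pd_smul {A : Vec d → Alt d} {f : Vec d → ℝ} {y : Vec d} (hf : DifferentiableAt ℝ f y)
    (hA : SmoothAt A y) (v : Vec d) :
    pd (fun z => f z • A z) y v = fderiv ℝ f y v • A y + f y • pd A y v := by
  funext n
  simp only [pd_apply, Pi.smul_apply, Pi.add_apply]
  rw [fderiv_fun_smul hf (hA.differentiableAt n)]
  simp [add_comm]

theorem pd_sum {I : Type*} {s : Finset I} {A : I → Vec d → Alt d} {y : Vec d}
    (hA : ∀ i, SmoothAt (A i) y) : pd (fun z => ∑ i ∈ s, A i z) y = ∑ i ∈ s, pd (A i) y := by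
  ext v n : 2
  simp only [pd_apply, Finset.sum_apply, LinearMap.sum_apply]
  rw [fderiv_fun_sum fun i _ => (hA i).differentiableAt n]
  simp

/-- Interior multiplication of an `(n + 1)`-form by a vector, as a continuous bilinear map. -/
def insCLM (n : ℕ) :
    Vec d →L[ℝ] ((Vec d) [⋀^Fin (n + 1)]→L[ℝ] ℝ) →L[ℝ] ((Vec d) [⋀^Fin n]→L[ℝ] ℝ) :=
  (ContinuousAlternatingMap.curryLeftLI (𝕜 := ℝ) (E := Vec d) (F := ℝ)
    (n := n)).toContinuousLinearMap.flip

/-- `♭` as a continuous linear map in the two-form. -/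
def flatCLM : ((Vec d) [⋀^Fin 2]→L[ℝ] ℝ) →L[ℝ] Vec d →L[ℝ] Cov d :=
  (ContinuousAlternatingMap.curryLeftLI (𝕜 := ℝ) (E := Vec d) (F := ℝ)
    (n := 1)).toContinuousLinearMap

/-! ### Leibniz rules for the algebraic operations. -/

section Leibniz

variable {A : Vec d → Alt d} {a : Vec d → Cov d} {X : Vec d → Vec d}
  {ζ : Vec d → (Vec d) [⋀^Fin 2]→L[ℝ] ℝ} {y : Vec d}

theorem contDiffAt_bilinear {E F G : Type*} [NormedAddCommGroup E] [NormedSpace ℝ E]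
    [NormedAddCommGroup F] [NormedSpace ℝ F] [NormedAddCommGroup G] [NormedSpace ℝ G]
    (B : E →L[ℝ] F →L[ℝ] G) {f : Vec d → E} {g : Vec d → F} (hf : ContDiffAt ℝ ∞ f y)
    (hg : ContDiffAt ℝ ∞ g y) : ContDiffAt ℝ ∞ (fun z => B (f z) (g z)) y :=
  (B.contDiff.contDiffAt.comp y hf).clm_apply hg

theorem fderiv_bilinear {E F G : Type*} [NormedAddCommGroup E] [NormedSpace ℝ E]
    [NormedAddCommGroup F] [NormedSpace ℝ F] [NormedAddCommGroup G] [NormedSpace ℝ G]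
    (B : E →L[ℝ] F →L[ℝ] G) {f : Vec d → E} {g : Vec d → F} (hf : ContDiffAt ℝ ∞ f y)
    (hg : ContDiffAt ℝ ∞ g y) (v : Vec d) :
    fderiv ℝ (fun z => B (f z) (g z)) y v = B (fderiv ℝ f y v) (g y) + B (f y) (fderiv ℝ g y v) := by
  have h := B.hasFDerivAt_of_bilinear (hf.differentiableAt (by simp)).hasFDerivAt
    (hg.differentiableAt (by simp)).hasFDerivAt
  rw [h.fderiv]
  simp [add_comm]

theorem SmoothAt.ε (ha : ContDiffAt ℝ ∞ a y) (hA : SmoothAt A y) :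
    SmoothAt (fun z => ε (a z) (A z)) y := by
  intro n
  cases n with
  | zero => exact contDiffAt_const
  | succ n => exact contDiffAt_bilinear (wedgeCov n) ha (hA n)

theorem pd_ε (ha : ContDiffAt ℝ ∞ a y) (hA : SmoothAt A y) (v : Vec d) :
    pd (fun z => ε (a z) (A z)) y v = ε (fderiv ℝ a y v) (A y) + ε (a y) (pd A y v) := by
  funext n
  cases n with
  | zero => simp [pd_apply, ε_zero_apply]
  | succ n => exact fderiv_bilinear (wedgeCov n) ha (hA n) v

theorem pd_const_ε (a : Cov d) (hA : SmoothAt A y) (v : Vec d) :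
    pd (fun z => ε a (A z)) y v = ε a (pd A y v) := by
  simp [pd_ε contDiffAt_const hA]

theorem SmoothAt.ι (hX : ContDiffAt ℝ ∞ X y) (hA : SmoothAt A y) :
    SmoothAt (fun z => ι (X z) (A z)) y := fun n =>
  contDiffAt_bilinear (insCLM n) hX (hA (n + 1))

theorem pd_ι (hX : ContDiffAt ℝ ∞ X y) (hA : SmoothAt A y) (v : Vec d) :
    pd (fun z => ι (X z) (A z)) y v = ι (fderiv ℝ X y v) (A y) + ι (X y) (pd A y v) :=
  funext fun n => fderiv_bilinear (insCLM n) hX (hA (n + 1)) v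

theorem contDiffAt_flat (hζ : ContDiffAt ℝ ∞ ζ y) (hX : ContDiffAt ℝ ∞ X y) :
    ContDiffAt ℝ ∞ (fun z => flat (ζ z) (X z)) y :=
  contDiffAt_bilinear flatCLM hζ hX

theorem fderiv_flat (hζ : ContDiffAt ℝ ∞ ζ y) (hX : ContDiffAt ℝ ∞ X y) (v : Vec d) :
    fderiv ℝ (fun z => flat (ζ z) (X z)) y v =
      flat (fderiv ℝ ζ y v) (X y) + flat (ζ y) (fderiv ℝ X y v) :=
  fderiv_bilinear flatCLM hζ hX v

theorem SmoothAt.wedgeTwo (hζ : ContDiffAt ℝ ∞ ζ y) (hA : SmoothAt A y) :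
    SmoothAt (fun z => wedgeTwo (ζ z) (A z)) y := by
  simp only [wedgeTwo_apply]
  exact (SmoothAt.sum fun i =>
    (hA.ε (contDiffAt_flat hζ contDiffAt_const)).ε contDiffAt_const).const_smul _

theorem pd_wedgeTwo (hζ : ContDiffAt ℝ ∞ ζ y) (hA : SmoothAt A y) (v : Vec d) :
    pd (fun z => wedgeTwo (ζ z) (A z)) y v =
      wedgeTwo (fderiv ℝ ζ y v) (A y) + wedgeTwo (ζ y) (pd A y v) := by
  have h1 : ∀ i : Fin d, SmoothAt (fun z => LCSForms.ε (flat (ζ z) (stdVec i)) (A z)) y :=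
    fun i => hA.ε (contDiffAt_flat hζ contDiffAt_const)
  have h2 : ∀ i : Fin d, SmoothAt
      (fun z => LCSForms.ε (stdCov i) (LCSForms.ε (flat (ζ z) (stdVec i)) (A z))) y :=
    fun i => (h1 i).ε contDiffAt_const
  simp only [wedgeTwo_apply]
  rw [pd_const_smul (SmoothAt.sum h2), pd_sum h2]
  simp only [LinearMap.smul_apply, LinearMap.sum_apply, pd_const_ε _ (h1 _),
    pd_ε (contDiffAt_flat hζ contDiffAt_const) hA, fderiv_flat hζ contDiffAt_const, map_add,
    fderiv_fun_const, Pi.zero_apply, _root_.zero_apply, map_zero, add_zero,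
    Finset.sum_add_distrib, smul_add]

theorem contDiffAt_flatInv (hζ : ContDiffAt ℝ ∞ ζ y) (ha : ContDiffAt ℝ ∞ a y)
    (hN : Nondeg (ζ y)) : ContDiffAt ℝ ∞ (fun z => flatInv (ζ z) (a z)) y := by
  have h1 : ContDiffAt ℝ ∞ (fun z => flat (ζ z)) y := flatCLM.contDiff.contDiffAt.comp y hζ
  exact ((hN.isInvertible_flat.contDiffAt_map_inverse (n := ∞)).comp y h1).clm_apply ha

/-- The derivative of `♭⁻¹`. -/
theorem fderiv_flatInv (hζ : ContDiffAt ℝ ∞ ζ y) (ha : ContDiffAt ℝ ∞ a y)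
    (hN : ∀ᶠ z in nhds y, Nondeg (ζ z)) (v : Vec d) :
    flat (fderiv ℝ ζ y v) (flatInv (ζ y) (a y)) +
      flat (ζ y) (fderiv ℝ (fun z => flatInv (ζ z) (a z)) y v) = fderiv ℝ a y v := by
  rw [← fderiv_flat hζ (contDiffAt_flatInv hζ ha hN.self_of_nhds), Filter.EventuallyEq.fderiv_eq]
  filter_upwards [hN] with z hz
  exact hz.flat_flatInv (a z)

theorem SmoothAt.contrTwo (hζ : ContDiffAt ℝ ∞ ζ y) (hN : Nondeg (ζ y)) (hA : SmoothAt A y) :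
    SmoothAt (fun z => contrTwo (ζ z) (A z)) y := by
  simp only [contrTwo_apply]
  exact (SmoothAt.sum fun i =>
    (hA.ι (contDiffAt_flatInv hζ contDiffAt_const hN)).ι contDiffAt_const).const_smul _

theorem SmoothAt.volForm (m : ℕ) (hζ : ContDiffAt ℝ ∞ ζ y) :
    SmoothAt (fun z => volForm m (ζ z)) y := by
  refine SmoothAt.const_smul ?_ _
  induction m with
  | zero => exact SmoothAt.const _ _
  | succ r ih =>
    simp only [Function.iterate_succ_apply']
    exact ih.wedgeTwo hζ

theorem SmoothAt.starAux (hζ : ContDiffAt ℝ ∞ ζ y) (hN : Nondeg (ζ y)) (k : ℕ)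
    {V : Vec d → Alt d} (hA : SmoothAt A y) (hV : SmoothAt V y) :
    SmoothAt (fun z => starAux (ζ z) k (A z) (V z)) y := by
  induction k generalizing A V with
  | zero =>
    simp only [starAux_zero]
    refine SmoothAt.smul ?_ hV
    exact (ContinuousAlternatingMap.apply ℝ (Vec d) ℝ
      (fun i : Fin 0 => i.elim0)).contDiff.contDiffAt.comp y (hA 0)
  | succ k ih =>
    simp only [starAux_succ]
    exact (SmoothAt.sum fun i => ih (hA.ι (contDiffAt_flatInv hζ contDiffAt_const hN))
      (hV.ι contDiffAt_const)).const_smul _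

end Leibniz

/-! ### Differentiating the star operator. -/

section Star

variable {m : ℕ} {A : Vec (2 * m) → Alt (2 * m)} {a : Vec (2 * m) → Cov (2 * m)}
  {Ω : Vec (2 * m) → (Vec (2 * m)) [⋀^Fin 2]→L[ℝ] ℝ} {y : Vec (2 * m)}

theorem SmoothAt.starL (hΩ : ContDiffAt ℝ ∞ Ω y) (hN : Nondeg (Ω y)) (hA : SmoothAt A y) :
    SmoothAt (fun z => starL m (Ω z) (A z)) y := by
  simp only [starL_apply]
  exact SmoothAt.sum fun k => hA.starAux hΩ hN k (SmoothAt.volForm m hΩ)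

/-- By `Nondeg.derivL_wedgeTwo`, `½ D_B` reproduces the derivative of each factor `Ω`, and it obeys
the same product rule with multiplication by `Ω`. -/
theorem pd_volForm (hΩ : ContDiffAt ℝ ∞ Ω y) (hN : Nondeg (Ω y)) (v : Vec (2 * m)) :
    pd (fun z => volForm m (Ω z)) y v =
      (2 : ℝ)⁻¹ • derivL (varEnd (Ω y) (fderiv ℝ Ω y v)) (volForm m (Ω y)) := by
  have key : ∀ r : ℕ, SmoothAt (fun z => (wedgeTwo (Ω z))^[r] oneForm) y ∧
      pd (fun z => (wedgeTwo (Ω z))^[r] oneForm) y v =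
        (2 : ℝ)⁻¹ • derivL (varEnd (Ω y) (fderiv ℝ Ω y v)) ((wedgeTwo (Ω y))^[r] oneForm) := by
    intro r
    induction r with
    | zero =>
      refine ⟨SmoothAt.const _ _, ?_⟩
      simp [pd_const, derivL_apply, ι_zero_of_homog homog_oneForm]
    | succ r ih =>
      simp only [Function.iterate_succ_apply']
      refine ⟨ih.1.wedgeTwo hΩ, ?_⟩
      rw [pd_wedgeTwo hΩ ih.1, ih.2, hN.derivL_wedgeTwo, map_smul]
      module
  simp only [volForm]
  rw [pd_const_smul (key m).1, LinearMap.smul_apply, (key m).2, map_smul, smul_comm]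

/-- The variation of the star operator. -/
theorem pd_starL {k : ℕ} (hΩ : ContDiffAt ℝ ∞ Ω y) (hN : ∀ᶠ z in nhds y, Nondeg (Ω z))
    (hA : SmoothAt A y) (hk : ∀ z, Homog k (A z)) (v : Vec (2 * m)) :
    pd (fun z => starL m (Ω z) (A z)) y v = starL m (Ω y) (pd A y v) +
      (derivL (varEnd (Ω y) (fderiv ℝ Ω y v)) (starL m (Ω y) (A y)) -
        ((2 : ℝ)⁻¹ * traceL (varEnd (Ω y) (fderiv ℝ Ω y v))) • starL m (Ω y) (A y)) := by
  have hy := hN.self_of_nhds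
  induction k generalizing A with
  | zero =>
    -- For a function, `⋆f = f Ω^m/m!`. Only the volume form varies; in top degree `D_B` is
    -- multiplication by `tr B`, so `½ D_B = D_B - ½ tr B` there.
    set f : Vec (2 * m) → ℝ := fun z => A z 0 (fun i => i.elim0) with hf
    have hfs : ContDiffAt ℝ ∞ f y := (ContinuousAlternatingMap.apply ℝ (Vec (2 * m)) ℝ
      (fun i : Fin 0 => i.elim0)).contDiff.contDiffAt.comp y (hA 0)
    have hAf : A = fun z => f z • oneForm := by
      funext z n
      cases n with
      | zero =>
        ext w
        simp [oneForm, hf]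
        congr 1
        funext i
        exact i.elim0
      | succ n => simp [oneForm, hk z (n + 1) n.succ_ne_zero]
    have hd := hfs.differentiableAt (by simp)
    have hV := SmoothAt.volForm m hΩ
    rw [hAf]
    simp only [map_smul, starL_one]
    rw [pd_smul hd hV, pd_smul hd (SmoothAt.const _ _), pd_const, pd_volForm hΩ hy, map_add, map_smul,
      starL_one, derivL_top (homog_volForm m (Ω y))]
    simp only [LinearMap.zero_apply, smul_zero, map_zero]
    module
  | succ k ih =>
    have hι : ∀ i, SmoothAt (fun z => ι (stdVec i) (A z)) y := fun i => hA.ι contDiffAt_const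
    have hει : ∀ i, SmoothAt (fun z => ε (stdCov i) (ι (stdVec i) (A z))) y :=
      fun i => (hι i).ε contDiffAt_const
    have hk' : ∀ i z, Homog k (ι (stdVec i) (A z)) := fun i z => (hk z).ι _
    -- Euler's identity reduces to products `eⁱ ∧ C` with `C` of lower degree and the covector
    -- constant.
    have hAd : A = fun z => ((k + 1 : ℕ) : ℝ)⁻¹ • ∑ i, ε (stdCov i) (ι (stdVec i) (A z)) := by
      funext z
      rw [sum_ε_ι, (hk z).degL_eq, smul_smul, inv_mul_cancel₀ (by positivity), one_smul]
    have hterm : ∀ i, pd (fun z => starL m (Ω z) (ε (stdCov i) (ι (stdVec i) (A z)))) y v =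
        starL m (Ω y) (pd (fun z => ε (stdCov i) (ι (stdVec i) (A z))) y v) +
        (derivL (varEnd (Ω y) (fderiv ℝ Ω y v)) (starL m (Ω y) (ε (stdCov i) (ι (stdVec i) (A y)))) -
          ((2 : ℝ)⁻¹ * traceL (varEnd (Ω y) (fderiv ℝ Ω y v))) •
            starL m (Ω y) (ε (stdCov i) (ι (stdVec i) (A y)))) := by
      intro i
      set C : Vec (2 * m) → Alt (2 * m) := fun z => ι (stdVec i) (A z) with hC
      have h1 : (fun z => starL m (Ω z) (ε (stdCov i) (C z))) =ᶠ[nhds y]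
          fun z => (-1 : ℝ) ^ k • ι (flatInv (Ω z) (stdCov i)) (starL m (Ω z) (C z)) := by
        filter_upwards [hN] with z hz
        rw [hz.starL_ε, (hk' i z).sgn_eq, map_smul, map_smul]
      have h2 : ContDiffAt ℝ ∞ (fun z => flatInv (Ω z) (stdCov i)) y :=
        contDiffAt_flatInv hΩ contDiffAt_const hy
      have h3 := (hι i).starL hΩ hy
      -- Differentiating `♭(♭⁻¹eⁱ) = eⁱ` gives `-B(♭⁻¹eⁱ)`; this is exactly the commutator of `D_B`
      -- with contraction by `♭⁻¹eⁱ`, so the variation formula passes through the contraction.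
      have h4 : fderiv ℝ (fun z => flatInv (Ω z) (stdCov i)) y v =
          -varEnd (Ω y) (fderiv ℝ Ω y v) (flatInv (Ω y) (stdCov i)) := by
        have := fderiv_flatInv hΩ contDiffAt_const (a := fun _ => stdCov i) hN v
        rw [fderiv_fun_const, Pi.zero_apply, _root_.zero_apply,
          add_comm, add_eq_zero_iff_eq_neg] at this
        rw [← hy.flatInv_flat (fderiv ℝ _ y v), this, map_neg, varEnd_apply]
      have h5 : sgn (pd C y v) = (-1 : ℝ) ^ k • pd C y v := by
        refine Homog.sgn_eq fun n hn => ?_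
        rw [pd_apply]
        have : (fun z => C z n) = fun _ => 0 := funext fun z => hk' i z n hn
        rw [this]
        simp
      rw [pd_congr h1, pd_const_smul (h3.ι h2), LinearMap.smul_apply, pd_ι h2 h3, h4,
        ih (hι i) (hk' i), pd_const_ε _ (hι i), hy.starL_ε, hy.starL_ε, h5, (hk' i y).sgn_eq]
      simp only [map_smul, map_add, map_sub, map_neg, ι_derivL, LinearMap.neg_apply]
      module
    rw [hAd]
    simp only [map_smul, map_sum]
    have hs : ∀ i, SmoothAt (fun z => starL m (Ω z) (ε (stdCov i) (ι (stdVec i) (A z)))) y :=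
      fun i => (hει i).starL hΩ hy
    rw [pd_const_smul (SmoothAt.sum hs), pd_sum hs, pd_const_smul (SmoothAt.sum hει), pd_sum hει]
    simp only [LinearMap.smul_apply, LinearMap.sum_apply, map_smul, map_sum, hterm,
      Finset.sum_add_distrib, Finset.sum_sub_distrib, ← Finset.smul_sum]
    module

end Star

end

section

/-! ### The exterior derivative in coordinates. -/

section ExteriorDerivative

variable {d : ℕ}

/-- The exterior derivative of a field of forms on `ℝᵈ`. -/
def dLoc (A : Vec d → Alt d) (y : Vec d) : Alt d := ∑ i, ε (stdCov i) (pd A y (stdVec i))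

/-- Expanding each vector in the standard basis rewrites the alternated derivative as `∑ eⁱ ∧ ∂ᵢ`,
the form in which the exchange rules for `⋆` apply. -/
theorem extDeriv_eq_dLoc (A : Vec d → Alt d) (y : Vec d) (n : ℕ) :
    extDeriv (fun z => A z n) y = dLoc A y (n + 1) := by
  ext v
  simp only [dLoc, Finset.sum_apply, ContinuousAlternatingMap.sum_apply, ε_succ_apply,
    wedgeCov_apply]
  rw [Finset.sum_comm, extDeriv, ContinuousAlternatingMap.alternatizeUncurryFin_apply]
  refine Finset.sum_congr rfl fun j _ => ?_
  conv_lhs => rw [← sum_pairing_smul_stdVec (v j)]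
  rw [map_sum, ContinuousAlternatingMap.sum_apply, Finset.smul_sum]
  refine Finset.sum_congr rfl fun i _ => ?_
  simp [pd_apply]

theorem dLoc_apply_zero (A : Vec d → Alt d) (y : Vec d) : dLoc A y 0 = 0 := by
  simp [dLoc, Finset.sum_apply, ε_zero_apply]

theorem dLoc_congr {A B : Vec d → Alt d} {y : Vec d} (h : A =ᶠ[nhds y] B) : dLoc A y = dLoc B y := by
  simp only [dLoc, pd_congr h]

theorem Homog.pd {k : ℕ} {A : Vec d → Alt d} (h : ∀ z, Homog k (A z)) (y v : Vec d) :
    Homog k (pd A y v) := by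
  intro n hn
  rw [pd_apply]
  have : (fun z => A z n) = fun _ => 0 := funext fun z => h z n hn
  rw [this]
  simp

/-- Cartan's formula in coordinates. -/
theorem dLoc_ι_add_ι_dLoc {A : Vec d → Alt d} {X : Vec d → Vec d} {y : Vec d}
    (hX : ContDiffAt ℝ ∞ X y) (hA : SmoothAt A y) :
    dLoc (fun z => ι (X z) (A z)) y + ι (X y) (dLoc A y) =
      pd A y (X y) + derivL (fderiv ℝ X y).toLinearMap (A y) := by
  have h : ∑ i, pairing (stdCov i) (X y) • pd A y (stdVec i) = pd A y (X y) := by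
    conv_rhs => rw [← sum_pairing_smul_stdVec (X y)]
    simp only [map_sum, map_smul]
  rw [← h, derivL_apply, dLoc, dLoc, map_sum, ← Finset.sum_add_distrib, ← Finset.sum_add_distrib]
  refine Finset.sum_congr rfl fun i _ => ?_
  rw [pd_ι hX hA, map_add, ι_ε]
  change _ = _ + ε _ (ι (fderiv ℝ X y (stdVec i)) _)
  abel

end ExteriorDerivative

/-! ### The star operator against `d`, `i(Λ)` and `L_E`, in coordinates. -/

section StarDerivative

variable {m : ℕ} {A : Vec (2 * m) → Alt (2 * m)}
  {Ω : Vec (2 * m) → (Vec (2 * m)) [⋀^Fin 2]→L[ℝ] ℝ} {θ : Vec (2 * m) → Cov (2 * m)}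
  {y : Vec (2 * m)}

theorem degL_starL {j : ℕ} {α : Alt (2 * m)} (h : Homog j α)
    (Ω : (Vec (2 * m)) [⋀^Fin 2]→L[ℝ] ℝ) :
    degL (starL m Ω α) = (2 * (m : ℝ) - j) • starL m Ω α := by
  by_cases hj : j ≤ 2 * m
  · rw [(h.starL (l := 2 * m - j) (by omega) Ω).degL_eq, Nat.cast_sub hj]
    push_cast
    rfl
  · have : α = 0 := by
      funext n
      by_cases hn : n = j
      · exact form_eq_zero_of_lt (by omega) _
      · exact h n hn
    simp [this]

/-- The derivative of contraction by the bivector, after applying the star operator. -/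
theorem starL_pd_contrTwo {j : ℕ} (hΩ : ContDiffAt ℝ ∞ Ω y) (hN : ∀ᶠ z in nhds y, Nondeg (Ω z))
    (hA : SmoothAt A y) (hj : ∀ z, Homog j (A z)) (v : Vec (2 * m)) :
    starL m (Ω y) (pd (fun z => contrTwo (Ω z) (A z)) y v) =
      wedgeTwo (Ω y) (starL m (Ω y) (pd A y v)) -
        wedgeTwo (fderiv ℝ Ω y v) (starL m (Ω y) (A y)) := by
  have hy := hN.self_of_nhds
  -- The variation formula needs one degree valid at all points. In degrees zero and one the
  -- contraction vanishes, so any degree serves.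
  have hc : ∃ k, ∀ z, Homog k (contrTwo (Ω z) (A z)) := by
    rcases j with _ | _ | j
    · exact ⟨0, fun z => by rw [contrTwo_of_homog_zero (hj z)]; exact fun _ _ => rfl⟩
    · exact ⟨0, fun z => by rw [contrTwo_of_homog_one (hj z)]; exact fun _ _ => rfl⟩
    · exact ⟨j, fun z => (hj z).contrTwo _⟩
  obtain ⟨k, hk⟩ := hc
  have h1 := pd_starL hΩ hN (hA.contrTwo hΩ hy) hk v
  have h2 := pd_starL hΩ hN hA hj v
  -- The relation `⋆ i(Λ) = Ω ∧ ⋆` is differentiated. The product rule contributes `+∂Ω ∧ ⋆A`, and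
  -- `D_B(Ω ∧ ·)` contributes `2 ∂Ω ∧ ⋆A` on the other side; the difference is the coefficient `-1`.
  have h3 : pd (fun z => starL m (Ω z) (contrTwo (Ω z) (A z))) y =
      pd (fun z => wedgeTwo (Ω z) (starL m (Ω z) (A z))) y := by
    refine pd_congr ?_
    filter_upwards [hN] with z hz
    exact hz.starL_contrTwo (A z)
  rw [h3, pd_wedgeTwo hΩ (hA.starL hΩ hy), h2, hy.starL_contrTwo, hy.derivL_wedgeTwo] at h1
  simp only [map_add, map_sub, map_smul] at h1
  rw [← sub_eq_zero] at h1 ⊢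
  rw [← neg_eq_zero, ← h1]
  module

/-- The star operator carries the commutator of the exterior derivative with contraction by the
bivector into a twisted exterior derivative. -/
theorem starL_commutator {j : ℕ} (hΩ : ContDiffAt ℝ ∞ Ω y) (hN : ∀ᶠ z in nhds y, Nondeg (Ω z))
    (hA : SmoothAt A y) (hj : ∀ z, Homog j (A z)) {a : Cov (2 * m)}
    (hL : LeeIdentity (Ω y) (fderiv ℝ Ω y).toLinearMap a) :
    starL m (Ω y) (contrTwo (Ω y) (dLoc A y) - dLoc (fun z => contrTwo (Ω z) (A z)) y +
        (j : ℝ) • ι (flatInv (Ω y) a) (A y)) =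
      (-1 : ℝ) ^ (j + 1) • (dLoc (fun z => starL m (Ω z) (A z)) y -
        ((m : ℝ) + 1) • ε a (starL m (Ω y) (A y)) -
          wedgeTwo (Ω y) (ι (flatInv (Ω y) a) (starL m (Ω y) (A y)))) := by
  have hy := hN.self_of_nhds
  set Φ := starL m (Ω y) (A y) with hΦ
  have h1 : starL m (Ω y) (contrTwo (Ω y) (dLoc A y)) = (-1 : ℝ) ^ j • ∑ i,
      wedgeTwo (Ω y) (ι (flatInv (Ω y) (stdCov i)) (starL m (Ω y) (pd A y (stdVec i)))) := by
    rw [hy.starL_contrTwo, dLoc, map_sum, map_sum, Finset.smul_sum]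
    refine Finset.sum_congr rfl fun i _ => ?_
    rw [hy.starL_ε, (Homog.pd hj y _).sgn_eq, map_smul, map_smul, map_smul]
  have hsgn : ∀ v, sgn (pd (fun z => contrTwo (Ω z) (A z)) y v) =
      (-1 : ℝ) ^ j • pd (fun z => contrTwo (Ω z) (A z)) y v := by
    intro v
    rcases j with _ | _ | j
    · have : (fun z => contrTwo (Ω z) (A z)) = fun _ => 0 :=
        funext fun z => contrTwo_of_homog_zero (hj z) _
      simp [this, pd_const]
    · have : (fun z => contrTwo (Ω z) (A z)) = fun _ => 0 :=
        funext fun z => contrTwo_of_homog_one (hj z) _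
      simp [this, pd_const]
    · rw [(Homog.pd (fun z => (hj z).contrTwo (Ω z)) y v).sgn_eq]
      simp [pow_succ]
  have h2 : starL m (Ω y) (dLoc (fun z => contrTwo (Ω z) (A z)) y) = (-1 : ℝ) ^ j • ∑ i,
      ι (flatInv (Ω y) (stdCov i)) (wedgeTwo (Ω y) (starL m (Ω y) (pd A y (stdVec i))) -
        wedgeTwo (fderiv ℝ Ω y (stdVec i)) Φ) := by
    rw [dLoc, map_sum, Finset.smul_sum]
    refine Finset.sum_congr rfl fun i _ => ?_
    rw [hy.starL_ε, hsgn, map_smul, map_smul, starL_pd_contrTwo hΩ hN hA hj]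
  have h3 : starL m (Ω y) (ι (flatInv (Ω y) a) (A y)) = (-1 : ℝ) ^ j • ε a Φ := by
    rw [hy.starL_ι, (hj y).sgn_eq, map_smul, map_smul, hy.flat_flatInv]
  have h4 : dLoc (fun z => starL m (Ω z) (A z)) y =
      ∑ i, ε (stdCov i) (starL m (Ω y) (pd A y (stdVec i))) +
      ∑ i, ε (stdCov i) (derivL (varEnd (Ω y) (fderiv ℝ Ω y (stdVec i))) Φ -
        ((2 : ℝ)⁻¹ * traceL (varEnd (Ω y) (fderiv ℝ Ω y (stdVec i)))) • Φ) := by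
    rw [dLoc, ← Finset.sum_add_distrib]
    refine Finset.sum_congr rfl fun i _ => ?_
    rw [pd_starL hΩ hN hA hj, map_add]
  -- Since `Φ` has degree `2m - j`, the coefficient of `a ∧ Φ` is `(2m - j) + (1 - m) = m + 1 - j`.
  -- The term `j i_E` removes the `-j`, leaving the constant `m + 1`.
  have h5 := hL.sum_variation hy Φ
  rw [degL_starL (hj y), map_smul] at h5
  simp only [ContinuousLinearMap.coe_coe] at h5
  -- Moving the contraction past `Ω ∧` leaves `eⁱ ∧ ⋆∂ᵢA`: the second-type terms cancel and these
  -- assemble the main part of `d⋆A`.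
  have h6 : ∀ i, ι (flatInv (Ω y) (stdCov i)) (wedgeTwo (Ω y) (starL m (Ω y) (pd A y (stdVec i)))) =
      ε (stdCov i) (starL m (Ω y) (pd A y (stdVec i))) +
        wedgeTwo (Ω y) (ι (flatInv (Ω y) (stdCov i)) (starL m (Ω y) (pd A y (stdVec i)))) := by
    intro i
    rw [ι_wedgeTwo, hy.flat_flatInv]
  rw [map_add, map_sub, map_smul, h1, h2, h3, h4, eq_sub_of_add_eq h5]
  simp only [map_sub, h6, Finset.sum_sub_distrib, Finset.sum_add_distrib, pow_succ]
  push_cast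
  module

/-- The star operator commutes with the Lie derivative along `E = ♭⁻¹(θ)`. -/
theorem starL_lie {j : ℕ} (hΩ : ContDiffAt ℝ ∞ Ω y) (hN : ∀ᶠ z in nhds y, Nondeg (Ω z))
    (hθ : ContDiffAt ℝ ∞ θ y) (hA : SmoothAt A y) (hj : ∀ z, Homog j (A z))
    (hL : LeeIdentity (Ω y) (fderiv ℝ Ω y).toLinearMap (θ y))
    (hc : ∀ X Y, pairing (fderiv ℝ θ y X) Y = pairing (fderiv ℝ θ y Y) X) :
    starL m (Ω y) (dLoc (fun z => ι (flatInv (Ω z) (θ z)) (A z)) y +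
        ι (flatInv (Ω y) (θ y)) (dLoc A y)) =
      dLoc (fun z => ι (flatInv (Ω z) (θ z)) (starL m (Ω z) (A z))) y +
        ι (flatInv (Ω y) (θ y)) (dLoc (fun z => starL m (Ω z) (A z)) y) := by
  have hy := hN.self_of_nhds
  have hE := contDiffAt_flatInv hΩ hθ hy
  -- By Cartan's formula `L_E = ∂_E + D_N` with `N` the derivative of `E`. The defect of `⋆` against
  -- `∂_E` is the opposite of its defect against `D_N`.
  rw [dLoc_ι_add_ι_dLoc hE hA, dLoc_ι_add_ι_dLoc hE (hA.starL hΩ hy), map_add,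
    hL.starL_derivL hy (fderiv_flatInv hΩ hθ hN) hc, pd_starL hΩ hN hA hj]
  simp only [ContinuousLinearMap.coe_coe]
  abel

end StarDerivative

end

section

/-! ### The structure equations in coordinates. -/

section LocalIdentities

variable {d : ℕ}

theorem leeIdentity_of_extDeriv {Ω : Vec d → (Vec d) [⋀^Fin 2]→L[ℝ] ℝ} {θ : Cov d} {y : Vec d}
    (h : extDeriv Ω y = wedgeCov 2 θ (Ω y)) :
    LeeIdentity (Ω y) (fderiv ℝ Ω y).toLinearMap θ := by
  intro X Y Z
  have h1 := congrArg (fun α => α ![X, Y, Z]) h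
  have e0 : (0 : Fin 3).removeNth ![X, Y, Z] = ![Y, Z] := by
    funext i; fin_cases i <;> rfl
  have e1 : (1 : Fin 3).removeNth ![X, Y, Z] = ![X, Z] := by
    funext i; fin_cases i <;> rfl
  have e2 : (2 : Fin 3).removeNth ![X, Y, Z] = ![X, Y] := by
    funext i; fin_cases i <;> rfl
  have h2 : ∑ i : Fin 3, (-1 : ℤ) ^ (i : ℕ) • fderiv ℝ Ω y (![X, Y, Z] i) (i.removeNth ![X, Y, Z]) =
      ∑ i : Fin 3, (-1 : ℝ) ^ (i : ℕ) *
        (pairing θ (![X, Y, Z] i) * Ω y (i.removeNth ![X, Y, Z])) :=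
    (ContinuousAlternatingMap.alternatizeUncurryFin_apply _ _).symm.trans
      (h1.trans (wedgeCov_apply 2 θ (Ω y) _))
  simp only [Fin.sum_univ_three, e0, e1, e2, ← pairing_flat] at h2
  simp only [Fin.val_zero, Fin.val_one, Fin.val_two, pow_zero, pow_one, one_smul, neg_smul,
    one_mul, neg_mul, even_two, Even.neg_pow, one_pow, Matrix.cons_val_zero, Matrix.cons_val_one,
    Matrix.cons_val] at h2
  simp only [ContinuousLinearMap.coe_coe]
  linarith

/-- A closed one-form has symmetric first derivatives. -/
theorem fderiv_symm_of_extDeriv {θ : Vec d → Cov d} {y : Vec d} (h : extDeriv θ y = 0)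
    (X Y : Vec d) : pairing (fderiv ℝ θ y X) Y = pairing (fderiv ℝ θ y Y) X := by
  have h1 := congrArg (fun α => α ![X, Y]) h
  have h2 : ∑ i : Fin 2, (-1 : ℤ) ^ (i : ℕ) •
      pairing (fderiv ℝ θ y (![X, Y] i)) ((i.removeNth ![X, Y] : Fin 1 → Vec d) 0) = 0 := by
    simp only [← Cov.apply_eq_pairing]
    exact (ContinuousAlternatingMap.alternatizeUncurryFin_apply _ _).symm.trans h1
  have e0 : ((0 : Fin 2).removeNth ![X, Y] : Fin 1 → Vec d) 0 = Y := rfl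
  have e1 : ((1 : Fin 2).removeNth ![X, Y] : Fin 1 → Vec d) 0 = X := rfl
  rw [Fin.sum_univ_two, e0, e1] at h2
  simp at h2
  linarith

theorem SmoothAt.dLoc {A : Vec d → Alt d} {y : Vec d} (hA : SmoothAt A y) : SmoothAt (dLoc A) y := by
  refine SmoothAt.sum fun i => SmoothAt.ε contDiffAt_const fun n => ?_
  exact ((hA n).fderiv_right (m := ∞) (by simp)).clm_apply contDiffAt_const

end LocalIdentities

/-! ### Pull-back by a linear isomorphism -/

section Pull

variable {d : ℕ}

/-- Pull-back by a linear isomorphism, as a linear map. -/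
def pullL (T : Vec d ≃L[ℝ] Vec d) : Alt d →ₗ[ℝ] Alt d where
  toFun := pull T
  map_add' _ _ := rfl
  map_smul' _ _ := rfl

theorem pullL_apply (T : Vec d ≃L[ℝ] Vec d) (α : Alt d) (n : ℕ) :
    pullL T α n = (α n).compContinuousLinearMap (T : Vec d →L[ℝ] Vec d) := rfl

theorem pullL_wedge (T : Vec d ≃L[ℝ] Vec d) (α β : Alt d) :
    pullL T (wedge α β) = wedge (pullL T α) (pullL T β) := by
  funext n
  ext v
  rw [pullL_apply]
  simp only [wedge, wedgeHom, ContinuousAlternatingMap.compContinuousLinearMap_apply,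
    ContinuousAlternatingMap.sum_apply, ContinuousAlternatingMap.smul_apply,
    ContinuousMultilinearMap.alternatization_apply_apply]
  rfl

theorem pullL_ε (T : Vec d ≃L[ℝ] Vec d) (a : Cov d) (α : Alt d) :
    pullL T (ε a α) = ε (a.compContinuousLinearMap (T : Vec d →L[ℝ] Vec d)) (pullL T α) := by
  funext n
  ext v
  cases n with
  | zero => simp [pullL_apply, ε_zero_apply]
  | succ n =>
    rw [pullL_apply, ContinuousAlternatingMap.compContinuousLinearMap_apply, ε_succ_apply,
      ε_succ_apply, wedgeCov_apply, wedgeCov_apply]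
    rfl

theorem pullL_ι (T : Vec d ≃L[ℝ] Vec d) (X : Vec d) (α : Alt d) :
    pullL T (ι X α) = ι (T.symm X) (pullL T α) :=
  pull_interior T X α

theorem Homog.pullL {k : ℕ} {α : Alt d} (h : Homog k α) (T : Vec d ≃L[ℝ] Vec d) :
    Homog k (pullL T α) := by
  intro n hn
  rw [pullL_apply, h n hn]
  rfl

theorem pullL_oneForm (T : Vec d ≃L[ℝ] Vec d) : pullL T oneForm = oneForm := by
  funext n
  cases n with
  | zero =>
    ext v
    simp [pullL_apply, oneForm]
  | succ n =>
    rw [(homog_oneForm.pullL T) _ n.succ_ne_zero, homog_oneForm _ n.succ_ne_zero]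

/-- Regarding `ζ` as an inhomogeneous form reduces this to naturality of the full wedge product,
which avoids transforming the basis in `wedgeTwo`. -/
theorem pullL_wedgeTwo (T : Vec d ≃L[ℝ] Vec d) (ζ : (Vec d) [⋀^Fin 2]→L[ℝ] ℝ) (α : Alt d) :
    pullL T (wedgeTwo ζ α) =
      wedgeTwo (ζ.compContinuousLinearMap (T : Vec d →L[ℝ] Vec d)) (pullL T α) := by
  have h := homog_single ζ
  have h1 := wedge_two h α
  have h2 := wedge_two (h.pullL T) (pullL T α)
  rw [← pullL_wedge, h1, pullL_apply] at h2
  simpa using h2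

theorem pullL_volForm (T : Vec d ≃L[ℝ] Vec d) (m : ℕ) (ζ : (Vec d) [⋀^Fin 2]→L[ℝ] ℝ) :
    pullL T (volForm m ζ) =
      volForm m (ζ.compContinuousLinearMap (T : Vec d →L[ℝ] Vec d)) := by
  rw [volForm, volForm, map_smul]
  congr 1
  induction m with
  | zero => exact pullL_oneForm T
  | succ r ih => rw [Function.iterate_succ_apply', Function.iterate_succ_apply', pullL_wedgeTwo, ih]

/-- The volume form and the exchange rule with covectors are natural, and they determine `⋆`. -/
theorem pullL_starL {m : ℕ} (T : Vec (2 * m) ≃L[ℝ] Vec (2 * m))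
    {Ω : (Vec (2 * m)) [⋀^Fin 2]→L[ℝ] ℝ} (h : Nondeg Ω) (α : Alt (2 * m)) :
    pullL T (starL m Ω α) =
      starL m (Ω.compContinuousLinearMap (T : Vec (2 * m) →L[ℝ] Vec (2 * m))) (pullL T α) := by
  induction α using form_induction with
  | one => rw [pullL_oneForm, starL_one, starL_one, pullL_volForm]
  | zero => simp
  | add α β hα hβ => simp [hα, hβ]
  | smul c α hα => simp [hα]
  | mul k a γ hγ ih =>
    rw [pullL_ε, h.starL_ε, (h.pull T).starL_ε, pullL_ι, flatInv_pull h, hγ.sgn_eq,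
      (hγ.pullL T).sgn_eq, map_smul, map_smul, map_smul, map_smul, map_smul, ih]

end Pull

end

section

/-! ## Forms on a manifold in charts -/

section Charts

variable {d : ℕ} {M : Type*} [TopologicalSpace M] [ChartedSpace (Vec d) M]

/-- A field of forms on a manifold, read in the chart at `x₀`. -/
def chartF (x₀ : M) (α : M → Alt d) (y : Vec d) : Alt d := fun n => chartRep x₀ α n y

theorem chartF_apply (x₀ : M) (α : M → Alt d) (y : Vec d) (n : ℕ) :
    chartF x₀ α y n = chartRep x₀ α n y := rfl

theorem isSmooth_iff_smoothAt {α : M → Alt d} :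
    IsSmooth α ↔ ∀ x₀, ∀ y ∈ (extChartAt (𝓡 d) x₀).target, SmoothAt (chartF x₀ α) y := by
  constructor
  · intro h x₀ y hy n
    exact (h x₀ n).contDiffAt ((isOpen_extChartAt_target x₀).mem_nhds hy)
  · intro h x₀ n y hy
    exact (h x₀ y hy n).contDiffWithinAt

theorem eventually_mem_target (x₀ : M) {y : Vec d} (hy : y ∈ (extChartAt (𝓡 d) x₀).target) :
    ∀ᶠ z in nhds y, z ∈ (extChartAt (𝓡 d) x₀).target :=
  (isOpen_extChartAt_target x₀).mem_nhds hy

variable [IsManifold (𝓡 d) ∞ M]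

/-- One isomorphism serves all fields at the given point, so an algebraic identity between several
fields transfers at once. -/
theorem exists_chartF_eq_pullL (x₀ : M) {y : Vec d} (hy : y ∈ (extChartAt (𝓡 d) x₀).target) :
    ∃ T : Vec d ≃L[ℝ] Vec d, ∀ α : M → Alt d,
      chartF x₀ α y = pullL T (α ((extChartAt (𝓡 d) x₀).symm y)) := by
  obtain ⟨T, hT⟩ := exists_equiv_mfderiv x₀ hy
  refine ⟨T, fun α => ?_⟩
  funext n
  rw [chartF_apply, chartRep, ← hT]
  rfl

theorem pullL_injective (T : Vec d ≃L[ℝ] Vec d) : Function.Injective (pullL T) := by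
  intro α β h
  funext n
  ext v
  have := congrArg (fun γ : Alt d => γ n fun i => T.symm (v i)) h
  simpa [pullL_apply, Function.comp_def] using this

/-- Two fields of forms agree if they agree in all charts. -/
theorem eq_of_chartF_eq {α β : M → Alt d}
    (h : ∀ x₀, ∀ y ∈ (extChartAt (𝓡 d) x₀).target, chartF x₀ α y = chartF x₀ β y) : α = β := by
  funext x
  obtain ⟨T, hT⟩ := exists_chartF_eq_pullL x (mem_extChartAt_target (I := 𝓡 d) x)
  have := h x _ (mem_extChartAt_target x)
  rw [hT, hT, extChartAt_to_inv] at this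
  exact pullL_injective T this

/-- The transition map between two charts. -/
theorem hasFDerivAt_chart_change (x₀ x : M) {z : Vec d} (hz : z ∈ (extChartAt (𝓡 d) x₀).target)
    (hx : (extChartAt (𝓡 d) x₀).symm z ∈ (extChartAt (𝓡 d) x).source) :
    ContDiffAt ℝ ∞ (extChartAt (𝓡 d) x ∘ (extChartAt (𝓡 d) x₀).symm) z ∧
      fderiv ℝ (extChartAt (𝓡 d) x ∘ (extChartAt (𝓡 d) x₀).symm) z =
        (mfderiv (𝓡 d) 𝓘(ℝ, Vec d) (extChartAt (𝓡 d) x) ((extChartAt (𝓡 d) x₀).symm z) :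
            Vec d →L[ℝ] Vec d).comp
          (mfderiv 𝓘(ℝ, Vec d) (𝓡 d) (extChartAt (𝓡 d) x₀).symm z : Vec d →L[ℝ] Vec d) := by
  have h1 : ContMDiffAt 𝓘(ℝ, Vec d) (𝓡 d) ∞ (extChartAt (𝓡 d) x₀).symm z :=
    (contMDiffOn_extChartAt_symm x₀).contMDiffAt ((isOpen_extChartAt_target x₀).mem_nhds hz)
  have h2 : ContMDiffAt (𝓡 d) 𝓘(ℝ, Vec d) ∞ (extChartAt (𝓡 d) x)
      ((extChartAt (𝓡 d) x₀).symm z) :=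
    contMDiffAt_extChartAt' (by rwa [extChartAt_source] at hx)
  refine ⟨(h2.comp z h1).contDiffAt, ?_⟩
  rw [← mfderiv_eq_fderiv]
  exact mfderiv_comp z (h2.mdifferentiableAt (by simp)) (h1.mdifferentiableAt (by simp))

/-- The chain rule for `extChartAt` through `x`: the differentials of that chart and of its inverse
cancel. -/
theorem chartRep_eq_pullback (x₀ x : M) (α : M → Alt d) (n : ℕ) {z : Vec d}
    (hz : z ∈ (extChartAt (𝓡 d) x₀).target)
    (hx : (extChartAt (𝓡 d) x₀).symm z ∈ (extChartAt (𝓡 d) x).source) :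
    chartRep x₀ α n z =
      (chartRep x α n ((extChartAt (𝓡 d) x ∘ (extChartAt (𝓡 d) x₀).symm) z)).compContinuousLinearMap
        (fderiv ℝ (extChartAt (𝓡 d) x ∘ (extChartAt (𝓡 d) x₀).symm) z) := by
  have : IsManifold (𝓡 d) 1 M := IsManifold.of_le (n := ∞) (by simp)
  rw [(hasFDerivAt_chart_change x₀ x hz hx).2]
  have h1 := mfderivWithin_extChartAt_symm_comp_mfderiv_extChartAt' (I := 𝓡 d) hx
  rw [ModelWithCorners.range_eq_univ, mfderivWithin_univ] at h1
  have h2 : (extChartAt (𝓡 d) x).symm ((extChartAt (𝓡 d) x ∘ (extChartAt (𝓡 d) x₀).symm) z) =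
      (extChartAt (𝓡 d) x₀).symm z := (extChartAt (𝓡 d) x).left_inv hx
  have h3 : α ((extChartAt (𝓡 d) x).symm
      ((extChartAt (𝓡 d) x ∘ (extChartAt (𝓡 d) x₀).symm) z)) n =
        α ((extChartAt (𝓡 d) x₀).symm z) n := by rw [h2]
  have h4 : ∀ w : Vec d, (mfderiv 𝓘(ℝ, Vec d) (𝓡 d) (extChartAt (𝓡 d) x).symm
      ((extChartAt (𝓡 d) x ∘ (extChartAt (𝓡 d) x₀).symm) z) : Vec d →L[ℝ] Vec d)
        ((mfderiv (𝓡 d) 𝓘(ℝ, Vec d) (extChartAt (𝓡 d) x) ((extChartAt (𝓡 d) x₀).symm z) :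
          Vec d →L[ℝ] Vec d) w) = w := fun w => DFunLike.congr_fun h1 w
  ext v
  change _ = α ((extChartAt (𝓡 d) x).symm
      ((extChartAt (𝓡 d) x ∘ (extChartAt (𝓡 d) x₀).symm) z)) n _
  rw [h3]
  change α ((extChartAt (𝓡 d) x₀).symm z) n _ = _
  congr 1
  funext i
  exact (h4 _).symm

/-- `extD` uses at each point the chart centred there, so reading it in a fixed chart requires
comparing the two charts; this is the naturality of `extDeriv` under the transition map. -/
theorem chartRep_extD {α : M → Alt d} (hα : IsSmooth α) (x₀ : M) (n : ℕ) {y : Vec d}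
    (hy : y ∈ (extChartAt (𝓡 d) x₀).target) :
    chartRep x₀ (extD α) (n + 1) y = extDeriv (chartRep x₀ α n) y := by
  set x := (extChartAt (𝓡 d) x₀).symm y with hx
  set τ := extChartAt (𝓡 d) x ∘ (extChartAt (𝓡 d) x₀).symm with hτ
  have hxs : (extChartAt (𝓡 d) x₀).symm y ∈ (extChartAt (𝓡 d) x).source :=
    mem_extChartAt_source x
  obtain ⟨h1, h2⟩ := hasFDerivAt_chart_change x₀ x hy hxs
  have h3 : chartRep x₀ α n =ᶠ[nhds y] fun z =>
      (chartRep x α n (τ z)).compContinuousLinearMap (fderiv ℝ τ z) := by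
    have hc : ContinuousAt (extChartAt (𝓡 d) x₀).symm y := continuousAt_extChartAt_symm'' hy
    filter_upwards [(isOpen_extChartAt_target x₀).mem_nhds hy,
      hc.preimage_mem_nhds ((isOpen_extChartAt_source x).mem_nhds hxs)] with z hz hz'
    exact chartRep_eq_pullback x₀ x α n hz hz'
  have h4 : DifferentiableAt ℝ (chartRep x α n) (τ y) := hα.differentiableAt x n
  rw [h3.extDeriv_eq, extDeriv_pullback h4 h1 (by simp [ENat.LEInfty.out]), h2]
  rfl

theorem chartF_extD {α : M → Alt d} (hα : IsSmooth α) (x₀ : M) {y : Vec d}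
    (hy : y ∈ (extChartAt (𝓡 d) x₀).target) : chartF x₀ (extD α) y = dLoc (chartF x₀ α) y := by
  funext n
  cases n with
  | zero =>
    rw [dLoc_apply_zero]
    rfl
  | succ n => exact (chartRep_extD hα x₀ n hy).trans (extDeriv_eq_dLoc (chartF x₀ α) y n)

theorem IsSmooth.extD {α : M → Alt d} (hα : IsSmooth α) : IsSmooth (extD α) := by
  rw [isSmooth_iff_smoothAt] at hα ⊢
  intro x₀ y hy
  refine (hα x₀ y hy).dLoc.congr ?_
  filter_upwards [eventually_mem_target x₀ hy] with z hz
  exact chartF_extD (isSmooth_iff_smoothAt.mpr hα) x₀ hz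

end Charts

end

section

/-! ## The operators of a locally conformal symplectic structure -/

/-- A form all of whose components of degree different from the integer `k` vanish. -/
def HomogInt {d : ℕ} (k : ℤ) (α : Alt d) : Prop := ∀ n : ℕ, (n : ℤ) ≠ k → α n = 0

section HomogInt

variable {d : ℕ} {k : ℤ} {α : Alt d}

theorem HomogInt.homog {k : ℕ} (h : HomogInt (k : ℤ) α) : Homog k α :=
  fun n hn => h n (by exact_mod_cast hn)

theorem HomogInt.eq_zero (h : HomogInt k α) (hk : k < 0) : α = 0 :=
  funext fun n => h n (by omega)

theorem HomogInt.smul (hα : HomogInt k α) (c : ℝ) : HomogInt k (c • α) :=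
  fun n hn => by simp [hα n hn]

theorem HomogInt.sum {I : Type*} {s : Finset I} {f : I → Alt d} (hf : ∀ i, HomogInt k (f i)) :
    HomogInt k (∑ i ∈ s, f i) :=
  fun n hn => by simp [Finset.sum_apply, hf _ n hn]

theorem HomogInt.ι (h : HomogInt k α) (X : Vec d) : HomogInt (k - 1) (ι X α) := by
  intro n hn
  rw [ι_apply, h (n + 1) (by push_cast; omega)]
  ext v
  rfl

theorem HomogInt.contrTwo (h : HomogInt k α) (Ω : (Vec d) [⋀^Fin 2]→L[ℝ] ℝ) :
    HomogInt (k - 2) (contrTwo Ω α) := by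
  rw [contrTwo_apply, show k - 2 = k - 1 - 1 by ring]
  exact (HomogInt.sum fun i => (h.ι _).ι _).smul _

theorem HomogInt.starL {m : ℕ} {α : Alt (2 * m)} (h : HomogInt k α)
    (Ω : (Vec (2 * m)) [⋀^Fin 2]→L[ℝ] ℝ) : HomogInt (2 * m - k) (starL m Ω α) := by
  intro l hl
  rw [starL_apply, Finset.sum_apply]
  refine Finset.sum_eq_zero fun j hj => ?_
  by_cases hjk : (j : ℤ) = k
  · have hj' := Finset.mem_range.mp hj
    refine Homog.starAux (l := 2 * m - j) ?_ Ω α l (by omega)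
    rw [show j + (2 * m - j) = 2 * m by omega]
    exact homog_volForm m Ω
  · rw [starAux_congr (β := 0) (by rw [h j hjk]; rfl)]
    simp

end HomogInt

theorem mem_forms_iff {d : ℕ} {M : Type*} [TopologicalSpace M] [ChartedSpace (Vec d) M]
    {k : ℤ} {α : M → Alt d} : α ∈ Forms d M k ↔ IsSmooth α ∧ ∀ x, HomogInt k (α x) := Iff.rfl

theorem homogInt_chartF {d : ℕ} {M : Type*} [TopologicalSpace M] [ChartedSpace (Vec d) M]
    {k : ℤ} {α : M → Alt d} (h : ∀ x, HomogInt k (α x)) (x₀ : M) (y : Vec d) :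
    HomogInt k (chartF x₀ α y) := by
  intro n hn
  rw [chartF_apply, chartRep, h _ n hn]
  ext v
  rfl

theorem extD_mem {d : ℕ} {M : Type*} [TopologicalSpace M] [ChartedSpace (Vec d) M]
    [IsManifold (𝓡 d) ∞ M] {k : ℤ} {α : M → Alt d} (hα : α ∈ Forms d M k) :
    extD α ∈ Forms d M (k + 1) := by
  refine ⟨IsSmooth.extD hα.1, fun x n hn => ?_⟩
  cases n with
  | zero => rfl
  | succ n =>
    have : chartRep x α n = fun _ => 0 :=
      funext fun y => homogInt_chartF hα.2 x y n (by push_cast at hn; omega)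
    have h0 : extDeriv (chartRep x α n) (extChartAt (𝓡 d) x x) = 0 := by
      rw [this]
      ext v
      simp [extDeriv, ContinuousAlternatingMap.alternatizeUncurryFin_apply]
    simp only [extD, h0]
    rfl

namespace LCSStructure

variable {m : ℕ} {M : Type*} [TopologicalSpace M] [ChartedSpace (Vec (2 * m)) M]
  (S : LCSStructure m M)

theorem homog_Ω (x : M) : Homog 2 (S.Ω x) := HomogInt.homog (k := 2) (S.Ω_mem.2 x)

theorem homog_lee (x : M) : Homog 1 (S.lee x) := HomogInt.homog (k := 1) (S.lee_mem.2 x)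

theorem starF_apply (α : M → Alt (2 * m)) (x : M) : S.starF α x = starL m (S.Ω x 2) (α x) :=
  star_eq_starL (S.homog_Ω x) (S.nondeg x) (α x)

theorem intF_apply (α : M → Alt (2 * m)) (x : M) :
    intF S.E α x = ι (flatInv (S.Ω x 2) (S.lee x 1)) (α x) := rfl

theorem contractF_apply (α : M → Alt (2 * m)) (x : M) :
    contractF S.Λ α x = contrTwo (S.Ω x 2) (α x) :=
  contract_bivector (S.nondeg x) (α x)

theorem wedgeF_Ω_apply (α : M → Alt (2 * m)) (x : M) :
    wedgeF S.Ω α x = wedgeTwo (S.Ω x 2) (α x) :=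
  wedge_two (S.homog_Ω x) (α x)

theorem wedgeF_lee_apply (α : M → Alt (2 * m)) (x : M) :
    wedgeF S.lee α x = ε (S.lee x 1) (α x) :=
  wedge_one (S.homog_lee x) (α x)

theorem wedgeF_smul_lee (c : ℝ) (α : M → Alt (2 * m)) :
    wedgeF (c • S.lee) α = c • wedgeF S.lee α := by
  funext x
  have h : Homog 1 ((c • S.lee) x) := (S.homog_lee x).smul c
  change wedge ((c • S.lee) x) (α x) = c • wedge (S.lee x) (α x)
  rw [wedge_one h, wedge_one (S.homog_lee x), ← LinearMap.smul_apply, ← map_smul]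
  rfl

theorem contDiffAt_Ω (x₀ : M) {y : Vec (2 * m)}
    (hy : y ∈ (extChartAt (𝓡 (2 * m)) x₀).target) :
    ContDiffAt ℝ ∞ (chartRep x₀ S.Ω 2) y :=
  (S.Ω_mem.1 x₀ 2).contDiffAt (eventually_mem_target x₀ hy)

theorem contDiffAt_lee (x₀ : M) {y : Vec (2 * m)}
    (hy : y ∈ (extChartAt (𝓡 (2 * m)) x₀).target) :
    ContDiffAt ℝ ∞ (chartRep x₀ S.lee 1) y :=
  (S.lee_mem.1 x₀ 1).contDiffAt (eventually_mem_target x₀ hy)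

variable [IsManifold (𝓡 (2 * m)) ∞ M]

section Chart

variable (x₀ : M) {y : Vec (2 * m)}

theorem chartF_starF (hy : y ∈ (extChartAt (𝓡 (2 * m)) x₀).target) (α : M → Alt (2 * m)) :
    chartF x₀ (S.starF α) y = starL m (chartRep x₀ S.Ω 2 y) (chartF x₀ α y) := by
  obtain ⟨T, hT⟩ := exists_chartF_eq_pullL x₀ hy
  rw [← chartF_apply, hT, hT, hT, starF_apply, pullL_starL T (S.nondeg _)]
  rfl

theorem chartF_intF (hy : y ∈ (extChartAt (𝓡 (2 * m)) x₀).target) (α : M → Alt (2 * m)) :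
    chartF x₀ (intF S.E α) y =
      ι (flatInv (chartRep x₀ S.Ω 2 y) (chartRep x₀ S.lee 1 y)) (chartF x₀ α y) :=
  funext fun n => chartRep_interior_flatInv S.nondeg α x₀ n hy

theorem chartF_contractF (hy : y ∈ (extChartAt (𝓡 (2 * m)) x₀).target) (α : M → Alt (2 * m)) :
    chartF x₀ (contractF S.Λ α) y = contrTwo (chartRep x₀ S.Ω 2 y) (chartF x₀ α y) := by
  rw [← contract_bivector (nondeg_chartRep S.nondeg x₀ hy)]
  exact funext fun n => chartRep_contract_bivector S.nondeg α x₀ n hy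

theorem chartF_wedgeF_Ω (hy : y ∈ (extChartAt (𝓡 (2 * m)) x₀).target) (α : M → Alt (2 * m)) :
    chartF x₀ (wedgeF S.Ω α) y = wedgeTwo (chartRep x₀ S.Ω 2 y) (chartF x₀ α y) := by
  obtain ⟨T, hT⟩ := exists_chartF_eq_pullL x₀ hy
  rw [← chartF_apply, hT, hT, hT, wedgeF_Ω_apply, pullL_wedgeTwo]
  rfl

theorem chartF_wedgeF_lee (hy : y ∈ (extChartAt (𝓡 (2 * m)) x₀).target) (α : M → Alt (2 * m)) :
    chartF x₀ (wedgeF S.lee α) y = ε (chartRep x₀ S.lee 1 y) (chartF x₀ α y) := by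
  obtain ⟨T, hT⟩ := exists_chartF_eq_pullL x₀ hy
  rw [← chartF_apply, hT, hT, hT, wedgeF_lee_apply, pullL_ε]
  rfl

theorem eventually_nondeg (hy : y ∈ (extChartAt (𝓡 (2 * m)) x₀).target) :
    ∀ᶠ z in nhds y, Nondeg (chartRep x₀ S.Ω 2 z) := by
  filter_upwards [eventually_mem_target x₀ hy] with z hz
  exact nondeg_chartRep S.nondeg x₀ hz

theorem leeIdentity (hy : y ∈ (extChartAt (𝓡 (2 * m)) x₀).target) :
    LeeIdentity (chartRep x₀ S.Ω 2 y) (fderiv ℝ (chartRep x₀ S.Ω 2) y).toLinearMap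
      (chartRep x₀ S.lee 1 y) := by
  refine leeIdentity_of_extDeriv ?_
  rw [← chartRep_extD S.Ω_mem.1 x₀ 2 hy, S.extD_Ω]
  exact congrFun (S.chartF_wedgeF_lee x₀ hy S.Ω) 3

theorem fderiv_lee_symm (hy : y ∈ (extChartAt (𝓡 (2 * m)) x₀).target) (X Y : Vec (2 * m)) :
    pairing (fderiv ℝ (chartRep x₀ S.lee 1) y X) Y =
      pairing (fderiv ℝ (chartRep x₀ S.lee 1) y Y) X := by
  refine fderiv_symm_of_extDeriv ?_ X Y
  rw [← chartRep_extD S.lee_mem.1 x₀ 1 hy, S.closed]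
  rfl

end Chart

theorem isSmooth_starF {α : M → Alt (2 * m)} (hα : IsSmooth α) : IsSmooth (S.starF α) := by
  rw [isSmooth_iff_smoothAt] at hα ⊢
  intro x₀ y hy
  refine ((hα x₀ y hy).starL (S.contDiffAt_Ω x₀ hy) (nondeg_chartRep S.nondeg x₀ hy)).congr ?_
  filter_upwards [eventually_mem_target x₀ hy] with z hz
  exact S.chartF_starF x₀ hz α

theorem starF_mem {k : ℤ} {α : M → Alt (2 * m)} (hα : α ∈ Forms (2 * m) M k) :
    S.starF α ∈ Forms (2 * m) M (2 * m - k) := by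
  refine mem_forms_iff.mpr ⟨S.isSmooth_starF hα.1, fun x => ?_⟩
  rw [starF_apply]
  exact HomogInt.starL (hα.2 x) _

theorem intF_mem {k : ℤ} {α : M → Alt (2 * m)} (hα : α ∈ Forms (2 * m) M k) :
    intF S.E α ∈ Forms (2 * m) M (k - 1) :=
  mem_forms_iff.mpr ⟨isSmooth_interior_flatInv S.nondeg S.Ω_mem.1 S.lee_mem.1 hα.1,
    fun x => HomogInt.ι (hα.2 x) _⟩

theorem contractF_mem {k : ℤ} {α : M → Alt (2 * m)} (hα : α ∈ Forms (2 * m) M k) :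
    contractF S.Λ α ∈ Forms (2 * m) M (k - 2) := by
  refine mem_forms_iff.mpr ⟨isSmooth_contract_bivector S.nondeg S.Ω_mem.1 hα.1, fun x => ?_⟩
  rw [contractF_apply]
  exact HomogInt.contrTwo (hα.2 x) _

theorem lieD_mem {k : ℤ} {α : M → Alt (2 * m)} (hα : α ∈ Forms (2 * m) M k) :
    lieD S.E α ∈ Forms (2 * m) M k := by
  have h1 := extD_mem (S.intF_mem hα)
  have h2 := S.intF_mem (extD_mem hα)
  rw [sub_add_cancel] at h1
  rw [add_sub_cancel_right] at h2
  exact add_mem h1 h2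

/-- The commutator of the exterior derivative and the contraction by the bivector. -/
theorem commutator_mem {k : ℤ} {α : M → Alt (2 * m)} (hα : α ∈ Forms (2 * m) M k) :
    contractF S.Λ (extD α) - extD (contractF S.Λ α) ∈ Forms (2 * m) M (k - 1) := by
  have h1 := S.contractF_mem (extD_mem hα)
  have h2 := extD_mem (S.contractF_mem hα)
  rw [show k + 1 - 2 = k - 1 by ring] at h1
  rw [show k - 2 + 1 = k - 1 by ring] at h2
  exact sub_mem h1 h2

end LCSStructure

end

/-! ### Global identities and the intertwining relation. -/

section

theorem intF_sub {d : ℕ} {M : Type*} (X : M → Vec d) (α β : M → Alt d) :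
    intF X (α - β) = intF X α - intF X β := funext fun x => map_sub (ι (X x)) (α x) (β x)

theorem wedgeF_sub {d : ℕ} {M : Type*} (α β γ : M → Alt d) : wedgeF α (β - γ) = wedgeF α β - wedgeF α γ := by
  rw [sub_eq_add_neg, ← neg_one_smul ℝ γ, wedgeF_add, wedgeF_smul, neg_one_smul, ← sub_eq_add_neg]

namespace LCSStructure

variable {m : ℕ} {M : Type*} [TopologicalSpace M] [ChartedSpace (Vec (2 * m)) M]
  (S : LCSStructure m M)

/-- The star operator on fields of forms, as a linear map. -/
def starLin : (M → Alt (2 * m)) →ₗ[ℝ] (M → Alt (2 * m)) where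
  toFun := S.starF
  map_add' α β := by funext x; simp [starF_apply]
  map_smul' c α := by funext x; simp [starF_apply]

theorem starF_add (α β : M → Alt (2 * m)) : S.starF (α + β) = S.starF α + S.starF β :=
  S.starLin.map_add α β

theorem starF_smul (c : ℝ) (α : M → Alt (2 * m)) : S.starF (c • α) = c • S.starF α :=
  S.starLin.map_smul c α

theorem starF_starF (α : M → Alt (2 * m)) : S.starF (S.starF α) = α := by
  funext x
  rw [starF_apply, starF_apply, (S.nondeg x).starL_starL]

theorem starF_contractF (α : M → Alt (2 * m)) :
    S.starF (contractF S.Λ α) = wedgeF S.Ω (S.starF α) := by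
  funext x
  rw [starF_apply, contractF_apply, wedgeF_Ω_apply, starF_apply, (S.nondeg x).starL_contrTwo]

theorem intF_intF (α : M → Alt (2 * m)) : intF S.E (intF S.E α) = 0 := by
  funext x
  exact ι_ι_self _ _

theorem intF_wedgeF_Ω (α : M → Alt (2 * m)) :
    intF S.E (wedgeF S.Ω α) = wedgeF S.lee α + wedgeF S.Ω (intF S.E α) := by
  funext x
  rw [intF_apply, wedgeF_Ω_apply, ι_wedgeTwo, (S.nondeg x).flat_flatInv, Pi.add_apply,
    wedgeF_lee_apply, wedgeF_Ω_apply, intF_apply]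

/-- The scalar term of the Clifford relation is `ω(E) = Λ(ω, ω) = 0`. -/
theorem intF_wedgeF_lee (α : M → Alt (2 * m)) :
    intF S.E (wedgeF S.lee α) = -wedgeF S.lee (intF S.E α) := by
  funext x
  have h : pairing (S.lee x 1) (flatInv (S.Ω x 2) (S.lee x 1)) = 0 :=
    eq_zero_of_eq_neg ((S.nondeg x).pairing_flatInv_swap _ _)
  rw [intF_apply, wedgeF_lee_apply, ι_ε, h, zero_smul, zero_sub, Pi.neg_apply, wedgeF_lee_apply,
    intF_apply]

theorem extD_sub {α β : M → Alt (2 * m)} (hα : IsSmooth α) (hβ : IsSmooth β) :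
    extD (α - β) = extD α - extD β := by
  have hβ' : IsSmooth ((-1 : ℝ) • β) := fun x n => (hβ x n).const_smul (-1 : ℝ)
  rw [sub_eq_add_neg, ← neg_one_smul ℝ β, extD_add hα hβ', extD_smul, neg_one_smul,
    ← sub_eq_add_neg]

/-- `φ̃` as a linear automorphism of the space of all pairs of fields of forms. -/
def phiEquiv : Pairs (2 * m) M ≃ₗ[ℝ] Pairs (2 * m) M where
  toFun := S.phi
  map_add' p q := by
    refine Prod.ext (S.starF_add _ _) ?_
    change intF S.E (S.starF (p.2 + q.2)) - S.starF (p.1 + q.1) = _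
    rw [starF_add, starF_add, intF_add, add_sub_add_comm]
    rfl
  map_smul' c p := by
    refine Prod.ext (S.starF_smul _ _) ?_
    change intF S.E (S.starF (c • p.2)) - S.starF (c • p.1) = _
    rw [starF_smul, starF_smul, intF_smul, ← smul_sub]
    rfl
  -- The first component determines `β = ⋆q₁`; subtracting the second from `i_E q₁` then leaves
  -- `⋆α`.
  invFun q := (S.starF (intF S.E q.1 - q.2), S.starF q.1)
  left_inv p := by
    refine Prod.ext ?_ (S.starF_starF _)
    change S.starF (intF S.E (S.starF p.2) - (intF S.E (S.starF p.2) - S.starF p.1)) = p.1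
    rw [sub_sub_cancel, starF_starF]
  right_inv q := by
    refine Prod.ext (S.starF_starF _) ?_
    change intF S.E (S.starF (S.starF q.1)) - S.starF (S.starF (intF S.E q.1 - q.2)) = q.2
    rw [starF_starF, starF_starF, sub_sub_cancel]

theorem phiEquiv_apply (p : Pairs (2 * m) M) : S.phiEquiv p = S.phi p := rfl

theorem mem_cocycles_iff {k : ℤ} {z : Pairs (2 * m) M} :
    z ∈ S.Cocycles k ↔ z ∈ PairForms (2 * m) M k ∧ S.dTilde z = 0 := by
  constructor
  · rintro ⟨p, hp, rfl⟩
    exact ⟨p.2, hp⟩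
  · rintro ⟨hz, h⟩
    exact ⟨⟨z, hz⟩, h, rfl⟩

variable [IsManifold (𝓡 (2 * m)) ∞ M]

theorem isSmooth_intF {α : M → Alt (2 * m)} (hα : IsSmooth α) : IsSmooth (intF S.E α) :=
  isSmooth_interior_flatInv S.nondeg S.Ω_mem.1 S.lee_mem.1 hα

theorem isSmooth_contractF {α : M → Alt (2 * m)} (hα : IsSmooth α) :
    IsSmooth (contractF S.Λ α) :=
  isSmooth_contract_bivector S.nondeg S.Ω_mem.1 hα

theorem starF_commutator_nat {j : ℕ} {α : M → Alt (2 * m)} (hα : α ∈ Forms (2 * m) M j) :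
    S.starF (contractF S.Λ (extD α) - extD (contractF S.Λ α) + (j : ℝ) • intF S.E α) =
      (-1 : ℝ) ^ (j + 1) • (extD (S.starF α) - ((m : ℝ) + 1) • wedgeF S.lee (S.starF α) -
        wedgeF S.Ω (intF S.E (S.starF α))) := by
  refine eq_of_chartF_eq fun x₀ y hy => ?_
  have hs := isSmooth_iff_smoothAt.mp hα.1 x₀ y hy
  have hj : ∀ z, Homog j (chartF x₀ α z) := fun z => (homogInt_chartF hα.2 x₀ z).homog
  have key := starL_commutator (S.contDiffAt_Ω x₀ hy) (S.eventually_nondeg x₀ hy) hs hj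
    (S.leeIdentity x₀ hy)
  have h1 : dLoc (chartF x₀ (contractF S.Λ α)) y =
      dLoc (fun z => contrTwo (chartRep x₀ S.Ω 2 z) (chartF x₀ α z)) y := by
    refine dLoc_congr ?_
    filter_upwards [eventually_mem_target x₀ hy] with z hz
    exact S.chartF_contractF x₀ hz α
  have h2 : dLoc (chartF x₀ (S.starF α)) y =
      dLoc (fun z => starL m (chartRep x₀ S.Ω 2 z) (chartF x₀ α z)) y := by
    refine dLoc_congr ?_
    filter_upwards [eventually_mem_target x₀ hy] with z hz
    exact S.chartF_starF x₀ hz α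
  rw [← h1, ← h2, ← chartF_extD (S.isSmooth_contractF hα.1) x₀ hy,
    ← chartF_extD (S.isSmooth_starF hα.1) x₀ hy, ← chartF_extD hα.1 x₀ hy,
    ← S.chartF_contractF x₀ hy, ← S.chartF_intF x₀ hy, ← S.chartF_starF x₀ hy,
    ← S.chartF_intF x₀ hy, ← S.chartF_wedgeF_lee x₀ hy, ← S.chartF_wedgeF_Ω x₀ hy] at key
  refine Eq.trans ?_ key
  rw [S.chartF_starF x₀ hy]
  rfl

/-- `⋆ ([i(Λ), d] α + k i_E α) = (-1)^{k+1} (d - (m + 1) θ ∧ - Ω ∧ i_E) ⋆ α` on `k`-forms. -/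
theorem starF_commutator {k : ℤ} {α : M → Alt (2 * m)} (hα : α ∈ Forms (2 * m) M k) :
    S.starF (contractF S.Λ (extD α) - extD (contractF S.Λ α) + (k : ℝ) • intF S.E α) =
      (-1 : ℝ) ^ (k + 1) • (extD (S.starF α) - ((m : ℝ) + 1) • wedgeF S.lee (S.starF α) -
        wedgeF S.Ω (intF S.E (S.starF α))) := by
  rcases lt_or_ge k 0 with hk | hk
  · obtain rfl : α = 0 := funext fun x => HomogInt.eq_zero (hα.2 x) hk
    -- For `α = 0` the natural-degree statement, read in degrees zero and one, equates the left side
    -- with both `-R` and `R`, where `R` is the bracket on the right; hence both vanish and the sign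
    -- for negative `k` is immaterial.
    have h0 := S.starF_commutator_nat (zero_mem (Forms (2 * m) M ((0 : ℕ) : ℤ)))
    have h1 : intF S.E (0 : M → Alt (2 * m)) = 0 := funext fun x => map_zero (ι (S.E x))
    rw [h1, smul_zero] at h0 ⊢
    have h2 := S.starF_commutator_nat (zero_mem (Forms (2 * m) M ((1 : ℕ) : ℤ)))
    rw [h1, smul_zero, h0, ← sub_eq_zero, ← sub_smul] at h2
    have h3 := (smul_eq_zero.mp h2).resolve_left (by norm_num)
    rw [h0, h3, smul_zero, smul_zero]
  · lift k to ℕ using hk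
    have := S.starF_commutator_nat hα
    rw [Int.cast_natCast, this]
    norm_cast

theorem starF_lieD_nat {j : ℕ} {α : M → Alt (2 * m)} (hα : α ∈ Forms (2 * m) M j) :
    S.starF (lieD S.E α) = lieD S.E (S.starF α) := by
  refine eq_of_chartF_eq fun x₀ y hy => ?_
  have hs := isSmooth_iff_smoothAt.mp hα.1 x₀ y hy
  have hj : ∀ z, Homog j (chartF x₀ α z) := fun z => (homogInt_chartF hα.2 x₀ z).homog
  have key := starL_lie (S.contDiffAt_Ω x₀ hy) (S.eventually_nondeg x₀ hy) (S.contDiffAt_lee x₀ hy)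
    hs hj (S.leeIdentity x₀ hy) (S.fderiv_lee_symm x₀ hy)
  have h1 : dLoc (chartF x₀ (intF S.E α)) y = dLoc (fun z => ι (flatInv (chartRep x₀ S.Ω 2 z)
      (chartRep x₀ S.lee 1 z)) (chartF x₀ α z)) y := by
    refine dLoc_congr ?_
    filter_upwards [eventually_mem_target x₀ hy] with z hz
    exact S.chartF_intF x₀ hz α
  have h2 : dLoc (chartF x₀ (S.starF α)) y =
      dLoc (fun z => starL m (chartRep x₀ S.Ω 2 z) (chartF x₀ α z)) y := by
    refine dLoc_congr ?_
    filter_upwards [eventually_mem_target x₀ hy] with z hz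
    exact S.chartF_starF x₀ hz α
  have h3 : dLoc (chartF x₀ (intF S.E (S.starF α))) y =
      dLoc (fun z => ι (flatInv (chartRep x₀ S.Ω 2 z) (chartRep x₀ S.lee 1 z))
        (starL m (chartRep x₀ S.Ω 2 z) (chartF x₀ α z))) y := by
    refine dLoc_congr ?_
    filter_upwards [eventually_mem_target x₀ hy] with z hz
    rw [S.chartF_intF x₀ hz, S.chartF_starF x₀ hz]
  have hst := S.isSmooth_starF hα.1
  rw [← h1, ← h2, ← h3, ← chartF_extD (S.isSmooth_intF hα.1) x₀ hy,
    ← chartF_extD (S.isSmooth_intF hst) x₀ hy, ← chartF_extD hst x₀ hy,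
    ← chartF_extD hα.1 x₀ hy, ← S.chartF_intF x₀ hy, ← S.chartF_intF x₀ hy] at key
  refine Eq.trans ?_ key
  rw [S.chartF_starF x₀ hy]
  rfl

/-- The star operator commutes with the Lie derivative along `E`. -/
theorem starF_lieD {k : ℤ} {α : M → Alt (2 * m)} (hα : α ∈ Forms (2 * m) M k) :
    S.starF (lieD S.E α) = lieD S.E (S.starF α) := by
  rcases lt_or_ge k 0 with hk | hk
  · obtain rfl : α = 0 := funext fun x => HomogInt.eq_zero (hα.2 x) hk
    exact S.starF_lieD_nat (zero_mem (Forms (2 * m) M ((0 : ℕ) : ℤ)))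
  · lift k to ℕ using hk
    exact S.starF_lieD_nat hα

/-- `φ̃` intertwines `δ` and `(-1)ᵏ d̃`. -/
theorem phi_delta {k : ℤ} {p : Pairs (2 * m) M} (hp : p ∈ PairForms (2 * m) M k) :
    S.phi (S.delta k p) = (-1 : ℝ) ^ k • S.dTilde (S.phi p) := by
  obtain ⟨α, β⟩ := p
  obtain ⟨hα, hβ⟩ : α ∈ Forms (2 * m) M k ∧ β ∈ Forms (2 * m) M (k - 1) := hp
  have hsq : (-1 : ℝ) ^ k * (-1 : ℝ) ^ k = 1 := by
    rw [← mul_zpow]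
    simp
  have hk1 : (-1 : ℝ) ^ (k + 1) = -(-1 : ℝ) ^ k := by
    rw [zpow_add₀ (by norm_num)]
    simp
  have hF := S.starF_commutator hα
  have hF' := S.starF_commutator hβ
  rw [sub_add_cancel] at hF'
  rw [hk1] at hF
  have hL := S.starF_lieD hβ
  have hsβ := S.isSmooth_starF hβ.1
  have hsα := S.isSmooth_starF hα.1
  have h1 : S.starF (S.delta k (α, β)).2 = (-1 : ℝ) ^ k • (S.dTilde (S.phi (α, β))).1 := by
    change S.starF (contractF S.Λ (extD β) - extD (contractF S.Λ β) + ((k : ℝ) - 1) • intF S.E β +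
      (-1 : ℝ) ^ k • contractF S.Λ α) = (-1 : ℝ) ^ k • (extD (S.starF β) +
        wedgeF ((-((m : ℝ) + 1)) • S.lee) (S.starF β) -
          wedgeF S.Ω (intF S.E (S.starF β) - S.starF α))
    push_cast at hF'
    rw [starF_add, hF', starF_smul, starF_contractF, wedgeF_smul_lee, wedgeF_sub]
    module
  refine Prod.ext h1 ?_
  change intF S.E (S.starF (S.delta k (α, β)).2) - S.starF (S.delta k (α, β)).1 = _
  rw [h1]
  change intF S.E ((-1 : ℝ) ^ k • (extD (S.starF β) +
        wedgeF ((-((m : ℝ) + 1)) • S.lee) (S.starF β) -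
          wedgeF S.Ω (intF S.E (S.starF β) - S.starF α))) -
      S.starF (contractF S.Λ (extD α) - extD (contractF S.Λ α) + (k : ℝ) • intF S.E α +
        (-1 : ℝ) ^ k • lieD S.E β) =
    (-1 : ℝ) ^ k • -(extD (intF S.E (S.starF β) - S.starF α) +
      wedgeF ((-(m : ℝ)) • S.lee) (intF S.E (S.starF β) - S.starF α))
  rw [starF_add, hF, starF_smul, hL, extD_sub (S.isSmooth_intF hsβ) hsα]
  -- The term `i_E d⋆β` cancels against half of `L_E⋆β`, leaving `-d i_E⋆β`. Each `i_E(Ω ∧ γ)`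
  -- releases one `ω ∧ γ`, which lowers the coefficient `m + 1` of `ω₁` to the `m` of `ω₀`.
  simp only [lieD, wedgeF_smul_lee, wedgeF_sub, intF_smul, intF_sub, intF_add, intF_wedgeF_lee,
    intF_wedgeF_Ω, intF_intF]
  have h0 : wedgeF S.Ω (0 : M → Alt (2 * m)) = 0 := by
    have := wedgeF_smul S.Ω 0 (0 : M → Alt (2 * m))
    rwa [zero_smul, zero_smul] at this
  rw [h0]
  module

/-! ### Degrees, cycles and boundaries under `φ̃`. -/

theorem phi_mem_iff {k : ℤ} {p : Pairs (2 * m) M} :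
    S.phi p ∈ PairForms (2 * m) M (2 * m + 1 - k) ↔ p ∈ PairForms (2 * m) M k := by
  constructor
  · rintro ⟨h1, h2⟩
    have h3 := S.starF_mem h1
    rw [show (S.phi p).1 = S.starF p.2 from rfl, starF_starF] at h3
    have h4 := S.starF_mem (sub_mem (S.intF_mem h1) h2)
    rw [show intF S.E (S.phi p).1 - (S.phi p).2 = S.starF p.1 from sub_sub_cancel _ _,
      starF_starF] at h4
    rw [show (2 * m - (2 * m + 1 - k) : ℤ) = k - 1 by ring] at h3
    rw [show (2 * m - (2 * m + 1 - k - 1) : ℤ) = k by ring] at h4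
    exact ⟨h4, h3⟩
  · rintro ⟨h1, h2⟩
    have h3 := S.starF_mem h2
    have h4 := S.intF_mem h3
    have h5 := S.starF_mem h1
    rw [show (2 * m - (k - 1) : ℤ) = 2 * m + 1 - k by ring] at h3
    rw [show (2 * m - (k - 1) - 1 : ℤ) = 2 * m + 1 - k - 1 by ring] at h4
    rw [show (2 * m - k : ℤ) = 2 * m + 1 - k - 1 by ring] at h5
    exact ⟨h3, sub_mem h4 h5⟩

theorem delta_mem {k : ℤ} {p : Pairs (2 * m) M} (hp : p ∈ PairForms (2 * m) M k) :
    S.delta k p ∈ PairForms (2 * m) M (k - 1) := by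
  have h1 := S.commutator_mem hp.1
  have h2 := S.commutator_mem hp.2
  have h3 := S.contractF_mem hp.1
  rw [show k - 2 = k - 1 - 1 by ring] at h3
  exact ⟨add_mem (add_mem h1 (Submodule.smul_mem _ _ (S.intF_mem hp.1)))
      (Submodule.smul_mem _ _ (S.lieD_mem hp.2)),
    add_mem (add_mem h2 (Submodule.smul_mem _ _ (S.intF_mem hp.2))) (Submodule.smul_mem _ _ h3)⟩

theorem mem_cycles_iff {k : ℤ} {z : Pairs (2 * m) M} :
    z ∈ S.Cycles k ↔ z ∈ PairForms (2 * m) M k ∧ S.delta k z = 0 := by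
  constructor
  · rintro ⟨p, hp, rfl⟩
    exact ⟨p.2, hp⟩
  · rintro ⟨hz, h⟩
    exact ⟨⟨z, hz⟩, h, rfl⟩

/-- By the intertwining relation, `d̃φ̃(z)` is `φ̃(δz)` up to a nonzero scalar, and `φ̃` is
injective. -/
theorem phi_mem_cocycles_iff {k : ℤ} {z : Pairs (2 * m) M} :
    S.phi z ∈ S.Cocycles (2 * m + 1 - k) ↔ z ∈ S.Cycles k := by
  rw [mem_cocycles_iff, mem_cycles_iff, phi_mem_iff]
  refine and_congr_right fun hz => ?_
  rw [← S.phiEquiv.map_eq_zero_iff (x := S.delta k z), phiEquiv_apply, S.phi_delta hz, smul_eq_zero]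
  have : (-1 : ℝ) ^ k ≠ 0 := zpow_ne_zero _ (by norm_num)
  simp [this]

theorem phi_mem_coboundaries_iff {k : ℤ} {z : Pairs (2 * m) M} :
    S.phi z ∈ S.Coboundaries (2 * m + 1 - k) ↔ z ∈ S.Boundaries k := by
  have hne : (-1 : ℝ) ^ (k + 1) ≠ 0 := zpow_ne_zero _ (by norm_num)
  have hdeg : (2 * m + 1 - (k + 1) : ℤ) = 2 * m + 1 - k - 1 := by ring
  constructor
  · rintro ⟨q, hq⟩
    change S.dTilde q = S.phi z at hq
    -- A primitive `q` of `φ̃(z)` pulls back to some `p`, which has degree `k + 1` because `φ̃`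
    -- detects degrees; then `δp = (-1)^{k+1} z`, and the sign is absorbed by linearity.
    obtain ⟨p, hp⟩ := S.phiEquiv.surjective (q : Pairs (2 * m) M)
    rw [phiEquiv_apply] at hp
    have hpm : p ∈ PairForms (2 * m) M (k + 1) := by
      rw [← S.phi_mem_iff, hp, hdeg]
      exact q.2
    have h1 := S.phi_delta hpm
    rw [hp, hq] at h1
    have h2 : S.deltaLin (k + 1) ⟨p, hpm⟩ = (-1 : ℝ) ^ (k + 1) • z := by
      refine S.phiEquiv.injective ?_
      rw [map_smul]
      exact h1
    rw [← inv_smul_smul₀ hne z, ← h2]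
    exact Submodule.smul_mem _ _ ⟨_, rfl⟩
  · rintro ⟨p, hp⟩
    change S.delta (k + 1) p = z at hp
    have h1 := S.phi_delta p.2
    rw [hp] at h1
    rw [h1]
    refine Submodule.smul_mem _ _ ⟨⟨S.phi p, ?_⟩, rfl⟩
    rw [← hdeg, phi_mem_iff]
    exact p.2

/-- `φ̃` from cycles to cocycles. -/
def cyclesEquiv (k : ℤ) : S.Cycles k ≃ₗ[ℝ] S.Cocycles (2 * m + 1 - k) :=
  S.phiEquiv.ofSubmodules (S.Cycles k) (S.Cocycles (2 * m + 1 - k)) (by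
    ext w
    obtain ⟨z, rfl⟩ := S.phiEquiv.surjective w
    rw [Submodule.mem_map_equiv, LinearEquiv.symm_apply_apply, phiEquiv_apply, phi_mem_cocycles_iff])

/-- The isomorphism induced by `φ̃` in homology. -/
def homologyEquiv (k : ℤ) : S.LJHomology k ≃ₗ[ℝ] S.TildeCohomology (2 * m + 1 - k) :=
  Submodule.Quotient.equiv _ _ (S.cyclesEquiv k) (by
    ext w
    obtain ⟨z, rfl⟩ := (S.cyclesEquiv k).surjective w
    rw [Submodule.mem_map_equiv, LinearEquiv.symm_apply_apply]
    exact S.phi_mem_coboundaries_iff.symm)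

end LCSStructure

end

end LCSForms

end

/-- For a locally conformal symplectic manifold `(M, Ω)` of dimension `2m` with Lee form `ω`:
`φ̃` is an isomorphism of `C^∞(M)`-modules from `Ωᵏ ⊕ Ωᵏ⁻¹` onto `Ω²ᵐ⁺¹⁻ᵏ ⊕ Ω²ᵐ⁻ᵏ`, it
intertwines `δ` with `(-1)ᵏ d̃`, and it induces an isomorphism
`H_k^{LJ}(M) ≅ H̃^{2m+1-k}(M)`. -/
theorem theorem4p15 (m : ℕ) (M : Type*) [TopologicalSpace M]
    [ChartedSpace (EuclideanSpace ℝ (Fin (2 * m))) M] [IsManifold (𝓡 (2 * m)) ∞ M]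
    (S : LCSForms.LCSStructure m M) (k : ℤ) :
    (Set.BijOn S.phi (LCSForms.PairForms (2 * m) M k)
        (LCSForms.PairForms (2 * m) M (2 * m + 1 - k)) ∧
      (∀ p ∈ LCSForms.PairForms (2 * m) M k, ∀ q ∈ LCSForms.PairForms (2 * m) M k,
        S.phi (p + q) = S.phi p + S.phi q) ∧
      (∀ f : C^∞⟮𝓡 (2 * m), M; 𝓘(ℝ, ℝ), ℝ⟯, ∀ p ∈ LCSForms.PairForms (2 * m) M k,
        S.phi (fun x => f x • p.1 x, fun x => f x • p.2 x) =
          (fun x => f x • (S.phi p).1 x, fun x => f x • (S.phi p).2 x))) ∧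
    (∀ p ∈ LCSForms.PairForms (2 * m) M k,
      S.delta k p ∈ LCSForms.PairForms (2 * m) M (k - 1) ∧
        S.phi (S.delta k p) = (-1 : ℝ) ^ k • S.dTilde (S.phi p)) ∧
    ∃ e : S.LJHomology k ≃ₗ[ℝ] S.TildeCohomology (2 * m + 1 - k),
      ∀ z : S.Cycles k, ∃ w : S.Cocycles (2 * m + 1 - k),
        (w : LCSForms.Pairs (2 * m) M) = S.phi z ∧
          e (Submodule.Quotient.mk z) = Submodule.Quotient.mk w := by
  refine ⟨⟨⟨fun p hp => S.phi_mem_iff.mpr hp, S.phiEquiv.injective.injOn, fun q hq => ?_⟩,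
    fun p _ q _ => S.phiEquiv.map_add p q, fun f p _ => ?_⟩,
    fun p hp => ⟨S.delta_mem hp, S.phi_delta hp⟩,
    ⟨S.homologyEquiv k, fun z => ⟨S.cyclesEquiv k z, rfl, rfl⟩⟩⟩
  · obtain ⟨p, rfl⟩ := S.phiEquiv.surjective q
    exact ⟨p, S.phi_mem_iff.mp hq, rfl⟩
  -- Only pointwise linearity is involved: no derivative occurs in `φ̃`.
  · have h (u : M → LCSForms.Alt (2 * m)) :
        S.starF (fun x => f x • u x) = fun x => f x • S.starF u x := by
      funext x
      simp only [LCSForms.LCSStructure.starF_apply, map_smul]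
    refine Prod.ext (h p.2) ?_
    change LCSForms.intF S.E (S.starF fun x => f x • p.2 x) - S.starF (fun x => f x • p.1 x) = _
    rw [h, h]
    funext x
    change LCSForms.interior (S.E x) (f x • S.starF p.2 x) - f x • S.starF p.1 x =
      f x • (LCSForms.interior (S.E x) (S.starF p.2 x) - S.starF p.1 x)
    rw [smul_sub, ← LCSForms.ι_eq_interior, map_smul]
    rfl
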